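/- Let $a>0$, $\gamma>1$, $L>0$, $P>0$, $\underline\rho>0$, put $\underline c=\sqrt{a\gamma}\,\underline\rho^{(\gamma-1)/2}$ and let $\underline u>\underline c$. Let $\alpha\in C^2(\mathbb R)$ be $P$-periodic with $\int_0^t\alpha(s)\,ds\ge 0$ for all $t\ge 0$ and $\int_0^P\alpha(s)\,ds=0$. Put $$r_\alpha(t)=\tfrac12 e^{\int_0^t\alpha}\,\underline u-\tfrac{1}{\gamma-1}\underline c,\qquad s_\alpha(t)=\tfrac12 e^{\int_0^t\alpha}\,\underline u+\tfrac{1}{\gamma-1}\underline c .$$ For $m=(m_1,m_2)^T$ write $r=r_\alpha+m_1$, $s=s_\alpha+m_2$, $u=r+s$, $c=\frac{\gamma-1}{2}(s-r)$, $\lambda_1=u-c$, $\lambda_2=u+c$ and $\Lambda=\mathrm{diag}(1/\lambda_1,1/\lambda_2)$. For $T_1>0$ and a function $m_0:[0,T_1]\to\mathbb R^2$ (the boundary perturbation $m_0=(r_l-r_\alpha,\,s_l-s_\alpha)^T$ of the inflow Riemann invariants $r_l,s_l$), consider on $(t,x)\in[0,T_1]\times[0,L]$ the initial-boundary value problem $$(\mathrm{PIB1})\qquad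 m_x+\Lambda m_t=\frac{\alpha(t)}{2}\,\Lambda\begin{pmatrix}m_1+m_2\\ m_1+m_2\end{pmatrix},\qquad m(t,0)=m_0(t),\qquad m(0,x)=0,$$ where a solution is understood to have $\lambda_1,\lambda_2\neq0$ on $[0,T_1]\times[0,L]$. **Theorem 4.2.** For every $T_0>0$ there exist $\varepsilon_1>0$, $C_1>0$ and $T_1>T_0$ such that the following holds for every $\varepsilon\in(0,\varepsilon_1)$. If $m_0\in H^2([0,T_1])$ satisfies the compatibility conditions $m_0(0)=0$ and $m_0'(0)=0$, and $\|m_0\|_{H^2([0,T_1])}\le\varepsilon$, then (PIB1) has a unique solution $m\in C([0,L];H^2([0,T_1]))\cap C^1([0,L];H^1([0,T_1]))$, and this solution satisfies $$\sup_{x\in[0,L]}\|m\|_{H^2([0,T_1])}+\sup_{x\in[0,L]}\|m_x\|_{H^1([0,T_1])}\le C_1\varepsilon .$$ -/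

import Mathlib

open MeasureTheory Set
open scoped ContDiff

namespace SupersonicDuct

/-- The values of `m = (m₁, m₂)`: the Euclidean plane. -/
abbrev State : Type := EuclideanSpace ℝ (Fin 2)

/-- Lebesgue measure on the time interval `(0, T)`. -/
noncomputable abbrev timeMeasure (T : ℝ) : Measure ℝ := volume.restrict (Ioo 0 T)

/-- `L²((0, T); ℝ²)`. -/
abbrev L2 (T : ℝ) : Type := Lp State 2 (timeMeasure T)

/-- Smooth real functions with compact support contained in `(0, T)`. -/
def IsTest (T : ℝ) (φ : ℝ → ℝ) : Prop :=
  ContDiff ℝ ∞ φ ∧ HasCompactSupport φ ∧ tsupport φ ⊆ Ioo 0 T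

/-- `g` is the weak derivative of `f` on `(0, T)`. -/
def IsWeakDeriv {T : ℝ} (f g : L2 T) : Prop :=
  ∀ φ : ℝ → ℝ, IsTest T φ →
    ∫ t, deriv φ t • f t ∂(timeMeasure T) = -∫ t, φ t • g t ∂(timeMeasure T)

theorem integrable_smul_L2 {T : ℝ} {ψ : ℝ → ℝ} (hψ : Continuous ψ) (hc : HasCompactSupport ψ)
    (f : L2 T) : Integrable (fun t => ψ t • f t) (timeMeasure T) := by
  have hf : Integrable (f : ℝ → State) (timeMeasure T) :=
    (Lp.memLp f).integrable (by norm_num)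
  obtain ⟨C, hC⟩ := hc.exists_bound_of_continuous hψ
  exact hf.bdd_smul C hψ.aestronglyMeasurable (Filter.Eventually.of_forall hC)

theorem IsTest.integrable {T : ℝ} {φ : ℝ → ℝ} (h : IsTest T φ) (f : L2 T) :
    Integrable (fun t => φ t • f t) (timeMeasure T) :=
  integrable_smul_L2 h.1.continuous h.2.1 f

theorem IsTest.integrable_deriv {T : ℝ} {φ : ℝ → ℝ} (h : IsTest T φ) (f : L2 T) :
    Integrable (fun t => deriv φ t • f t) (timeMeasure T) :=
  integrable_smul_L2 (h.1.continuous_deriv (by norm_num)) h.2.1.deriv f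

theorem IsWeakDeriv.zero {T : ℝ} : IsWeakDeriv (0 : L2 T) 0 := by
  intro φ _
  have h0 : ((0 : L2 T) : ℝ → State) =ᵐ[timeMeasure T] 0 := Lp.coeFn_zero _ _ _
  have h1 : ∀ ψ : ℝ → ℝ, ∫ t, ψ t • ((0 : L2 T) : ℝ → State) t ∂(timeMeasure T) = 0 := by
    intro ψ
    refine integral_eq_zero_of_ae ?_
    filter_upwards [h0] with t ht
    simp only [ht, Pi.zero_apply, smul_zero]
  rw [h1, h1, neg_zero]

theorem integral_smul_add {T : ℝ} {ψ : ℝ → ℝ} (f g : L2 T)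
    (hf : Integrable (fun t => ψ t • f t) (timeMeasure T))
    (hg : Integrable (fun t => ψ t • g t) (timeMeasure T)) :
    ∫ t, ψ t • ((f + g : L2 T) : ℝ → State) t ∂(timeMeasure T) =
      ∫ t, ψ t • f t ∂(timeMeasure T) + ∫ t, ψ t • g t ∂(timeMeasure T) := by
  rw [← integral_add hf hg]
  refine integral_congr_ae ?_
  filter_upwards [Lp.coeFn_add f g] with t ht
  simp only [ht, Pi.add_apply, smul_add]

theorem integral_smul_smul {T : ℝ} {ψ : ℝ → ℝ} (c : ℝ) (f : L2 T) :
    ∫ t, ψ t • ((c • f : L2 T) : ℝ → State) t ∂(timeMeasure T) = c • ∫ t, ψ t • f t ∂(timeMeasure T) := by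
  rw [← integral_smul]
  refine integral_congr_ae ?_
  filter_upwards [Lp.coeFn_smul c f] with t ht
  simp only [ht, Pi.smul_apply]
  rw [smul_comm]

theorem IsWeakDeriv.add {T : ℝ} {f g f' g' : L2 T} (h : IsWeakDeriv f g)
    (h' : IsWeakDeriv f' g') : IsWeakDeriv (f + f') (g + g') := by
  intro φ hφ
  rw [integral_smul_add _ _ (hφ.integrable_deriv f) (hφ.integrable_deriv f'),
    integral_smul_add _ _ (hφ.integrable g) (hφ.integrable g'), h φ hφ, h' φ hφ, neg_add]

theorem IsWeakDeriv.smul {T : ℝ} {f g : L2 T} (c : ℝ) (h : IsWeakDeriv f g) :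
    IsWeakDeriv (c • f) (c • g) := by
  intro φ hφ
  rw [integral_smul_smul, integral_smul_smul, h φ hφ, smul_neg]

/-- The Sobolev space `Hᵏ((0, T); ℝ²)`. An element is an `L²` function `f 0` together with its weak
derivatives `f 1, …, f k`, which are uniquely determined by `f 0`; the norm, inherited from the
`ℓ²` sum of `k + 1` copies of `L²`, is `(∑_{i ≤ k} ‖∂ₜⁱ f‖²_{L²})^{1/2}`. -/
def Sobolev (k : ℕ) (T : ℝ) : Submodule ℝ (PiLp 2 (fun _ : Fin (k + 1) => L2 T)) where
  carrier := {f | ∀ i : Fin k, IsWeakDeriv (f i.castSucc) (f i.succ)}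
  zero_mem' := fun _ => IsWeakDeriv.zero
  add_mem' := fun ha hb i => (ha i).add (hb i)
  smul_mem' := fun c _ ha i => (ha i).smul c

/-- The `i`-th weak time derivative of `f ∈ Hᵏ`. -/
def wderiv {k : ℕ} {T : ℝ} (f : Sobolev k T) (i : Fin (k + 1)) : L2 T := f.1 i

/-- The inclusion of `H²` in `H¹`. -/
def toH1 {T : ℝ} (f : Sobolev 2 T) : Sobolev 1 T :=
  ⟨WithLp.toLp 2 fun i => wderiv f i.castSucc, fun i => f.2 i.castSucc⟩

/-- `g` is the continuous representative on `[0, T]` of the `L²` class `f`. -/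
def IsContRep {T : ℝ} (f : L2 T) (g : ℝ → State) : Prop :=
  ContinuousOn g (Icc 0 T) ∧ f =ᵐ[timeMeasure T] g

/-- `f` has a continuous representative on `[0, T]`, and this vanishes at `t = 0`. -/
def VanishesAtZero {T : ℝ} (f : L2 T) : Prop :=
  ∃ g : ℝ → State, IsContRep f g ∧ g 0 = 0

/-- The constants of the problem, for the pressure law `p = a ρ^γ` in a duct of length `L`:
`ρb`, `ub` are the background density and velocity, `α` the coefficient of the external force
and `P` its period. -/
structure Duct where
  a : ℝ
  γ : ℝ
  ρb : ℝ
  ub : ℝ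
  L : ℝ
  P : ℝ
  α : ℝ → ℝ

namespace Duct

variable (d : Duct)

/-- The background sound speed `√(aγ) ρb^((γ-1)/2)`. -/
noncomputable def cb : ℝ := Real.sqrt (d.a * d.γ) * d.ρb ^ ((d.γ - 1) / 2)

/-- The standing assumptions: a polytropic gas, a supersonic background state, and a `C²`,
`P`-periodic force coefficient with nonnegative primitive and zero mean. -/
structure Admissible : Prop where
  a_pos : 0 < d.a
  one_lt_γ : 1 < d.γ
  ρb_pos : 0 < d.ρb
  supersonic : d.cb < d.ub
  L_pos : 0 < d.L
  P_pos : 0 < d.P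
  α_smooth : ContDiff ℝ 2 d.α
  α_periodic : Function.Periodic d.α d.P
  α_primitive : ∀ t : ℝ, 0 ≤ t → 0 ≤ ∫ s in (0 : ℝ)..t, d.α s
  α_mean : ∫ s in (0 : ℝ)..d.P, d.α s = 0

/-- The background velocity `exp (∫₀ᵗ α) ub`. -/
noncomputable def uα (t : ℝ) : ℝ := Real.exp (∫ s in (0 : ℝ)..t, d.α s) * d.ub

/-- The background Riemann invariant `r_α`. -/
noncomputable def rα (t : ℝ) : ℝ := 1 / 2 * d.uα t - 1 / (d.γ - 1) * d.cb

/-- The background Riemann invariant `s_α`. -/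
noncomputable def sα (t : ℝ) : ℝ := 1 / 2 * d.uα t + 1 / (d.γ - 1) * d.cb

/-- The velocity `u` in terms of the Riemann invariants
`r = (u - 2c/(γ-1))/2`, `s = (u + 2c/(γ-1))/2`. -/
def velocity (r s : ℝ) : ℝ := r + s

/-- The sound speed `c` in terms of the Riemann invariants. -/
noncomputable def soundSpeed (r s : ℝ) : ℝ := (d.γ - 1) / 2 * (s - r)

/-- The characteristic speeds `λ₁ = u - c` and `λ₂ = u + c`. -/
noncomputable def charSpeed (r s : ℝ) : Fin 2 → ℝ :=
  ![velocity r s - d.soundSpeed r s, velocity r s + d.soundSpeed r s]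

/-- The characteristic speeds at time `t` when `(r, s) = (r_α(t), s_α(t)) + m`. -/
noncomputable def speed (t : ℝ) (m : State) : Fin 2 → ℝ :=
  d.charSpeed (d.rα t + m 0) (d.sα t + m 1)

/-- The matrix `Λ = diag (1/λ₁, 1/λ₂)`. -/
noncomputable def Lam (t : ℝ) (m : State) : Matrix (Fin 2) (Fin 2) ℝ :=
  Matrix.diagonal fun i => 1 / d.speed t m i

/-- `m ∈ C([0, L]; H²(0, T)) ∩ C¹([0, L]; H¹(0, T))` solves
`m_x + Λ m_t = (α / 2) Λ (m₁ + m₂, m₁ + m₂)ᵀ` on `[0, T] × [0, L]`, `m(t, 0) = m₀(t)`,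
`m(0, x) = 0`. A function `m(t, x)` is regarded as a map from `x` to functions of `t`; its values
outside `[0, L]` are irrelevant. -/
structure IsSolution {T : ℝ} (m₀ : Sobolev 2 T) (m : ℝ → Sobolev 2 T) : Prop where
  continuousOn : ContinuousOn m (Icc 0 d.L)
  contDiffOn : ContDiffOn ℝ 1 (fun x => toH1 (m x)) (Icc 0 d.L)
  /-- `Λ` is defined, i.e. the characteristic speeds do not vanish on `[0, T] × [0, L]`. -/
  speed_ne_zero : ∀ x ∈ Icc 0 d.L, ∃ g : ℝ → State, IsContRep (wderiv (m x) 0) g ∧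
    ∀ t ∈ Icc 0 T, ∀ i, d.speed t (g t) i ≠ 0
  equation : ∀ x ∈ Icc 0 d.L, ∀ᵐ t ∂(timeMeasure T),
    (wderiv (derivWithin (fun y => toH1 (m y)) (Icc 0 d.L) x) 0 t).ofLp
        + (d.Lam t (wderiv (m x) 0 t)).mulVec (wderiv (m x) 1 t).ofLp
      = (d.α t / 2) • (d.Lam t (wderiv (m x) 0 t)).mulVec
          ![wderiv (m x) 0 t 0 + wderiv (m x) 0 t 1, wderiv (m x) 0 t 0 + wderiv (m x) 0 t 1]
  boundary : m 0 = m₀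
  initial : ∀ x ∈ Icc 0 d.L, VanishesAtZero (wderiv (m x) 0)

end Duct

end SupersonicDuct

/-!
The variable `x` plays the role of time. A perturbation `m` such that `m` and `∂ₜ m` vanish at
`t = 0` is `V² h`, where `h = ∂ₜ² m` lies in `L²(0, T)` and `V` is the Volterra operator
`(V f)(t) = ∫₀ᵗ f`. Differentiating the system twice in `t` turns it into an evolution equation for
`h` in `L²`, in which the only unbounded term is the transport term `-Λ ∂ₜ h`.

Replacing `h` in this term by its Yosida regularisation `(1 + δ ∂ₜ)⁻¹ h` gives an ordinary
differential equation with locally Lipschitz right-hand side. Since `Λ > 0` and `h` has no inflow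
at `t = 0`, the transport term is dissipative up to a bounded error, uniformly in `δ`, which bounds
`h` by a multiple of its initial value. The same estimate for the difference of two approximations,
measured in a norm that is two derivatives weaker, controls the dependence on `δ`.
-/

open Filter Topology
open scoped BoundedContinuousFunction

namespace SupersonicDuct

section BoundedContinuousSMul

variable {X E : Type*} [TopologicalSpace X] [MeasurableSpace X] [OpensMeasurableSpace X]
  {μ : Measure X} {p : ENNReal} [NormedAddCommGroup E] [NormedSpace ℝ E]

theorem memLp_bcf_smul (f : X →ᵇ ℝ) (h : Lp E p μ) : MemLp (fun x => f x • h x) p μ :=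
  (Lp.memLp h).of_le_mul (c := ‖f‖)
    (f.continuous.aestronglyMeasurable.smul (Lp.aestronglyMeasurable h))
    (.of_forall fun x => by
      rw [norm_smul]
      exact mul_le_mul_of_nonneg_right (f.norm_coe_le_norm x) (norm_nonneg _))

noncomputable instance (priority := low) : SMul (X →ᵇ ℝ) (Lp E p μ) :=
  ⟨fun f h => (memLp_bcf_smul f h).toLp _⟩

theorem coeFn_bcf_smul (f : X →ᵇ ℝ) (h : Lp E p μ) :
    (f • h : Lp E p μ) =ᵐ[μ] fun x => f x • h x :=
  (memLp_bcf_smul f h).coeFn_toLp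

/-- The action of bounded continuous functions on `Lᵖ` by pointwise multiplication. -/
noncomputable instance : Module (X →ᵇ ℝ) (Lp E p μ) where
  one_smul h := by
    apply Lp.ext
    filter_upwards [coeFn_bcf_smul 1 h] with x h₁
    simp [h₁]
  mul_smul f g h := by
    apply Lp.ext
    filter_upwards [coeFn_bcf_smul (f * g) h, coeFn_bcf_smul f (g • h), coeFn_bcf_smul g h]
      with x h₁ h₂ h₃
    simp [h₁, h₂, h₃, mul_smul]
  smul_zero f := by
    apply Lp.ext
    filter_upwards [coeFn_bcf_smul f (0 : Lp E p μ), Lp.coeFn_zero E p μ] with x h₁ h₂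
    rw [h₁, h₂, Pi.zero_apply, smul_zero]
  smul_add f g h := by
    apply Lp.ext
    filter_upwards [coeFn_bcf_smul f (g + h), coeFn_bcf_smul f g, coeFn_bcf_smul f h,
      Lp.coeFn_add g h, Lp.coeFn_add (f • g) (f • h)] with x h₁ h₂ h₃ h₄ h₅
    simp only [h₁, h₂, h₃, h₄, h₅, Pi.add_apply, smul_add]
  add_smul f g h := by
    apply Lp.ext
    filter_upwards [coeFn_bcf_smul (f + g) h, coeFn_bcf_smul f h, coeFn_bcf_smul g h,
      Lp.coeFn_add (f • h) (g • h)] with x h₁ h₂ h₃ h₄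
    simp only [h₁, h₂, h₃, h₄, BoundedContinuousFunction.coe_add, Pi.add_apply, add_smul]
  zero_smul h := by
    apply Lp.ext
    filter_upwards [coeFn_bcf_smul 0 h, Lp.coeFn_zero E p μ] with x h₁ h₂
    rw [h₁, h₂, BoundedContinuousFunction.coe_zero, Pi.zero_apply, zero_smul, Pi.zero_apply]

instance : IsScalarTower ℝ (X →ᵇ ℝ) (Lp E p μ) where
  smul_assoc c f h := by
    apply Lp.ext
    filter_upwards [coeFn_bcf_smul (c • f) h, coeFn_bcf_smul f h, Lp.coeFn_smul c (f • h)]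
      with x h₁ h₂ h₃
    simp [h₁, h₂, h₃, mul_smul]

instance : SMulCommClass ℝ (X →ᵇ ℝ) (Lp E p μ) where
  smul_comm c f h := by
    apply Lp.ext
    filter_upwards [coeFn_bcf_smul f (c • h), coeFn_bcf_smul f h, Lp.coeFn_smul c (f • h),
      Lp.coeFn_smul c h] with x h₁ h₂ h₃ h₄
    rw [h₃, Pi.smul_apply, h₂, h₁, h₄, Pi.smul_apply, smul_comm]

instance [Fact (1 ≤ p)] : IsBoundedSMul (X →ᵇ ℝ) (Lp E p μ) :=
  .of_norm_smul_le fun f h => by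
    refine Lp.norm_le_mul_norm_of_ae_le_mul ?_
    filter_upwards [coeFn_bcf_smul f h] with x h₁
    rw [h₁, norm_smul]
    exact mul_le_mul_of_nonneg_right (f.norm_coe_le_norm x) (norm_nonneg _)

theorem inner_bcf_smul {F : Type*} [NormedAddCommGroup F] [InnerProductSpace ℝ F] (f : X →ᵇ ℝ)
    (g h : Lp F 2 μ) : inner ℝ (f • g) h = inner ℝ g (f • h) := by
  rw [L2.inner_def, L2.inner_def]
  refine integral_congr_ae ?_
  filter_upwards [coeFn_bcf_smul f g, coeFn_bcf_smul f h] with x h₁ h₂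
  rw [h₁, h₂, real_inner_smul_left, real_inner_smul_right]

end BoundedContinuousSMul

section TruncatedInverse

variable {X : Type*} [TopologicalSpace X] {κ : ℝ} (hκ : 0 < κ)

include hκ in
theorem lipschitzWith_inv_max :
    LipschitzWith (κ⁻¹ * κ⁻¹).toNNReal fun x : ℝ => (max κ x)⁻¹ := by
  refine .of_dist_le_mul fun x y => ?_
  have hx : 0 < max κ x := lt_max_of_lt_left hκ
  have hy : 0 < max κ y := lt_max_of_lt_left hκ
  rw [Real.dist_eq, Real.dist_eq, Real.coe_toNNReal _ (by positivity), inv_sub_inv hx.ne' hy.ne',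
    abs_div, abs_mul, abs_of_pos hx, abs_of_pos hy, div_eq_inv_mul, mul_inv]
  have h : |max κ y - max κ x| ≤ |x - y| := by
    rw [max_comm κ, max_comm κ, abs_sub_comm x]
    exact abs_max_sub_max_le_abs _ _ _
  gcongr <;> exact le_max_left _ _

/-- The reciprocal `1 / f`, with `f` truncated from below at `κ > 0`. -/
noncomputable def truncInv (f : X →ᵇ ℝ) : X →ᵇ ℝ :=
  f.comp _ (lipschitzWith_inv_max hκ)

theorem truncInv_apply (f : X →ᵇ ℝ) (x : X) : truncInv hκ f x = (max κ (f x))⁻¹ := rfl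

theorem truncInv_nonneg (f : X →ᵇ ℝ) (x : X) : 0 ≤ truncInv hκ f x :=
  inv_nonneg.2 (hκ.le.trans (le_max_left _ _))

theorem truncInv_mul_apply {f : X →ᵇ ℝ} {x : X} (h : κ ≤ f x) : truncInv hκ f x * f x = 1 := by
  rw [truncInv_apply, max_eq_right h, inv_mul_cancel₀ (hκ.trans_le h).ne']

theorem norm_truncInv_le (f : X →ᵇ ℝ) : ‖truncInv hκ f‖ ≤ κ⁻¹ :=
  (BoundedContinuousFunction.norm_le (inv_nonneg.2 hκ.le)).2 fun x => by
    rw [Real.norm_of_nonneg (truncInv_nonneg hκ f x)]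
    exact inv_anti₀ hκ (le_max_left _ _)

theorem norm_truncInv_sub_truncInv_le (f g : X →ᵇ ℝ) :
    ‖truncInv hκ f - truncInv hκ g‖ ≤ κ⁻¹ * κ⁻¹ * ‖f - g‖ := by
  simpa only [truncInv, dist_eq_norm, Real.coe_toNNReal _ (show 0 ≤ κ⁻¹ * κ⁻¹ by positivity)] using
    (BoundedContinuousFunction.lipschitz_comp (lipschitzWith_inv_max hκ)).dist_le_mul f g

end TruncatedInverse

section ScalarL2

/-- Real-valued `L²` functions on `(0, T)`. -/
abbrev ScalarL2 (T : ℝ) : Type := Lp ℝ 2 (timeMeasure T)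

/-- The `L²(0, T)` class of a bounded continuous function. -/
noncomputable abbrev toL2 (T : ℝ) : (ℝ →ᵇ ℝ) →L[ℝ] ScalarL2 T :=
  BoundedContinuousFunction.toLp 2 (timeMeasure T) ℝ

variable {T : ℝ}

theorem ae_mem_Icc : ∀ᵐ t ∂(timeMeasure T), t ∈ Icc 0 T :=
  (ae_restrict_mem measurableSet_Ioo).mono fun _ h => Ioo_subset_Icc_self h

theorem coeFn_toL2 (f : ℝ →ᵇ ℝ) : toL2 T f =ᵐ[timeMeasure T] f :=
  BoundedContinuousFunction.coeFn_toLp (p := 2) (timeMeasure T) ℝ f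

theorem denseRange_toL2 : DenseRange (toL2 T) :=
  BoundedContinuousFunction.toLp_denseRange ℝ (timeMeasure T) ℝ (by norm_num)

theorem integrable_scalarL2 (h : ScalarL2 T) : Integrable h (timeMeasure T) :=
  (Lp.memLp h).integrable (by norm_num)

theorem smul_toL2 (f g : ℝ →ᵇ ℝ) : f • toL2 T g = toL2 T (f * g) := by
  apply Lp.ext
  filter_upwards [coeFn_bcf_smul f (toL2 T g), coeFn_toL2 (T := T) g, coeFn_toL2 (T := T) (f * g)]
    with t h₁ h₂ h₃
  simp [h₁, h₂, h₃]

theorem toL2_eq_smul_one (f : ℝ →ᵇ ℝ) : toL2 T f = f • toL2 T 1 := by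
  rw [smul_toL2, mul_one]

theorem toL2_congr {f g : ℝ →ᵇ ℝ} (h : ∀ t ∈ Icc 0 T, f t = g t) : toL2 T f = toL2 T g := by
  apply Lp.ext
  filter_upwards [coeFn_toL2 (T := T) f, coeFn_toL2 (T := T) g, ae_mem_Icc] with t h₁ h₂ ht
  rw [h₁, h₂, h t ht]

theorem inner_scalarL2 (f g : ScalarL2 T) :
    inner ℝ f g = ∫ t, f t * g t ∂(timeMeasure T) := by
  simp only [L2.inner_def, Real.inner_apply]

theorem inner_toL2 (f : ℝ →ᵇ ℝ) (h : ScalarL2 T) :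
    inner ℝ (toL2 T f) h = ∫ t, f t * h t ∂(timeMeasure T) := by
  rw [inner_scalarL2]
  refine integral_congr_ae ?_
  filter_upwards [coeFn_toL2 (T := T) f] with t h₁
  rw [h₁]

theorem inner_toL2_one_smul (f : ℝ →ᵇ ℝ) (h : ScalarL2 T) :
    inner ℝ (toL2 T 1) (f • h) = inner ℝ (toL2 T f) h := by
  rw [← inner_bcf_smul, smul_toL2, mul_one]

theorem integral_norm_smul_le (f : ℝ →ᵇ ℝ) (h : ScalarL2 T) :
    ∫ t, ‖(f • h : ScalarL2 T) t‖ ∂(timeMeasure T) ≤ ‖toL2 T f‖ * ‖h‖ := by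
  have h₁ : ∫ t, ‖(f • h : ScalarL2 T) t‖ ∂(timeMeasure T) = inner ℝ |toL2 T f| |h| := by
    rw [inner_scalarL2]
    refine integral_congr_ae ?_
    filter_upwards [Lp.coeFn_abs h, Lp.coeFn_abs (toL2 T f), coeFn_toL2 (T := T) f,
      coeFn_bcf_smul f h] with t h₁ h₂ h₃ h₄
    rw [h₁, h₂, h₃, h₄, norm_smul, Real.norm_eq_abs, Real.norm_eq_abs]
  rw [h₁, ← norm_abs_eq_norm (toL2 T f), ← norm_abs_eq_norm h]
  exact real_inner_le_norm _ _

theorem norm_toL2_le_of_abs_le {f g : ℝ →ᵇ ℝ} {C : ℝ} (h : ∀ t, |f t| ≤ C * |g t|) :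
    ‖toL2 T f‖ ≤ C * ‖toL2 T g‖ := by
  refine Lp.norm_le_mul_norm_of_ae_le_mul ?_
  filter_upwards [coeFn_toL2 (T := T) f, coeFn_toL2 (T := T) g] with t h₁ h₂
  rw [h₁, h₂]
  exact h t

theorem inner_smul_self_nonneg {b : ℝ →ᵇ ℝ} (hb : ∀ t ∈ Icc 0 T, 0 ≤ b t) (w : ScalarL2 T) :
    0 ≤ inner ℝ (b • w) w := by
  rw [inner_scalarL2]
  refine integral_nonneg_of_ae ?_
  filter_upwards [coeFn_bcf_smul b w, ae_mem_Icc] with t h₁ ht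
  rw [h₁, smul_eq_mul, mul_assoc]
  exact mul_nonneg (hb t ht) (mul_self_nonneg _)

end ScalarL2

section Primitive

variable {T : ℝ}

theorem norm_integral_smul_le (f : ℝ →ᵇ ℝ) (h : ScalarL2 T) (t : ℝ) :
    ‖∫ s in (0 : ℝ)..t, (f • h : ScalarL2 T) s ∂(timeMeasure T)‖ ≤ ‖toL2 T f‖ * ‖h‖ :=
  intervalIntegral.norm_integral_le_integral_norm_uIoc.trans <|
    (setIntegral_le_integral (integrable_scalarL2 _).norm
      (.of_forall fun _ => norm_nonneg _)).trans (integral_norm_smul_le f h)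

theorem norm_integral_scalarL2_le (h : ScalarL2 T) (t : ℝ) :
    ‖∫ s in (0 : ℝ)..t, h s ∂(timeMeasure T)‖ ≤ ‖toL2 T 1‖ * ‖h‖ := by
  simpa only [one_smul (ℝ →ᵇ ℝ) h] using norm_integral_smul_le 1 h t

/-- The primitive `t ↦ ∫₀ᵗ h` of an `L²` function. -/
noncomputable def primitive : ScalarL2 T →L[ℝ] (ℝ →ᵇ ℝ) :=
  LinearMap.mkContinuous
    { toFun := fun h => BoundedContinuousFunction.ofNormedAddCommGroup
        (fun t => ∫ s in (0 : ℝ)..t, h s ∂(timeMeasure T))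
        (intervalIntegral.continuous_primitive
          (fun _ _ => (integrable_scalarL2 h).intervalIntegrable) 0)
        (‖toL2 T 1‖ * ‖h‖) (norm_integral_scalarL2_le h)
      map_add' := fun f g => by
        ext t
        simp only [BoundedContinuousFunction.coe_ofNormedAddCommGroup,
          BoundedContinuousFunction.coe_add, Pi.add_apply]
        rw [← intervalIntegral.integral_add (integrable_scalarL2 f).intervalIntegrable
          (integrable_scalarL2 g).intervalIntegrable]
        refine intervalIntegral.integral_congr_ae ?_
        filter_upwards [Lp.coeFn_add f g] with s hs _
        rw [hs, Pi.add_apply]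
      map_smul' := fun c f => by
        ext t
        simp only [BoundedContinuousFunction.coe_ofNormedAddCommGroup, RingHom.id_apply,
          BoundedContinuousFunction.coe_smul, smul_eq_mul]
        rw [← intervalIntegral.integral_const_mul]
        refine intervalIntegral.integral_congr_ae ?_
        filter_upwards [Lp.coeFn_smul c f] with s hs _
        rw [hs, Pi.smul_apply, smul_eq_mul] }
    ‖toL2 T 1‖ fun h => (BoundedContinuousFunction.norm_le (by positivity)).2
      (norm_integral_scalarL2_le h)

theorem primitive_apply (h : ScalarL2 T) (t : ℝ) :
    primitive h t = ∫ s in (0 : ℝ)..t, h s ∂(timeMeasure T) := rfl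

@[simp]
theorem primitive_apply_zero (h : ScalarL2 T) : primitive h 0 = 0 := by
  rw [primitive_apply, intervalIntegral.integral_same]

theorem norm_primitive_smul_le (f : ℝ →ᵇ ℝ) (h : ScalarL2 T) :
    ‖primitive (f • h)‖ ≤ ‖toL2 T f‖ * ‖h‖ :=
  (BoundedContinuousFunction.norm_le (by positivity)).2 (norm_integral_smul_le f h)

theorem restrict_timeMeasure_Ioc {t : ℝ} (ht : t ∈ Icc 0 T) :
    (timeMeasure T).restrict (Ioc 0 t) = volume.restrict (Ioc 0 t) := by
  rw [Measure.restrict_congr_set Ioo_ae_eq_Ioc.symm, Measure.restrict_restrict measurableSet_Ioo,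
    Measure.restrict_congr_set Ioo_ae_eq_Ioc.symm, inter_eq_left.2 (Ioo_subset_Ioo_right ht.2)]

theorem primitive_apply_clamp (h : ScalarL2 T) (t : ℝ) :
    primitive h t = primitive h (max 0 (min t T)) := by
  have hIoc : Ioc 0 t ∩ Ioo 0 T = Ioc 0 (max 0 (min t T)) ∩ Ioo 0 T := by
    ext s
    simp only [mem_inter_iff, mem_Ioc, mem_Ioo, le_max_iff, le_min_iff]
    grind
  rcases le_total 0 t with ht | ht
  · rw [primitive_apply, primitive_apply, intervalIntegral.integral_of_le ht,
      intervalIntegral.integral_of_le (le_max_left _ _),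
      Measure.restrict_restrict measurableSet_Ioc, Measure.restrict_restrict measurableSet_Ioc,
      hIoc]
  · have hempty : Ioc t 0 ∩ Ioo 0 T = ∅ :=
      (disjoint_left.2 fun s hs hs' => hs'.1.not_ge hs.2).inter_eq
    rw [max_eq_left ((min_le_left _ _).trans ht), primitive_apply_zero, primitive_apply,
      intervalIntegral.integral_of_ge ht, Measure.restrict_restrict measurableSet_Ioc, hempty,
      Measure.restrict_empty, integral_zero_measure, neg_zero]

theorem primitive_toL2_apply (f : ℝ →ᵇ ℝ) {t : ℝ} (ht : t ∈ Icc 0 T) :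
    primitive (toL2 T f) t = ∫ s in (0 : ℝ)..t, f s := by
  rw [primitive_apply, intervalIntegral.integral_of_le ht.1, intervalIntegral.integral_of_le ht.1,
    ← restrict_timeMeasure_Ioc ht]
  exact integral_congr_ae (ae_restrict_of_ae (coeFn_toL2 f))

theorem primitive_apply_end (h : ScalarL2 T) : primitive h T = inner ℝ (toL2 T 1) h := by
  simp only [inner_toL2, BoundedContinuousFunction.coe_one, Pi.one_apply, one_mul, primitive_apply]
  rcases le_total T 0 with hT | hT
  · have hzero : timeMeasure T = 0 := by
      rw [timeMeasure, Ioo_eq_empty hT.not_gt, Measure.restrict_empty]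
    simp only [intervalIntegral.integral_of_ge hT, hzero, Measure.restrict_zero,
      integral_zero_measure, neg_zero]
  · rw [intervalIntegral.integral_of_le hT, restrict_timeMeasure_Ioc ⟨hT, le_rfl⟩,
      Measure.restrict_congr_set Ioo_ae_eq_Ioc.symm]

/-- `f` is a primitive of `g` on `[0, T]`. -/
def IsPrimitive (f : ℝ →ᵇ ℝ) (g : ScalarL2 T) : Prop := ∀ t ∈ Icc 0 T, f t = f 0 + primitive g t

theorem isPrimitive_primitive (g : ScalarL2 T) : IsPrimitive (primitive g) g := fun t _ => by simp

theorem isPrimitive_of_hasDerivAt {f f' : ℝ →ᵇ ℝ} (h : ∀ t ∈ Ioo 0 T, HasDerivAt f (f' t) t) :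
    IsPrimitive f (toL2 T f') := fun t ht => by
  rw [primitive_toL2_apply f' ht, intervalIntegral.integral_eq_sub_of_hasDerivAt_of_le ht.1
    f.continuous.continuousOn (fun x hx => h x ⟨hx.1, hx.2.trans_le ht.2⟩)
    (f'.continuous.intervalIntegrable _ _)]
  ring

namespace IsPrimitive

variable {f f' : ℝ →ᵇ ℝ} {g g' : ScalarL2 T}

theorem add (h : IsPrimitive f g) (h' : IsPrimitive f' g') : IsPrimitive (f + f') (g + g') :=
  fun t ht => by simp [h t ht, h' t ht]; ring

theorem sub (h : IsPrimitive f g) (h' : IsPrimitive f' g') : IsPrimitive (f - f') (g - g') :=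
  fun t ht => by simp [h t ht, h' t ht]; ring

theorem const_smul (c : ℝ) (h : IsPrimitive f g) : IsPrimitive (c • f) (c • g) :=
  fun t ht => by simp [h t ht]; ring

theorem sum {ι : Type*} {s : Finset ι} {f : ι → ℝ →ᵇ ℝ} {g : ι → ScalarL2 T}
    (h : ∀ i ∈ s, IsPrimitive (f i) (g i)) : IsPrimitive (∑ i ∈ s, f i) (∑ i ∈ s, g i) :=
  fun t ht => by
    simp only [map_sum, BoundedContinuousFunction.coe_sum, Finset.sum_apply]
    rw [Finset.sum_congr rfl fun i hi => h i hi t ht, Finset.sum_add_distrib]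

theorem hasDerivAt (h : IsPrimitive f (toL2 T f')) {t : ℝ} (ht : t ∈ Ioo 0 T) :
    HasDerivAt f (f' t) t := by
  have h₁ : HasDerivAt (fun u => f 0 + ∫ s in (0 : ℝ)..u, f' s) (f' t) t :=
    (intervalIntegral.integral_hasDerivAt_right (f'.continuous.intervalIntegrable _ _)
      (f'.continuous.stronglyMeasurableAtFilter _ _) f'.continuous.continuousAt).const_add _
  refine h₁.congr_of_eventuallyEq ?_
  filter_upwards [isOpen_Ioo.mem_nhds ht] with s hs
  rw [h s (Ioo_subset_Icc_self hs), primitive_toL2_apply f' (Ioo_subset_Icc_self hs)]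

end IsPrimitive

theorem primitive_mul_primitive (f g : ScalarL2 T) (t : ℝ) :
    primitive f t * primitive g t = primitive (primitive f • g + primitive g • f) t := by
  rw [primitive_apply_clamp f, primitive_apply_clamp g, primitive_apply_clamp (_ + _)]
  rcases le_or_gt 0 T with hT | hT
  · have ht : max 0 (min t T) ∈ Icc 0 T := ⟨le_max_left _ _, max_le hT (min_le_right _ _)⟩
    generalize max 0 (min t T) = s at ht
    have heval : Continuous fun h : ScalarL2 T => primitive h s :=
      (BoundedContinuousFunction.evalCLM ℝ s).continuous.comp primitive.continuous
    refine denseRange_toL2.induction_on₂ (p := fun f g : ScalarL2 T =>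
      primitive f s * primitive g s = primitive (primitive f • g + primitive g • f) s) ?_ ?_ f g
    · refine isClosed_eq ((heval.comp continuous_fst).mul (heval.comp continuous_snd))
        (heval.comp ?_)
      exact ((primitive.continuous.comp continuous_fst).smul continuous_snd).add
        ((primitive.continuous.comp continuous_snd).smul continuous_fst)
    · intro a b
      have hab : IsPrimitive (primitive (toL2 T a) * primitive (toL2 T b))
          (toL2 T (primitive (toL2 T a) * b + primitive (toL2 T b) * a)) :=
        isPrimitive_of_hasDerivAt fun r hr =>
          (((isPrimitive_primitive (toL2 T a)).hasDerivAt hr).mul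
            ((isPrimitive_primitive (toL2 T b)).hasDerivAt hr)).congr_deriv (by simp; ring)
      rw [smul_toL2, smul_toL2, ← map_add]
      simpa using hab s ht
  · simp [max_eq_left ((min_le_right t T).trans hT.le)]

namespace IsPrimitive

variable {f f' : ℝ →ᵇ ℝ} {g g' : ScalarL2 T}

theorem smul_eq (h : IsPrimitive f g) (k : ScalarL2 T) : f • k = f 0 • k + primitive g • k := by
  apply Lp.ext
  filter_upwards [coeFn_bcf_smul f k, coeFn_bcf_smul (primitive g) k, Lp.coeFn_smul (f 0) k,
    Lp.coeFn_add (f 0 • k) (primitive g • k), ae_mem_Icc] with t h₁ h₂ h₃ h₄ ht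
  rw [h₁, h₄, Pi.add_apply, h₂, h₃, h t ht, Pi.smul_apply, add_smul]

theorem mul (h : IsPrimitive f g) (h' : IsPrimitive f' g') :
    IsPrimitive (f * f') (f • g' + f' • g) := fun t ht => by
  have hsplit : f • g' + f' • g
      = f 0 • g' + f' 0 • g + (primitive g • g' + primitive g' • g) := by
    rw [h.smul_eq, h'.smul_eq]
    abel
  rw [hsplit, map_add, map_add]
  simp only [BoundedContinuousFunction.coe_mul, BoundedContinuousFunction.coe_add, Pi.mul_apply,
    Pi.add_apply, ← primitive_mul_primitive g g', BoundedContinuousFunction.coe_smul, map_smul,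
    smul_eq_mul, h t ht, h' t ht]
  ring

theorem truncInv {κ : ℝ} (hκ : 0 < κ) (h : IsPrimitive f (toL2 T f'))
    (hf : ∀ t ∈ Icc 0 T, κ ≤ f t) :
    IsPrimitive (truncInv hκ f) (toL2 T (-(truncInv hκ f * truncInv hκ f * f'))) := by
  refine isPrimitive_of_hasDerivAt fun t ht => ?_
  have h₀ : f t ≠ 0 := (hκ.trans_le (hf t (Ioo_subset_Icc_self ht))).ne'
  refine (((h.hasDerivAt ht).inv h₀).congr_of_eventuallyEq ?_).congr_deriv ?_
  · filter_upwards [isOpen_Ioo.mem_nhds ht] with s hs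
    rw [truncInv_apply, max_eq_right (hf s (Ioo_subset_Icc_self hs))]
    rfl
  · simp only [BoundedContinuousFunction.coe_neg, BoundedContinuousFunction.coe_mul, Pi.neg_apply,
      Pi.mul_apply, truncInv_apply, max_eq_right (hf t (Ioo_subset_Icc_self ht))]
    field_simp

end IsPrimitive

end Primitive

section Volterra

variable {T : ℝ}

/-- The Volterra operator `h ↦ ∫₀ᵗ h` on `L²(0, T)`. -/
noncomputable def volterra (T : ℝ) : ScalarL2 T →L[ℝ] ScalarL2 T := (toL2 T).comp primitive

theorem volterra_apply (h : ScalarL2 T) : volterra T h = toL2 T (primitive h) := rfl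

theorem IsPrimitive.toL2_eq {f : ℝ →ᵇ ℝ} {g : ScalarL2 T} (h : IsPrimitive f g) :
    toL2 T f = f 0 • toL2 T 1 + volterra T g := by
  rw [volterra_apply, ← map_smul, ← map_add]
  exact toL2_congr fun t ht => by simpa using h t ht

theorem IsPrimitive.volterra_eq {f : ℝ →ᵇ ℝ} {g : ScalarL2 T} (h : IsPrimitive f g)
    (h₀ : f 0 = 0) : volterra T g = toL2 T f := by
  rw [h.toL2_eq, h₀, zero_smul, zero_add]

theorem inner_volterra_self (w : ScalarL2 T) :
    2 * inner ℝ (volterra T w) w = primitive w T ^ 2 := by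
  rw [sq, primitive_mul_primitive, primitive_apply_end, inner_add_right, inner_toL2_one_smul,
    volterra_apply, two_mul]

theorem inner_volterra_self_nonneg (w : ScalarL2 T) : 0 ≤ inner ℝ (volterra T w) w := by
  linarith [inner_volterra_self w, sq_nonneg (primitive w T)]

theorem sq_primitive_apply_le (w : ScalarL2 T) (t : ℝ) :
    primitive w t ^ 2 ≤ 2 * (‖volterra T w‖ * ‖w‖) := by
  have hle := ((primitive (primitive w • w)).norm_coe_le_norm t).trans (norm_primitive_smul_le _ w)
  calc primitive w t ^ 2 = 2 * primitive (primitive w • w) t := by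
        rw [sq, primitive_mul_primitive, map_add, BoundedContinuousFunction.coe_add, Pi.add_apply,
          two_mul]
    _ ≤ 2 * (‖volterra T w‖ * ‖w‖) := by
        gcongr
        exact (le_abs_self _).trans hle

/-- Integrate `(b v ^ 2)'` over `[0, T]`, where `v' = w`. -/
theorem inner_smul_volterra_ge {b b' : ℝ →ᵇ ℝ} (hb : IsPrimitive b (toL2 T b'))
    (hb₀ : ∀ t ∈ Icc 0 T, 0 ≤ b t) (w : ScalarL2 T) :
    -(‖b'‖ * ‖volterra T w‖ ^ 2) ≤ 2 * inner ℝ (b • w) (volterra T w) := by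
  rcases le_or_gt 0 T with hT | hT
  · have hend : T ∈ Icc 0 T := ⟨hT, le_rfl⟩
    set v := primitive w
    have hvw := isPrimitive_primitive w
    have htransport : inner ℝ (toL2 T b) (v • w) = inner ℝ (b • w) (volterra T w) := by
      rw [← inner_bcf_smul, smul_toL2, mul_comm, ← smul_toL2, inner_bcf_smul, real_inner_comm]
      rfl
    have hspeed : inner ℝ (toL2 T (v * v)) (toL2 T b')
        = inner ℝ (b' • volterra T w) (volterra T w) := by
      rw [← smul_toL2, inner_bcf_smul, smul_toL2, mul_comm, ← smul_toL2, real_inner_comm]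
      rfl
    have hibp : (b * (v * v)) T
        = 2 * inner ℝ (b • w) (volterra T w) + inner ℝ (b' • volterra T w) (volterra T w) := by
      rw [hb.mul (hvw.mul hvw) T hend, primitive_apply_end, inner_add_right, smul_add,
        inner_add_right, inner_toL2_one_smul, inner_toL2_one_smul, htransport, hspeed]
      simp [two_mul]
    have hend₀ : 0 ≤ (b * (v * v)) T := mul_nonneg (hb₀ T hend) (mul_self_nonneg _)
    have hb' : inner ℝ (b' • volterra T w) (volterra T w) ≤ ‖b'‖ * ‖volterra T w‖ ^ 2 := by
      refine (real_inner_le_norm _ _).trans ?_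
      rw [sq, ← mul_assoc]
      exact mul_le_mul_of_nonneg_right (norm_smul_le _ _) (norm_nonneg _)
    linarith
  · have hw : w = 0 := by
      apply Lp.ext
      filter_upwards [ae_mem_Icc] with t ht
      exact absurd (ht.1.trans ht.2) hT.not_ge
    simp [hw]

end Volterra

section Accretive

variable {H : Type*} [NormedAddCommGroup H] [InnerProductSpace ℝ H]

/-- A bounded operator with nonnegative quadratic form. -/
def Accretive (A : H →L[ℝ] H) : Prop := ∀ h, 0 ≤ inner ℝ (A h) h

/-- The resolvent `(ρ + A)⁻¹`. If `A` is the Volterra operator, so that `A⁻¹ = ∂ₜ`, this is the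
Yosida approximation `∂ₜ (1 + ρ ∂ₜ)⁻¹` of `∂ₜ`. -/
noncomputable def yosida (A : H →L[ℝ] H) (ρ : ℝ) : H →L[ℝ] H := Ring.inverse (ρ • 1 + A)

/-- The operator `A (ρ + A)⁻¹ = (1 + ρ A⁻¹)⁻¹`, which tends to the identity as `ρ → 0`. -/
noncomputable def smoothing (A : H →L[ℝ] H) (ρ : ℝ) : H →L[ℝ] H := A.comp (yosida A ρ)

/-- The part `ρ (ρ + A)⁻¹ = 1 - A (ρ + A)⁻¹` of the identity which is removed by smoothing. -/
noncomputable def defect (A : H →L[ℝ] H) (ρ : ℝ) : H →L[ℝ] H := ρ • yosida A ρ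

theorem smoothing_apply (A : H →L[ℝ] H) (ρ : ℝ) (h : H) : smoothing A ρ h = A (yosida A ρ h) := rfl

theorem defect_apply (A : H →L[ℝ] H) (ρ : ℝ) (h : H) : defect A ρ h = ρ • yosida A ρ h := rfl

namespace Accretive

variable [CompleteSpace H] {A : H →L[ℝ] H} (hA : Accretive A) {ρ : ℝ} (hρ : 0 < ρ)

include hA hρ

theorem isUnit_smul_one_add : IsUnit (ρ • 1 + A) := by
  refine ContinuousLinearMap.isUnit_of_forall_le_norm_inner_map _ (c := ⟨ρ, hρ.le⟩) hρ fun h => ?_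
  calc ‖h‖ ^ 2 * ρ ≤ ‖h‖ ^ 2 * ρ + inner ℝ (A h) h := le_add_of_nonneg_right (hA h)
    _ = inner ℝ ((ρ • 1 + A) h) h := by
      rw [add_apply, smul_apply, one_apply_eq_self, inner_add_left, real_inner_smul_left,
        real_inner_self_eq_norm_sq, mul_comm]
    _ ≤ ‖inner ℝ ((ρ • 1 + A) h) h‖ := le_abs_self _

theorem yosida_spec (h : H) : ρ • yosida A ρ h + A (yosida A ρ h) = h :=
  DFunLike.congr_fun (Ring.mul_inverse_cancel _ (hA.isUnit_smul_one_add hρ)) h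

theorem yosida_eq_of_add_eq {w h : H} (hw : ρ • w + A w = h) : yosida A ρ h = w := by
  rw [← hw]
  exact DFunLike.congr_fun (Ring.inverse_mul_cancel _ (hA.isUnit_smul_one_add hρ)) w

theorem sub_smoothing (h : H) : h - smoothing A ρ h = defect A ρ h := by
  rw [sub_eq_iff_eq_add, smoothing_apply, defect_apply, hA.yosida_spec hρ]

theorem norm_defect_sq_add_norm_smoothing_sq_le (h : H) :
    ‖defect A ρ h‖ ^ 2 + ‖smoothing A ρ h‖ ^ 2 ≤ ‖h‖ ^ 2 := by
  conv_rhs => rw [← hA.yosida_spec hρ h]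
  rw [defect_apply, smoothing_apply, norm_add_sq_real, real_inner_smul_left, real_inner_comm]
  linarith [mul_nonneg hρ.le (hA (yosida A ρ h))]

theorem norm_defect_le (h : H) : ‖defect A ρ h‖ ≤ ‖h‖ :=
  le_of_sq_le_sq ((le_add_of_nonneg_right (sq_nonneg _)).trans
    (hA.norm_defect_sq_add_norm_smoothing_sq_le hρ h)) (norm_nonneg _)

theorem norm_smoothing_le (h : H) : ‖smoothing A ρ h‖ ≤ ‖h‖ :=
  le_of_sq_le_sq ((le_add_of_nonneg_left (sq_nonneg _)).trans
    (hA.norm_defect_sq_add_norm_smoothing_sq_le hρ h)) (norm_nonneg _)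

theorem yosida_apply_apply (h : H) : yosida A ρ (A h) = smoothing A ρ h :=
  hA.yosida_eq_of_add_eq hρ <| by
    rw [smoothing_apply, ← map_smul, ← map_add, hA.yosida_spec hρ]

theorem yosida_comm {δ : ℝ} (hδ : 0 < δ) (h : H) :
    yosida A ρ (yosida A δ h) = yosida A δ (yosida A ρ h) :=
  hA.yosida_eq_of_add_eq hρ <| by
    rw [← smoothing_apply, ← hA.yosida_apply_apply hδ, ← map_smul, ← map_add, hA.yosida_spec hρ]

theorem norm_yosida_le (h : H) : ‖yosida A ρ h‖ ≤ ρ⁻¹ * ‖h‖ := by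
  rw [← div_eq_inv_mul, le_div_iff₀ hρ, mul_comm, ← norm_smul_of_nonneg hρ.le]
  exact hA.norm_defect_le hρ h

theorem norm_le_two_mul_norm_defect_add (h : H) :
    ‖h‖ ≤ 2 * ‖defect A ρ h‖ + ρ⁻¹ * (ρ⁻¹ * ‖A (A h)‖) := by
  have hsplit : h = defect A ρ h + smoothing A ρ (defect A ρ h)
      + yosida A ρ (yosida A ρ (A (A h))) := by
    rw [hA.yosida_apply_apply hρ, smoothing_apply A ρ (A h), hA.yosida_apply_apply hρ (h := h),
      hA.yosida_apply_apply hρ, ← hA.sub_smoothing hρ, map_sub]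
    abel
  calc ‖h‖ ≤ ‖defect A ρ h‖ + ‖smoothing A ρ (defect A ρ h)‖
        + ‖yosida A ρ (yosida A ρ (A (A h)))‖ := by
        conv_lhs => rw [hsplit]
        exact norm_add₃_le
    _ ≤ ‖defect A ρ h‖ + ‖defect A ρ h‖ + ρ⁻¹ * (ρ⁻¹ * ‖A (A h)‖) := by
        have := inv_pos.2 hρ
        gcongr
        · exact hA.norm_smoothing_le hρ _
        · exact (hA.norm_yosida_le hρ _).trans (by gcongr; exact hA.norm_yosida_le hρ _)
    _ = 2 * ‖defect A ρ h‖ + ρ⁻¹ * (ρ⁻¹ * ‖A (A h)‖) := by ring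

omit hρ in
theorem tendsto_defect (hd : DenseRange A) (h : H) :
    Tendsto (fun ρ => defect A ρ h) (𝓝[>] 0) (𝓝 0) := by
  rw [Metric.tendsto_nhdsWithin_nhds]
  intro ε hε
  obtain ⟨g, hg⟩ := hd.exists_dist_lt h (half_pos hε)
  refine ⟨ε / 2 / (‖g‖ + 1), by positivity, fun {ρ} hρ hlt => ?_⟩
  replace hρ : 0 < ρ := hρ
  rw [dist_zero_right, Real.norm_of_nonneg hρ.le, lt_div_iff₀ (by positivity)] at hlt
  rw [dist_eq_norm] at hg
  have hsplit : defect A ρ h = defect A ρ (h - A g) + ρ • smoothing A ρ g := by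
    rw [map_sub, defect_apply _ _ (A g), hA.yosida_apply_apply hρ, sub_add_cancel]
  calc dist (defect A ρ h) 0 ≤ ‖defect A ρ (h - A g)‖ + ρ * ‖smoothing A ρ g‖ := by
        rw [dist_zero_right, hsplit, ← norm_smul_of_nonneg hρ.le]
        exact norm_add_le _ _
    _ ≤ ‖h - A g‖ + ρ * ‖g‖ := by
        gcongr
        exacts [hA.norm_defect_le hρ _, hA.norm_smoothing_le hρ g]
    _ < ε := by linarith

omit hρ in
theorem injective (hd : DenseRange A) : Function.Injective A :=
  (injective_iff_map_eq_zero A).2 fun h hh => by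
    have hlim : Tendsto (fun ρ => 2 * ‖defect A ρ h‖) (𝓝[>] 0) (𝓝 0) := by
      simpa using (hA.tendsto_defect hd h).norm.const_mul 2
    refine norm_le_zero_iff.1 (ge_of_tendsto hlim ?_)
    filter_upwards [self_mem_nhdsWithin] with ρ (hρ : 0 < ρ)
    simpa [hh] using hA.norm_le_two_mul_norm_defect_add hρ h

end Accretive

end Accretive

section VolterraYosida

variable {T : ℝ}

theorem accretive_volterra : Accretive (volterra T) := inner_volterra_self_nonneg

variable {ρ : ℝ} (hρ : 0 < ρ)

include hρ

theorem norm_primitive_yosida_le (h : ScalarL2 T) :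
    ρ * ‖primitive (yosida (volterra T) ρ h)‖ ≤ √(2 * ρ) * ‖h‖ := by
  set w := yosida (volterra T) ρ h
  have hw : ‖primitive w‖ ≤ √(2 * (‖volterra T w‖ * ‖w‖)) :=
    (BoundedContinuousFunction.norm_le (Real.sqrt_nonneg _)).2 fun t =>
      Real.abs_le_sqrt (sq_primitive_apply_le w t)
  have hρw : ρ * ‖w‖ ≤ ‖h‖ := by
    simpa only [defect_apply, norm_smul_of_nonneg hρ.le]
      using accretive_volterra.norm_defect_le hρ h
  calc ρ * ‖primitive w‖ ≤ ρ * √(2 * (‖volterra T w‖ * ‖w‖)) := by gcongr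
    _ = √(2 * ρ * (‖volterra T w‖ * (ρ * ‖w‖))) := by
        rw [← Real.sqrt_sq hρ.le, ← Real.sqrt_mul (sq_nonneg ρ), Real.sqrt_sq hρ.le]
        ring_nf
    _ ≤ √(2 * ρ * (‖h‖ * ‖h‖)) := by
        gcongr
        exact accretive_volterra.norm_smoothing_le hρ h
    _ = √(2 * ρ) * ‖h‖ := by
        rw [Real.sqrt_mul (by positivity), Real.sqrt_mul_self (norm_nonneg h)]

theorem smoothing_smul {f : ℝ →ᵇ ℝ} {f' : ScalarL2 T} (hf : IsPrimitive f f') (k : ScalarL2 T) :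
    smoothing (volterra T) ρ (f • k) = f • smoothing (volterra T) ρ k
      - ρ • smoothing (volterra T) ρ (primitive (yosida (volterra T) ρ k) • f') := by
  set w := yosida (volterra T) ρ k with hw
  have hproduct : volterra T (f • w + primitive w • f') = f • volterra T w := by
    rw [(hf.mul (isPrimitive_primitive w)).volterra_eq (by simp), volterra_apply, smul_toL2]
  have hyosida : yosida (volterra T) ρ (f • k + ρ • primitive w • f')
      = f • w + primitive w • f' := by
    refine accretive_volterra.yosida_eq_of_add_eq hρ ?_
    conv_rhs => rw [← accretive_volterra.yosida_spec hρ k]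
    rw [hproduct, ← hw]
    module
  rw [eq_sub_iff_add_eq, ← map_smul, ← map_add, smoothing_apply, hyosida, hproduct, hw,
    smoothing_apply]

theorem norm_defect_smul_le {f : ℝ →ᵇ ℝ} {f' : ScalarL2 T} (hf : IsPrimitive f f')
    (k : ScalarL2 T) :
    ‖defect (volterra T) ρ (f • k)‖
      ≤ ‖f‖ * ‖defect (volterra T) ρ k‖ + √(2 * ρ) * (‖f'‖ * ‖k‖) := by
  set w := yosida (volterra T) ρ k
  have hsplit : defect (volterra T) ρ (f • k)
      = f • defect (volterra T) ρ k + ρ • smoothing (volterra T) ρ (primitive w • f') := by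
    rw [← accretive_volterra.sub_smoothing hρ, smoothing_smul hρ hf,
      ← accretive_volterra.sub_smoothing hρ k, smul_sub]
    abel
  calc ‖defect (volterra T) ρ (f • k)‖
      ≤ ‖f • defect (volterra T) ρ k‖ + ρ * ‖smoothing (volterra T) ρ (primitive w • f')‖ := by
        rw [hsplit, ← norm_smul_of_nonneg hρ.le]
        exact norm_add_le _ _
    _ ≤ ‖f‖ * ‖defect (volterra T) ρ k‖ + ρ * (‖primitive w‖ * ‖f'‖) := by
        gcongr
        exacts [norm_smul_le _ _, (accretive_volterra.norm_smoothing_le hρ _).trans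
          (norm_smul_le _ _)]
    _ ≤ ‖f‖ * ‖defect (volterra T) ρ k‖ + √(2 * ρ) * (‖f'‖ * ‖k‖) := by
        nlinarith [norm_primitive_yosida_le hρ k, norm_nonneg f']

theorem inner_smul_yosida_ge {b b' : ℝ →ᵇ ℝ} (hb : IsPrimitive b (toL2 T b'))
    (hb₀ : ∀ t ∈ Icc 0 T, 0 ≤ b t) (h : ScalarL2 T) :
    -(‖b'‖ * ‖h‖ ^ 2) ≤ 2 * inner ℝ (b • yosida (volterra T) ρ h) h := by
  set w := yosida (volterra T) ρ h
  have hsplit : inner ℝ (b • w) h = ρ * inner ℝ (b • w) w + inner ℝ (b • w) (volterra T w) := by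
    conv_lhs => rw [← accretive_volterra.yosida_spec hρ h]
    rw [inner_add_right, real_inner_smul_right]
  have hsmoothing : ‖volterra T w‖ ^ 2 ≤ ‖h‖ ^ 2 :=
    pow_le_pow_left₀ (norm_nonneg _) (accretive_volterra.norm_smoothing_le hρ h) 2
  have hw₀ := mul_nonneg hρ.le (inner_smul_self_nonneg hb₀ w)
  have hb' := mul_le_mul_of_nonneg_left hsmoothing (norm_nonneg b')
  linarith [inner_smul_volterra_ge hb hb₀ w]

/-- The defect almost commutes with transport, uniformly in the scale `δ` of the regularisation. -/
theorem norm_defect_transport_le {δ : ℝ} (hδ : 0 < δ) {b b' : ℝ →ᵇ ℝ}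
    (hb : IsPrimitive b (toL2 T b')) (h : ScalarL2 T) :
    ‖defect (volterra T) ρ (b • yosida (volterra T) δ h)
        - b • yosida (volterra T) δ (defect (volterra T) ρ h)‖
      ≤ ‖b'‖ * ‖defect (volterra T) ρ h‖ := by
  set w := yosida (volterra T) δ h
  have hcomm : yosida (volterra T) δ (defect (volterra T) ρ h) = defect (volterra T) ρ w := by
    rw [defect_apply, map_smul, accretive_volterra.yosida_comm hδ hρ, defect_apply]
  have hprim : b' • smoothing (volterra T) δ (defect (volterra T) ρ h)
      = ρ • primitive (yosida (volterra T) ρ w) • toL2 T b' := by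
    rw [smoothing_apply, hcomm, defect_apply, (volterra T).map_smul, smul_comm, volterra_apply,
      smul_toL2, smul_toL2, mul_comm]
  have hcommutator : defect (volterra T) ρ (b • w) - b • defect (volterra T) ρ w
      = smoothing (volterra T) ρ (b' • smoothing (volterra T) δ (defect (volterra T) ρ h)) := by
    rw [hprim, (smoothing (volterra T) ρ).map_smul,
      ← accretive_volterra.sub_smoothing hρ (b • w), smoothing_smul hρ hb,
      ← accretive_volterra.sub_smoothing hρ w, smul_sub]
    abel
  rw [hcomm, hcommutator]
  calc _ ≤ ‖b' • smoothing (volterra T) δ (defect (volterra T) ρ h)‖ :=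
        accretive_volterra.norm_smoothing_le hρ _
    _ ≤ ‖b'‖ * ‖smoothing (volterra T) δ (defect (volterra T) ρ h)‖ := norm_smul_le _ _
    _ ≤ ‖b'‖ * ‖defect (volterra T) ρ h‖ := by
        gcongr
        exact accretive_volterra.norm_smoothing_le hδ _

end VolterraYosida

section TestFunctions

variable {T : ℝ}

theorem IsTest.eq_zero {φ : ℝ → ℝ} (hφ : IsTest T φ) {t : ℝ} (ht : t ∉ Ioo 0 T) : φ t = 0 :=
  image_eq_zero_of_notMem_tsupport fun h => ht (hφ.2.2 h)

theorem IsTest.exists_isPrimitive {φ : ℝ → ℝ} (hφ : IsTest T φ) :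
    ∃ f f' : ℝ →ᵇ ℝ, ⇑f = φ ∧ ⇑f' = deriv φ ∧ IsPrimitive f (toL2 T f') := by
  obtain ⟨C, hC⟩ := hφ.2.1.exists_bound_of_continuous hφ.1.continuous
  have hφ' : Continuous (deriv φ) := hφ.1.continuous_deriv (by norm_num)
  obtain ⟨C', hC'⟩ := hφ.2.1.deriv.exists_bound_of_continuous hφ'
  let f : ℝ →ᵇ ℝ := .ofNormedAddCommGroup φ hφ.1.continuous C hC
  let f' : ℝ →ᵇ ℝ := .ofNormedAddCommGroup (deriv φ) hφ' C' hC'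
  exact ⟨f, f', rfl, rfl, isPrimitive_of_hasDerivAt fun t _ =>
    (hφ.1.differentiable (by norm_num) t).hasDerivAt⟩

theorem eq_zero_of_integral_test {k : ScalarL2 T}
    (h : ∀ φ : ℝ → ℝ, IsTest T φ → ∫ t, φ t * k t ∂(timeMeasure T) = 0) : k = 0 := by
  have hk : ∀ᵐ t, t ∈ Ioo 0 T → k t = 0 := by
    refine isOpen_Ioo.ae_eq_zero_of_integral_contDiff_smul_eq_zero
      (IntegrableOn.locallyIntegrableOn (integrable_scalarL2 k)) fun φ hφ hc hs => ?_
    have hφ : IsTest T φ := ⟨hφ, hc, hs⟩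
    rw [← h φ hφ, setIntegral_eq_integral_of_forall_compl_eq_zero]
    · rfl
    · intro t ht
      rw [hφ.eq_zero ht, zero_mul]
  rw [Lp.eq_zero_iff_ae_eq_zero]
  exact (ae_restrict_iff' measurableSet_Ioo).2 hk

theorem denseRange_volterra : DenseRange (volterra T) := by
  have horthogonal : (LinearMap.range (volterra T).toLinearMap)ᗮ = ⊥ := by
    refine (Submodule.eq_bot_iff _).2 fun k hk => eq_zero_of_integral_test fun φ hφ => ?_
    obtain ⟨f, f', rfl, -, hff'⟩ := hφ.exists_isPrimitive
    rw [← inner_toL2, ← hff'.volterra_eq (hφ.eq_zero (by simp))]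
    exact (Submodule.mem_orthogonal _ k).1 hk _ ⟨toL2 T f', rfl⟩
  exact Submodule.dense_iff_topologicalClosure_eq_top.2
    (Submodule.topologicalClosure_eq_top_iff.2 horthogonal)

theorem tendsto_defect_volterra (h : ScalarL2 T) :
    Tendsto (fun ρ => defect (volterra T) ρ h) (𝓝[>] 0) (𝓝 0) :=
  accretive_volterra.tendsto_defect denseRange_volterra h

end TestFunctions

section Gronwall

variable {E : Type*} [NormedAddCommGroup E] [InnerProductSpace ℝ E]

theorem norm_sq_le_of_inner_deriv_le {u u' : ℝ → E} {L K η : ℝ} (hK : 0 ≤ K) (hη : 0 ≤ η)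
    (hu : ∀ x ∈ Icc 0 L, HasDerivWithinAt u (u' x) (Icc 0 L) x)
    (h : ∀ x ∈ Icc 0 L, 2 * inner ℝ (u' x) (u x) ≤ K * ‖u x‖ ^ 2 + η) {x : ℝ}
    (hx : x ∈ Icc 0 L) : ‖u x‖ ^ 2 ≤ Real.exp (K * L) * (‖u 0‖ ^ 2 + η * L) := by
  let g : ℝ → ℝ := fun x => Real.exp (-(K * x)) * ‖u x‖ ^ 2 - η * x
  have hg : ∀ x ∈ Icc 0 L, HasDerivWithinAt g
      (Real.exp (-(K * x)) * (-K) * ‖u x‖ ^ 2 + Real.exp (-(K * x)) * (2 * inner ℝ (u x) (u' x))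
        - η) (Icc 0 L) x := fun x hx => by
    have hexp : HasDerivAt (fun x => Real.exp (-(K * x))) (Real.exp (-(K * x)) * (-K)) x :=
      ((hasDerivAt_id x).const_mul K).neg.congr_deriv (by simp) |>.exp
    exact (hexp.hasDerivWithinAt.mul (hu x hx).norm_sq).sub
      (by simpa using (hasDerivWithinAt_id x _).const_mul η)
  have hanti : AntitoneOn g (Icc 0 L) := by
    refine antitoneOn_of_hasDerivWithinAt_nonpos (convex_Icc 0 L)
      (fun x hx => (hg x hx).continuousWithinAt)
      (fun x hx => (hg x (interior_subset hx)).mono interior_subset) fun x hx => ?_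
    have hx' := interior_subset hx
    have hexp : Real.exp (-(K * x)) ≤ 1 :=
      Real.exp_le_one_iff.2 (neg_nonpos.2 (mul_nonneg hK hx'.1))
    have henergy := mul_le_mul_of_nonneg_left (h x hx') (Real.exp_pos (-(K * x))).le
    rw [real_inner_comm] at henergy
    linarith [mul_le_mul_of_nonneg_right hexp hη]
  have hgx : Real.exp (-(K * x)) * ‖u x‖ ^ 2 - η * x ≤ ‖u 0‖ ^ 2 := by
    simpa [g] using hanti ⟨le_rfl, hx.1.trans hx.2⟩ hx hx.1
  calc ‖u x‖ ^ 2 = Real.exp (K * x) * (Real.exp (-(K * x)) * ‖u x‖ ^ 2) := by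
        rw [← mul_assoc, ← Real.exp_add, add_neg_cancel, Real.exp_zero, one_mul]
    _ ≤ Real.exp (K * L) * (‖u 0‖ ^ 2 + η * L) := by
        gcongr
        exacts [hx.2, by linarith [mul_le_mul_of_nonneg_left hx.2 hη]]

end Gronwall

section RadialRetraction

variable {E : Type*} [NormedAddCommGroup E] [NormedSpace ℝ E] {R : ℝ}

/-- The radial retraction onto the ball of radius `R`. -/
noncomputable def radial (R : ℝ) (x : E) : E := (R / max R ‖x‖) • x

theorem radial_of_norm_le (hR : 0 < R) {x : E} (hx : ‖x‖ ≤ R) : radial R x = x := by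
  rw [radial, max_eq_left hx, div_self hR.ne', one_smul]

theorem smul_radial (hR : 0 < R) (x : E) : (max R ‖x‖ / R) • radial R x = x := by
  have hmax : 0 < max R ‖x‖ := lt_max_of_lt_left hR
  rw [radial, smul_smul, div_mul_div_cancel₀ hR.ne', div_self hmax.ne', one_smul]

theorem norm_radial_le (hR : 0 < R) (x : E) : ‖radial R x‖ ≤ R := by
  rw [radial, norm_smul_of_nonneg (by positivity), div_mul_eq_mul_div,
    div_le_iff₀ (lt_max_of_lt_left hR)]
  exact mul_le_mul_of_nonneg_left (le_max_right _ _) hR.le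

theorem norm_radial_le_norm (hR : 0 < R) (x : E) : ‖radial R x‖ ≤ ‖x‖ := by
  rw [radial, norm_smul_of_nonneg (by positivity)]
  exact mul_le_of_le_one_left (norm_nonneg _) (div_le_one_of_le₀ (le_max_left _ _) (by positivity))

theorem norm_radial_sub_radial_le (hR : 0 < R) (x y : E) :
    ‖radial R x - radial R y‖ ≤ 2 * ‖x - y‖ := by
  have hx : 0 < max R ‖x‖ := lt_max_of_lt_left hR
  have hy : 0 < max R ‖y‖ := lt_max_of_lt_left hR
  have hx₁ : R / max R ‖x‖ ≤ 1 := (div_le_one hx).2 (le_max_left _ _)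
  have hy₁ : ‖y‖ / max R ‖y‖ ≤ 1 := (div_le_one hy).2 (le_max_right _ _)
  have hmax : |max R ‖y‖ - max R ‖x‖| ≤ ‖x - y‖ := by
    rw [max_comm R, max_comm R, norm_sub_rev]
    exact (abs_max_sub_max_le_abs _ _ _).trans (abs_norm_sub_norm_le y x)
  have hratio : |R / max R ‖x‖ - R / max R ‖y‖| * ‖y‖
      = R / max R ‖x‖ * (|max R ‖y‖ - max R ‖x‖| * (‖y‖ / max R ‖y‖)) := by
    rw [div_sub_div _ _ hx.ne' hy.ne', mul_comm (max R ‖x‖) R, ← mul_sub, abs_div, abs_mul,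
      abs_of_pos hR, abs_of_pos (mul_pos hx hy)]
    field_simp
  calc ‖radial R x - radial R y‖
      = ‖(R / max R ‖x‖) • (x - y) + (R / max R ‖x‖ - R / max R ‖y‖) • y‖ := by
        simp only [radial]
        congr 1
        module
    _ ≤ R / max R ‖x‖ * ‖x - y‖ + |R / max R ‖x‖ - R / max R ‖y‖| * ‖y‖ := by
        rw [← norm_smul_of_nonneg (by positivity), ← Real.norm_eq_abs, ← norm_smul]
        exact norm_add_le _ _
    _ ≤ 1 * ‖x - y‖ + 1 * (‖x - y‖ * 1) := by
        rw [hratio]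
        gcongr
    _ = 2 * ‖x - y‖ := by ring

end RadialRetraction

section Existence

variable {E : Type*} [NormedAddCommGroup E]

theorem exists_solution_of_bounded_lipschitz [NormedSpace ℝ E] [CompleteSpace E] {F : E → E}
    {M K L : ℝ} (hL : 0 ≤ L) (hM : ∀ x, ‖F x‖ ≤ M) (hK : ∀ x y, ‖F x - F y‖ ≤ K * ‖x - y‖)
    (x₀ : E) :
    ∃ u : ℝ → E, u 0 = x₀ ∧ ∀ x ∈ Icc 0 L, HasDerivWithinAt u (F (u x)) (Icc 0 L) x := by
  have hM₀ : 0 ≤ M := (norm_nonneg _).trans (hM 0)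
  have hPL : IsPicardLindelof (fun _ => F) (⟨0, le_rfl, hL⟩ : Icc 0 L) x₀ (M * L).toNNReal 0
      M.toNNReal K.toNNReal := by
    refine IsPicardLindelof.of_time_independent (fun x _ => (hM x).trans (Real.le_coe_toNNReal M))
      (LipschitzOnWith.of_dist_le_mul fun x _ y _ => ?_) ?_
    · rw [dist_eq_norm, dist_eq_norm]
      exact (hK x y).trans (mul_le_mul_of_nonneg_right (Real.le_coe_toNNReal K) (norm_nonneg _))
    · simp only [sub_zero, sub_self, NNReal.coe_zero]
      rw [max_eq_left hL, Real.coe_toNNReal _ hM₀, Real.coe_toNNReal _ (by positivity)]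
  exact hPL.exists_eq_forall_mem_Icc_hasDerivWithinAt₀

variable [InnerProductSpace ℝ E] {F : E → E} {C R : ℝ}

theorem inner_comp_radial_le (hR : 0 < R) (hC : 0 ≤ C)
    (hF : ∀ x, ‖x‖ ≤ R → 2 * inner ℝ (F x) x ≤ C * ‖x‖ ^ 2) (x : E) :
    2 * inner ℝ (F (radial R x)) x ≤ C * ‖x‖ ^ 2 := by
  set s := max R ‖x‖ / R
  have hs : 0 ≤ s := by positivity
  have hsx : s * ‖radial R x‖ = ‖x‖ := by rw [← norm_smul_of_nonneg hs, smul_radial hR]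
  calc 2 * inner ℝ (F (radial R x)) x = s * (2 * inner ℝ (F (radial R x)) (radial R x)) := by
        conv_lhs => rw [← smul_radial hR x, real_inner_smul_right, smul_radial hR]
        ring
    _ ≤ s * (C * ‖radial R x‖ ^ 2) := by
        exact mul_le_mul_of_nonneg_left (hF _ (norm_radial_le hR x)) hs
    _ = C * ((s * ‖radial R x‖) * ‖radial R x‖) := by ring
    _ ≤ C * ‖x‖ ^ 2 := by
        rw [hsx, sq]
        gcongr
        exact norm_radial_le_norm hR x

/-- Precomposing `F` with the radial retraction makes it globally Lipschitz; the energy estimate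
survives and keeps the solution in the ball, where nothing has changed. -/
theorem exists_solution_of_inner_le [CompleteSpace E] {M K L : ℝ} (hL : 0 ≤ L) (hR : 0 < R)
    (hC : 0 ≤ C) (hM : ∀ x, ‖x‖ ≤ R → ‖F x‖ ≤ M) (hK₀ : 0 ≤ K)
    (hK : ∀ x y, ‖x‖ ≤ R → ‖y‖ ≤ R → ‖F x - F y‖ ≤ K * ‖x - y‖)
    (hF : ∀ x, ‖x‖ ≤ R → 2 * inner ℝ (F x) x ≤ C * ‖x‖ ^ 2) {x₀ : E}
    (hx₀ : Real.exp (C * L) * ‖x₀‖ ^ 2 ≤ R ^ 2) :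
    ∃ u : ℝ → E, u 0 = x₀ ∧ ∀ x ∈ Icc 0 L, HasDerivWithinAt u (F (u x)) (Icc 0 L) x ∧
      ‖u x‖ ≤ R ∧ ‖u x‖ ^ 2 ≤ Real.exp (C * L) * ‖x₀‖ ^ 2 := by
  have hlip (x y : E) : ‖F (radial R x) - F (radial R y)‖ ≤ K * 2 * ‖x - y‖ := by
    rw [mul_assoc]
    exact (hK _ _ (norm_radial_le hR x) (norm_radial_le hR y)).trans
      (mul_le_mul_of_nonneg_left (norm_radial_sub_radial_le hR x y) hK₀)
  obtain ⟨u, hu₀, hu⟩ := exists_solution_of_bounded_lipschitz (F := fun x => F (radial R x)) hL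
    (fun x => hM _ (norm_radial_le hR x)) hlip x₀
  have henergy : ∀ x ∈ Icc 0 L, ‖u x‖ ^ 2 ≤ Real.exp (C * L) * ‖x₀‖ ^ 2 := fun x hx => by
    have := norm_sq_le_of_inner_deriv_le hC le_rfl hu
      (fun x _ => (inner_comp_radial_le hR hC hF (u x)).trans_eq (add_zero _).symm) hx
    rwa [hu₀, zero_mul, add_zero] at this
  have hball : ∀ x ∈ Icc 0 L, ‖u x‖ ≤ R := fun x hx =>
    le_of_sq_le_sq ((henergy x hx).trans hx₀) hR.le
  refine ⟨u, hu₀, fun x hx => ⟨?_, hball x hx, henergy x hx⟩⟩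
  simpa only [radial_of_norm_le hR (hball x hx)] using hu x hx

end Existence

/-- `f` is bounded and Lipschitz on `s`. -/
def BddLipOn {X Y : Type*} [SeminormedAddCommGroup X] [SeminormedAddCommGroup Y] (s : Set X)
    (f : X → Y) : Prop :=
  ∃ C, 0 ≤ C ∧ (∀ x ∈ s, ‖f x‖ ≤ C) ∧ ∀ x ∈ s, ∀ y ∈ s, ‖f x - f y‖ ≤ C * ‖x - y‖

namespace BddLipOn

variable {X Y Z : Type*} [SeminormedAddCommGroup X] [SeminormedAddCommGroup Y]
  [SeminormedAddCommGroup Z] {s : Set X}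

theorem of_le {f : X → Y} {B K : ℝ} (hB : ∀ x ∈ s, ‖f x‖ ≤ B)
    (hK : ∀ x ∈ s, ∀ y ∈ s, ‖f x - f y‖ ≤ K * ‖x - y‖) : BddLipOn s f :=
  ⟨max (max B K) 0, le_max_right _ _,
    fun x hx => (hB x hx).trans ((le_max_left _ _).trans (le_max_left _ _)),
    fun x hx y hy => (hK x hx y hy).trans (mul_le_mul_of_nonneg_right
      ((le_max_right _ _).trans (le_max_left _ _)) (norm_nonneg _))⟩

theorem const (y : Y) : BddLipOn s fun _ => y :=
  of_le (B := ‖y‖) (K := 0) (fun _ _ => le_rfl) fun _ _ _ _ => by rw [sub_self, norm_zero, zero_mul]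

theorem add {f g : X → Y} (hf : BddLipOn s f) (hg : BddLipOn s g) :
    BddLipOn s fun x => f x + g x := by
  obtain ⟨C, -, hf, hf'⟩ := hf
  obtain ⟨D, -, hg, hg'⟩ := hg
  refine of_le (fun x hx => norm_add_le_of_le (hf x hx) (hg x hx)) (K := C + D) fun x hx y hy => ?_
  rw [add_sub_add_comm, add_mul]
  exact norm_add_le_of_le (hf' x hx y hy) (hg' x hx y hy)

theorem neg {f : X → Y} (hf : BddLipOn s f) : BddLipOn s fun x => -f x := by
  obtain ⟨C, -, hf, hf'⟩ := hf
  refine of_le (fun x hx => (norm_neg _).trans_le (hf x hx)) (K := C) fun x hx y hy => ?_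
  rw [neg_sub_neg, norm_sub_rev]
  exact hf' x hx y hy

theorem sub {f g : X → Y} (hf : BddLipOn s f) (hg : BddLipOn s g) :
    BddLipOn s fun x => f x - g x := by
  simpa only [sub_eq_add_neg] using hf.add hg.neg

theorem sum {ι : Type*} {t : Finset ι} {f : ι → X → Y} (hf : ∀ i ∈ t, BddLipOn s (f i)) :
    BddLipOn s fun x => ∑ i ∈ t, f i x := by
  simpa only [Finset.sum_fn] using
    Finset.sum_induction f (BddLipOn s) (fun _ _ => add) (const 0) hf

theorem smul {S : Type*} [SeminormedRing S] [Module S Y] [IsBoundedSMul S Y] {f : X → S}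
    {g : X → Y} (hf : BddLipOn s f) (hg : BddLipOn s g) : BddLipOn s fun x => f x • g x := by
  obtain ⟨C, hC, hf, hf'⟩ := hf
  obtain ⟨D, -, hg, hg'⟩ := hg
  refine of_le (B := C * D) (K := C * D + C * D) (fun x hx => ?_) fun x hx y hy => ?_
  · exact (norm_smul_le _ _).trans (mul_le_mul (hf x hx) (hg x hx) (norm_nonneg _) hC)
  · have hsplit : f x • g x - f y • g y = f x • (g x - g y) + (f x - f y) • g y := by
      rw [smul_sub, sub_smul]
      abel
    calc ‖f x • g x - f y • g y‖ ≤ ‖f x‖ * ‖g x - g y‖ + ‖f x - f y‖ * ‖g y‖ := by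
          rw [hsplit]
          exact norm_add_le_of_le (norm_smul_le _ _) (norm_smul_le _ _)
      _ ≤ C * (D * ‖x - y‖) + C * ‖x - y‖ * D := by
          gcongr
          exacts [hf x hx, hg' x hx y hy, hf' x hx y hy, hg y hy]
      _ = (C * D + C * D) * ‖x - y‖ := by ring

theorem const_smul [NormedSpace ℝ Y] (r : ℝ) {f : X → Y} (hf : BddLipOn s f) :
    BddLipOn s fun x => r • f x :=
  (const r).smul hf

theorem mul {S : Type*} [SeminormedRing S] {f g : X → S} (hf : BddLipOn s f)
    (hg : BddLipOn s g) : BddLipOn s fun x => f x * g x :=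
  hf.smul hg

theorem clm [NormedSpace ℝ Y] [NormedSpace ℝ Z] (A : Y →L[ℝ] Z) {f : X → Y}
    (hf : BddLipOn s f) : BddLipOn s fun x => A (f x) := by
  obtain ⟨C, -, hf, hf'⟩ := hf
  refine of_le (fun x hx => A.le_opNorm_of_le (hf x hx)) (K := ‖A‖ * C) fun x hx y hy => ?_
  rw [← map_sub, mul_assoc]
  exact A.le_opNorm_of_le (hf' x hx y hy)

theorem truncInv {W : Type*} [TopologicalSpace W] {κ : ℝ} (hκ : 0 < κ) {f : X → W →ᵇ ℝ}
    (hf : BddLipOn s f) : BddLipOn s fun x => truncInv hκ (f x) := by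
  obtain ⟨C, -, -, hf⟩ := hf
  refine of_le (fun x _ => norm_truncInv_le hκ (f x)) (K := κ⁻¹ * κ⁻¹ * C) fun x hx y hy => ?_
  rw [mul_assoc _ C]
  exact (norm_truncInv_sub_truncInv_le hκ _ _).trans (by gcongr; exact hf x hx y hy)

end BddLipOn

section Vectors

variable {ι : Type*} [Fintype ι] {T : ℝ}

/-- Families of real-valued `L²` functions on `(0, T)`, with the `ℓ²` norm. -/
abbrev VectorL2 (ι : Type*) (T : ℝ) : Type _ := PiLp 2 fun _ : ι => ScalarL2 T

/-- The operator `A`, applied to every component of a family. -/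
noncomputable def componentwise (ι : Type*) (A : ScalarL2 T →L[ℝ] ScalarL2 T) :
    VectorL2 ι T →L[ℝ] VectorL2 ι T :=
  ((PiLp.continuousLinearEquiv 2 ℝ fun _ : ι => ScalarL2 T).symm : _ →L[ℝ] _).comp
    (ContinuousLinearMap.pi fun i => A.comp (PiLp.proj 2 (𝕜 := ℝ) _ i))

/-- The diagonal matrix of functions `b`, applied to a family. -/
noncomputable def diagSMul (b : ι → ℝ →ᵇ ℝ) (v : VectorL2 ι T) : VectorL2 ι T :=
  WithLp.toLp 2 fun i => b i • v i

omit [Fintype ι] in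
theorem diagSMul_apply (b : ι → ℝ →ᵇ ℝ) (v : VectorL2 ι T) (i : ι) :
    diagSMul b v i = b i • v i := rfl

theorem norm_le_mul_norm_of_apply_le {v w : VectorL2 ι T} {C : ℝ} (hC : 0 ≤ C)
    (h : ∀ i, ‖v i‖ ≤ C * ‖w i‖) : ‖v‖ ≤ C * ‖w‖ := by
  refine le_of_sq_le_sq ?_ (by positivity)
  rw [mul_pow, PiLp.norm_sq_eq_of_L2, PiLp.norm_sq_eq_of_L2, Finset.mul_sum]
  exact Finset.sum_le_sum fun i _ =>
    (pow_le_pow_left₀ (norm_nonneg _) (h i) 2).trans_eq (mul_pow _ _ _)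

theorem norm_le_sum_norm_apply (v : VectorL2 ι T) : ‖v‖ ≤ ∑ i, ‖v i‖ := by
  refine le_of_sq_le_sq ?_ (by positivity)
  rw [PiLp.norm_sq_eq_of_L2]
  exact Finset.sum_sq_le_sq_sum_of_nonneg fun i _ => norm_nonneg _

/-- The Volterra operator, applied to every component of a family. -/
noncomputable abbrev vecVolterra (ι : Type*) (T : ℝ) : VectorL2 ι T →L[ℝ] VectorL2 ι T :=
  componentwise ι (volterra T)

theorem accretive_vecVolterra : Accretive (vecVolterra ι T) := fun v => by
  rw [PiLp.inner_apply]
  exact Finset.sum_nonneg fun i _ => accretive_volterra (v i)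

variable {ρ : ℝ} (hρ : 0 < ρ)

include hρ

theorem yosida_vecVolterra_apply (v : VectorL2 ι T) (i : ι) :
    yosida (vecVolterra ι T) ρ v i = yosida (volterra T) ρ (v i) :=
  (accretive_volterra.yosida_eq_of_add_eq hρ
    (congrArg (· i) (accretive_vecVolterra.yosida_spec hρ v))).symm

theorem defect_vecVolterra_apply (v : VectorL2 ι T) (i : ι) :
    defect (vecVolterra ι T) ρ v i = defect (volterra T) ρ (v i) := by
  rw [defect_apply, PiLp.smul_apply, yosida_vecVolterra_apply hρ, defect_apply]

theorem inner_diagSMul_yosida_ge {b b' : ι → ℝ →ᵇ ℝ}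
    (hb : ∀ i, IsPrimitive (b i) (toL2 T (b' i))) (hb₀ : ∀ i, ∀ t ∈ Icc 0 T, 0 ≤ b i t)
    (h : VectorL2 ι T) :
    -(‖b'‖ * ‖h‖ ^ 2) ≤ 2 * inner ℝ (diagSMul b (yosida (vecVolterra ι T) ρ h)) h := by
  rw [PiLp.inner_apply, PiLp.norm_sq_eq_of_L2, Finset.mul_sum, Finset.mul_sum,
    ← Finset.sum_neg_distrib]
  refine Finset.sum_le_sum fun i _ => ?_
  rw [diagSMul_apply, yosida_vecVolterra_apply hρ]
  refine le_trans ?_ (inner_smul_yosida_ge hρ (hb i) (hb₀ i) (h i))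
  gcongr
  exact norm_le_pi_norm b' i

theorem norm_defect_diagSMul_yosida_sub_le {δ : ℝ} (hδ : 0 < δ) {b b' : ι → ℝ →ᵇ ℝ}
    (hb : ∀ i, IsPrimitive (b i) (toL2 T (b' i))) (h : VectorL2 ι T) :
    ‖defect (vecVolterra ι T) ρ (diagSMul b (yosida (vecVolterra ι T) δ h))
        - diagSMul b (yosida (vecVolterra ι T) δ (defect (vecVolterra ι T) ρ h))‖
      ≤ ‖b'‖ * ‖defect (vecVolterra ι T) ρ h‖ := by
  refine norm_le_mul_norm_of_apply_le (norm_nonneg b') fun i => ?_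
  simp only [PiLp.sub_apply, diagSMul_apply, defect_vecVolterra_apply hρ,
    yosida_vecVolterra_apply hδ]
  refine (norm_defect_transport_le hρ hδ (hb i) (h i)).trans ?_
  gcongr
  exact norm_le_pi_norm b' i

omit hρ in
theorem tendsto_defect_vecVolterra (h : VectorL2 ι T) :
    Tendsto (fun ρ => defect (vecVolterra ι T) ρ h) (𝓝[>] 0) (𝓝 0) := by
  rw [tendsto_zero_iff_norm_tendsto_zero]
  have hsum : Tendsto (fun ρ => ∑ i, ‖defect (volterra T) ρ (h i)‖) (𝓝[>] 0) (𝓝 0) := by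
    simpa using tendsto_finsetSum Finset.univ fun i _ => (tendsto_defect_volterra (h i)).norm
  refine squeeze_zero' (.of_forall fun _ => norm_nonneg _) ?_ hsum
  filter_upwards [self_mem_nhdsWithin] with ρ (hρ : 0 < ρ)
  simp only [← defect_vecVolterra_apply hρ]
  exact norm_le_sum_norm_apply _

omit [Fintype ι] hρ in
theorem vecVolterra_injective : Function.Injective (vecVolterra ι T) := fun _ _ h =>
  PiLp.ext fun i => accretive_volterra.injective denseRange_volterra (congrArg (· i) h)

end Vectors

section Lipschitz

variable {X Y ι : Type*} [SeminormedAddCommGroup X] [SeminormedAddCommGroup Y] [Fintype ι]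
  {s : Set X}

theorem BddLipOn.pi {f : X → ι → Y} (hf : ∀ i, BddLipOn s fun x => f x i) : BddLipOn s f := by
  choose C hC hf hf' using hf
  have hle (i : ι) : C i ≤ ∑ j, C j := Finset.single_le_sum (fun j _ => hC j) (Finset.mem_univ i)
  have hsum : 0 ≤ ∑ j, C j := Finset.sum_nonneg fun j _ => hC j
  refine ⟨∑ j, C j, hsum, fun x hx => (pi_norm_le_iff_of_nonneg hsum).2 fun i =>
    (hf i x hx).trans (hle i), fun x hx y hy => (pi_norm_le_iff_of_nonneg (by positivity)).2
    fun i => (hf' i x hx y hy).trans (by gcongr; exact hle i)⟩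

theorem BddLipOn.toVectorL2 {T : ℝ} {f : X → ι → ScalarL2 T}
    (hf : ∀ i, BddLipOn s fun x => f x i) :
    BddLipOn s fun x => (WithLp.toLp 2 (f x) : VectorL2 ι T) :=
  (BddLipOn.pi hf).clm ((PiLp.continuousLinearEquiv 2 ℝ fun _ : ι =>
    ScalarL2 T).symm.toContinuousLinearMap)

theorem BddLipOn.comp {X' : Type*} [SeminormedAddCommGroup X'] {s' : Set X'} {f : X → Y}
    (hf : BddLipOn s f) {g : X' → X} (hg : BddLipOn s' g) (hgs : MapsTo g s' s) :
    BddLipOn s' fun x => f (g x) := by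
  obtain ⟨C, hC, hf, hf'⟩ := hf
  obtain ⟨D, -, -, hg⟩ := hg
  refine of_le (fun x hx => hf _ (hgs hx)) (K := C * D) fun x hx y hy => ?_
  rw [mul_assoc]
  exact (hf' _ (hgs hx) _ (hgs hy)).trans (by gcongr; exact hg x hx y hy)

theorem BddLipOn.continuousOn {f : X → Y} (hf : BddLipOn s f) : ContinuousOn f s := by
  obtain ⟨C, hC, -, hf⟩ := hf
  refine (LipschitzOnWith.of_dist_le_mul (K := ⟨C, hC⟩) fun x hx y hy => ?_).continuousOn
  rw [dist_eq_norm, dist_eq_norm]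
  exact hf x hx y hy

end Lipschitz

/-- The coefficients of the diagonal system
`sᵢ (∂ₓ mᵢ) + ∂ₜ mᵢ = ∑ⱼ βᵢⱼ mⱼ` with speeds `sᵢ = μᵢ + ∑ⱼ ℓᵢⱼ mⱼ`, together with their time
derivatives, and a lower bound `κ` for the speeds to be considered. -/
structure DiagonalSystem (ι : Type*) (T : ℝ) where
  κ : ℝ
  κ_pos : 0 < κ
  β : ι → ι → ℝ →ᵇ ℝ
  β' : ι → ι → ℝ →ᵇ ℝ
  β'' : ι → ι → ScalarL2 T
  isPrimitive_β : ∀ i j, IsPrimitive (β i j) (toL2 T (β' i j))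
  isPrimitive_β' : ∀ i j, IsPrimitive (β' i j) (β'' i j)
  μ : ι → ℝ →ᵇ ℝ
  μ' : ι → ℝ →ᵇ ℝ
  μ'' : ι → ScalarL2 T
  isPrimitive_μ : ∀ i, IsPrimitive (μ i) (toL2 T (μ' i))
  isPrimitive_μ' : ∀ i, IsPrimitive (μ' i) (μ'' i)
  ℓ : ι → ι → ℝ

/-- Pairs `u = (h, k)`, where `h` stands for `∂ₜ² m` and `k` for an approximation of `∂ₜ² m` that
replaces it in the transport term. The system itself corresponds to `k = h`. -/
abbrev Unknown (ι : Type*) (T : ℝ) : Type _ := VectorL2 ι T × VectorL2 ι T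

section Unknown

variable {ι : Type*} {T : ℝ}

/-- The function `mⱼ` with `∂ₜ² mⱼ = hⱼ` and `mⱼ = ∂ₜ mⱼ = 0` at time `0`. -/
noncomputable def value (u : Unknown ι T) (j : ι) : ℝ →ᵇ ℝ := primitive (volterra T (u.1 j))

/-- The derivative `∂ₜ mⱼ`. -/
noncomputable def timeDeriv (u : Unknown ι T) (j : ι) : ℝ →ᵇ ℝ := primitive (u.1 j)

@[simp]
theorem value_apply_zero (u : Unknown ι T) (j : ι) : value u j 0 = 0 := primitive_apply_zero _

@[simp]
theorem timeDeriv_apply_zero (u : Unknown ι T) (j : ι) : timeDeriv u j 0 = 0 :=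
  primitive_apply_zero _

@[simp]
theorem value_zero (j : ι) : value (0 : Unknown ι T) j = 0 := by simp [value]

@[simp]
theorem timeDeriv_zero (j : ι) : timeDeriv (0 : Unknown ι T) j = 0 := by simp [timeDeriv]

theorem isPrimitive_value (u : Unknown ι T) (j : ι) :
    IsPrimitive (value u j) (toL2 T (timeDeriv u j)) :=
  isPrimitive_primitive _

theorem isPrimitive_timeDeriv (u : Unknown ι T) (j : ι) : IsPrimitive (timeDeriv u j) (u.1 j) :=
  isPrimitive_primitive _

section BddLipOn

open Metric

variable [Fintype ι] (R : ℝ)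

theorem bddLipOn_fst : BddLipOn (closedBall (0 : Unknown ι T) R) Prod.fst :=
  .of_le (B := R) (K := 1)
    (fun u hu => (norm_fst_le u).trans (mem_closedBall_zero_iff.1 hu)) fun u _ v _ => by
      rw [one_mul]; exact norm_fst_le (u - v)

theorem bddLipOn_snd : BddLipOn (closedBall (0 : Unknown ι T) R) Prod.snd :=
  .of_le (B := R) (K := 1)
    (fun u hu => (norm_snd_le u).trans (mem_closedBall_zero_iff.1 hu)) fun u _ v _ => by
      rw [one_mul]; exact norm_snd_le (u - v)

theorem bddLipOn_fst_apply (j : ι) : BddLipOn (closedBall (0 : Unknown ι T) R) fun u => u.1 j :=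
  (bddLipOn_fst R).clm (PiLp.proj 2 (𝕜 := ℝ) (fun _ : ι => ScalarL2 T) j)

theorem bddLipOn_snd_apply (j : ι) : BddLipOn (closedBall (0 : Unknown ι T) R) fun u => u.2 j :=
  (bddLipOn_snd R).clm (PiLp.proj 2 (𝕜 := ℝ) (fun _ : ι => ScalarL2 T) j)

theorem bddLipOn_timeDeriv (j : ι) :
    BddLipOn (closedBall (0 : Unknown ι T) R) fun u => timeDeriv u j :=
  (bddLipOn_fst_apply R j).clm primitive

theorem bddLipOn_value (j : ι) : BddLipOn (closedBall (0 : Unknown ι T) R) fun u => value u j :=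
  ((bddLipOn_fst_apply R j).clm (volterra T)).clm primitive

end BddLipOn

end Unknown

namespace DiagonalSystem

variable {ι : Type*} [Fintype ι] {T : ℝ} (c : DiagonalSystem ι T)

/-- The speed `sᵢ`. -/
noncomputable def speed (u : Unknown ι T) (i : ι) : ℝ →ᵇ ℝ := c.μ i + ∑ j, c.ℓ i j • value u j

/-- The derivative `∂ₜ sᵢ`. -/
noncomputable def speed' (u : Unknown ι T) (i : ι) : ℝ →ᵇ ℝ :=
  c.μ' i + ∑ j, c.ℓ i j • timeDeriv u j

/-- The second derivative `∂ₜ² sᵢ`. -/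
noncomputable def speed'' (u : Unknown ι T) (i : ι) : ScalarL2 T :=
  c.μ'' i + ∑ j, c.ℓ i j • u.1 j

/-- The reciprocal `1 / sᵢ`, cut off so that it is defined for all `u`. -/
noncomputable def slowness (u : Unknown ι T) (i : ι) : ℝ →ᵇ ℝ := truncInv c.κ_pos (c.speed u i)

/-- The derivative `∂ₜ (1 / sᵢ)`. -/
noncomputable def slowness' (u : Unknown ι T) (i : ι) : ℝ →ᵇ ℝ :=
  -(c.slowness u i * c.slowness u i * c.speed' u i)

/-- The source term `∑ⱼ βᵢⱼ mⱼ`. -/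
noncomputable def source (u : Unknown ι T) (i : ι) : ℝ →ᵇ ℝ := ∑ j, c.β i j * value u j

/-- The time derivative of the source term. -/
noncomputable def source' (u : Unknown ι T) (i : ι) : ℝ →ᵇ ℝ :=
  ∑ j, (c.β' i j * value u j + c.β i j * timeDeriv u j)

/-- The second time derivative of the source term. -/
noncomputable def source'' (u : Unknown ι T) (i : ι) : ScalarL2 T :=
  ∑ j, (value u j • c.β'' i j + (2 : ℝ) • toL2 T (c.β' i j * timeDeriv u j) + c.β i j • u.1 j)

/-- `∑ⱼ βᵢⱼ mⱼ - ∂ₜ mᵢ`, with `∂ₜ mᵢ` computed from the second entry of `u`. -/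
noncomputable def residual (u : Unknown ι T) (i : ι) : ℝ →ᵇ ℝ := c.source u i - primitive (u.2 i)

/-- The time derivative of the residual. -/
noncomputable def residual' (u : Unknown ι T) (i : ι) : ScalarL2 T :=
  toL2 T (c.source' u i) - u.2 i

/-- `∂ₓ m` according to the system. -/
noncomputable def xDeriv (u : Unknown ι T) (i : ι) : ℝ →ᵇ ℝ := c.slowness u i * c.residual u i

/-- `∂ₜ ∂ₓ m` according to the system. -/
noncomputable def xDeriv' (u : Unknown ι T) : VectorL2 ι T := WithLp.toLp 2 fun i =>
  c.slowness u i • (c.residual' u i - c.xDeriv u i • toL2 T (c.speed' u i))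

/-- The terms of `∂ₜ² ∂ₓ m` that contain no third time derivative of `m`. -/
noncomputable def lowerOrder (u : Unknown ι T) : VectorL2 ι T := WithLp.toLp 2 fun i =>
  c.slowness u i • (c.source'' u i - (2 : ℝ) • c.speed' u i • c.xDeriv' u i
    - c.xDeriv u i • c.speed'' u i)

/-- The `u` for which all speeds are at least `κ`. -/
def supersonic : Set (Unknown ι T) := {u | ∀ i, ∀ t ∈ Icc 0 T, c.κ ≤ c.speed u i t}

section Primitives

variable {c} {u : Unknown ι T} {i : ι}

theorem isPrimitive_speed : IsPrimitive (c.speed u i) (toL2 T (c.speed' u i)) := by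
  simp only [speed', map_add, map_sum, ContinuousLinearMap.map_smul]
  exact (c.isPrimitive_μ i).add (.sum fun j _ => (isPrimitive_value u j).const_smul (c.ℓ i j))

theorem isPrimitive_speed' : IsPrimitive (c.speed' u i) (c.speed'' u i) :=
  (c.isPrimitive_μ' i).add (.sum fun j _ => (isPrimitive_timeDeriv u j).const_smul (c.ℓ i j))

theorem isPrimitive_slowness (hu : u ∈ c.supersonic) :
    IsPrimitive (c.slowness u i) (toL2 T (c.slowness' u i)) :=
  isPrimitive_speed.truncInv c.κ_pos (hu i)

theorem isPrimitive_source : IsPrimitive (c.source u i) (toL2 T (c.source' u i)) := by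
  rw [source', map_sum]
  refine .sum fun j _ => ?_
  convert (c.isPrimitive_β i j).mul (isPrimitive_value u j) using 1
  rw [smul_toL2, smul_toL2, ← map_add, add_comm, mul_comm (c.β' i j)]

theorem isPrimitive_source' : IsPrimitive (c.source' u i) (c.source'' u i) := by
  refine .sum fun j _ => ?_
  convert ((c.isPrimitive_β' i j).mul (isPrimitive_value u j)).add
    ((c.isPrimitive_β i j).mul (isPrimitive_timeDeriv u j)) using 1
  rw [smul_toL2, smul_toL2, mul_comm (timeDeriv u j), two_smul]
  abel

theorem isPrimitive_residual : IsPrimitive (c.residual u i) (c.residual' u i) :=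
  isPrimitive_source.sub (isPrimitive_primitive (u.2 i))

theorem isPrimitive_xDeriv (hu : u ∈ c.supersonic) :
    IsPrimitive (c.xDeriv u i) (c.xDeriv' u i) := by
  rw [xDeriv]
  convert (isPrimitive_slowness hu).mul isPrimitive_residual using 1
  change c.slowness u i • (c.residual' u i - _) = _
  rw [slowness', toL2_eq_smul_one (-_), toL2_eq_smul_one (c.speed' u i), xDeriv]
  module

@[simp]
theorem xDeriv_apply_zero (u : Unknown ι T) (i : ι) : c.xDeriv u i 0 = 0 := by
  simp [xDeriv, residual, source]

theorem vecVolterra_xDeriv' (hu : u ∈ c.supersonic) :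
    vecVolterra ι T (c.xDeriv' u) = WithLp.toLp 2 fun i => toL2 T (c.xDeriv u i) := by
  ext1 i
  exact (isPrimitive_xDeriv hu).volterra_eq (xDeriv_apply_zero u i)

/-- The second time derivative of `∂ₓ m`, when the approximation of `∂ₜ² m` is itself
differentiable in time. -/
theorem vecVolterra_lowerOrder_sub (hu : u ∈ c.supersonic) {w : VectorL2 ι T}
    (hw : u.2 = vecVolterra ι T w) :
    vecVolterra ι T (c.lowerOrder u - diagSMul (c.slowness u) w) = c.xDeriv' u := by
  ext1 i
  let r : ℝ →ᵇ ℝ := c.source' u i - primitive (w i)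
  have hr : toL2 T r = c.residual' u i := by rw [residual', hw, map_sub]; rfl
  have hr' : IsPrimitive r (c.source'' u i - w i) :=
    isPrimitive_source'.sub (isPrimitive_primitive (w i))
  let y : ℝ →ᵇ ℝ := c.slowness u i * (r - c.speed' u i * c.xDeriv u i)
  have hy : toL2 T y = c.xDeriv' u i := by
    change _ = c.slowness u i • _
    rw [← hr, smul_toL2, ← map_sub, smul_toL2, mul_comm (c.xDeriv u i)]
  have hy' : IsPrimitive y (c.lowerOrder u i - c.slowness u i • w i) := by
    convert (isPrimitive_slowness hu).mul
      (hr'.sub (isPrimitive_speed'.mul (isPrimitive_xDeriv hu))) using 1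
    change c.slowness u i • _ - _ = _
    rw [← hy, slowness', toL2_eq_smul_one (-_), toL2_eq_smul_one y, two_smul]
    simp only [y]
    module
  rw [← hy]
  exact hy'.volterra_eq (by simp [y, r, source'])

end Primitives

section Zero

theorem xDeriv_zero (i : ι) : c.xDeriv 0 i = 0 := by simp [xDeriv, residual, source]

theorem xDeriv'_zero : c.xDeriv' 0 = 0 := by
  ext1 i
  change c.slowness 0 i • (c.residual' 0 i - c.xDeriv 0 i • _) = 0
  rw [xDeriv_zero, zero_smul (ℝ →ᵇ ℝ) (toL2 T _)]
  simp [residual', source']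

theorem lowerOrder_zero : c.lowerOrder 0 = 0 := by
  ext1 i
  change c.slowness 0 i • (c.source'' 0 i - (2 : ℝ) • c.speed' 0 i • c.xDeriv' 0 i
    - c.xDeriv 0 i • _) = 0
  have hsource : c.source'' 0 i = 0 := Finset.sum_eq_zero fun j _ => by
    rw [value_zero, zero_smul (ℝ →ᵇ ℝ) (c.β'' i j)]
    simp
  rw [hsource, xDeriv_zero, zero_smul (ℝ →ᵇ ℝ) (c.speed'' 0 i), xDeriv'_zero]
  simp

end Zero

section BddLipOn

open Metric

variable (R : ℝ)

theorem bddLipOn_speed (i : ι) : BddLipOn (closedBall 0 R) fun u => c.speed u i :=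
  (BddLipOn.const _).add (.sum fun j _ => (bddLipOn_value R j).const_smul _)

theorem bddLipOn_speed' (i : ι) : BddLipOn (closedBall 0 R) fun u => c.speed' u i :=
  (BddLipOn.const _).add (.sum fun j _ => (bddLipOn_timeDeriv R j).const_smul _)

theorem bddLipOn_speed'' (i : ι) : BddLipOn (closedBall 0 R) fun u => c.speed'' u i :=
  (BddLipOn.const _).add (.sum fun j _ => (bddLipOn_fst_apply R j).const_smul _)

theorem bddLipOn_slowness_apply (i : ι) : BddLipOn (closedBall 0 R) fun u => c.slowness u i :=
  (c.bddLipOn_speed R i).truncInv c.κ_pos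

theorem bddLipOn_slowness'_apply (i : ι) : BddLipOn (closedBall 0 R) fun u => c.slowness' u i :=
  (((c.bddLipOn_slowness_apply R i).mul (c.bddLipOn_slowness_apply R i)).mul
    (c.bddLipOn_speed' R i)).neg

theorem bddLipOn_slowness' : BddLipOn (closedBall 0 R) c.slowness' :=
  .pi (c.bddLipOn_slowness'_apply R)

theorem bddLipOn_source (i : ι) : BddLipOn (closedBall 0 R) fun u => c.source u i :=
  .sum fun j _ => (BddLipOn.const _).mul (bddLipOn_value R j)

theorem bddLipOn_source' (i : ι) : BddLipOn (closedBall 0 R) fun u => c.source' u i :=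
  .sum fun j _ => ((BddLipOn.const _).mul (bddLipOn_value R j)).add
    ((BddLipOn.const _).mul (bddLipOn_timeDeriv R j))

theorem bddLipOn_source'' (i : ι) : BddLipOn (closedBall 0 R) fun u => c.source'' u i :=
  .sum fun j _ => (((bddLipOn_value R j).smul (.const _)).add
    ((((BddLipOn.const _).mul (bddLipOn_timeDeriv R j)).clm (toL2 T)).const_smul 2)).add
    ((BddLipOn.const (c.β i j)).smul (bddLipOn_fst_apply R j))

theorem bddLipOn_residual (i : ι) : BddLipOn (closedBall 0 R) fun u => c.residual u i :=
  (c.bddLipOn_source R i).sub ((bddLipOn_snd_apply R i).clm primitive)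

theorem bddLipOn_residual' (i : ι) : BddLipOn (closedBall 0 R) fun u => c.residual' u i :=
  ((c.bddLipOn_source' R i).clm (toL2 T)).sub (bddLipOn_snd_apply R i)

theorem bddLipOn_xDeriv (i : ι) : BddLipOn (closedBall 0 R) fun u => c.xDeriv u i :=
  (c.bddLipOn_slowness_apply R i).mul (c.bddLipOn_residual R i)

theorem bddLipOn_xDeriv'_apply (i : ι) : BddLipOn (closedBall 0 R) fun u => c.xDeriv' u i :=
  (c.bddLipOn_slowness_apply R i).smul ((c.bddLipOn_residual' R i).sub
    ((c.bddLipOn_xDeriv R i).smul ((c.bddLipOn_speed' R i).clm (toL2 T))))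

theorem bddLipOn_xDeriv' : BddLipOn (closedBall 0 R) c.xDeriv' :=
  .toVectorL2 (c.bddLipOn_xDeriv'_apply R)

theorem bddLipOn_lowerOrder : BddLipOn (closedBall 0 R) c.lowerOrder :=
  .toVectorL2 fun i => (c.bddLipOn_slowness_apply R i).smul (((c.bddLipOn_source'' R i).sub
    (((c.bddLipOn_speed' R i).smul (c.bddLipOn_xDeriv'_apply R i)).const_smul 2)).sub
    ((c.bddLipOn_xDeriv R i).smul (c.bddLipOn_speed'' R i)))

end BddLipOn

end DiagonalSystem

section Regularity

variable {ι : Type*} [Fintype ι] {T : ℝ} {s : Set (Unknown ι T)}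

/-- The functions `f u`, `u ∈ s`, are bounded in the Sobolev space `H¹`. -/
def H1BddOn (s : Set (Unknown ι T)) (f : Unknown ι T → ℝ →ᵇ ℝ) : Prop :=
  ∃ (f' : Unknown ι T → ScalarL2 T) (C : ℝ), 0 ≤ C ∧
    ∀ u ∈ s, IsPrimitive (f u) (f' u) ∧ ‖f u‖ ≤ C ∧ ‖f' u‖ ≤ C

theorem H1BddOn.of_bddLipOn {f : Unknown ι T → ℝ →ᵇ ℝ} {f' : Unknown ι T → ScalarL2 T}
    (hf : BddLipOn s f) (hf' : BddLipOn s f') (h : ∀ u ∈ s, IsPrimitive (f u) (f' u)) :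
    H1BddOn s f := by
  obtain ⟨C, hC, hf, -⟩ := hf
  obtain ⟨D, hD, hf', -⟩ := hf'
  exact ⟨f', C + D, by positivity, fun u hu => ⟨h u hu,
    (hf u hu).trans (le_add_of_nonneg_right hD), (hf' u hu).trans (le_add_of_nonneg_left hC)⟩⟩

omit [Fintype ι] in
theorem H1BddOn.const {f : ℝ →ᵇ ℝ} {f' : ScalarL2 T} (h : IsPrimitive f f') :
    H1BddOn s fun _ => f :=
  ⟨fun _ => f', ‖f‖ + ‖f'‖, by positivity, fun _ _ => ⟨h,
    le_add_of_nonneg_right (norm_nonneg _), le_add_of_nonneg_left (norm_nonneg _)⟩⟩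

/-- The size of the part of `u` removed by smoothing at scale `ρ`. -/
noncomputable def defectSum (ρ : ℝ) (u : Unknown ι T) : ℝ :=
  ‖defect (vecVolterra ι T) ρ u.1‖ + ‖defect (vecVolterra ι T) ρ u.2‖

theorem defectSum_nonneg (ρ : ℝ) (u : Unknown ι T) : 0 ≤ defectSum ρ u := by
  unfold defectSum
  positivity

/-- `f u` is bounded in `L²` and, uniformly for `u ∈ s`, at least as regular in time as `u`. -/
def DefectBddOn (s : Set (Unknown ι T)) (f : Unknown ι T → ScalarL2 T) : Prop :=
  ∃ C, 0 ≤ C ∧ ∃ η : ℝ → ℝ, Tendsto η (𝓝[>] 0) (𝓝 0) ∧ (∀ u ∈ s, ‖f u‖ ≤ C) ∧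
    ∀ ρ, 0 < ρ → ∀ u ∈ s, ‖defect (volterra T) ρ (f u)‖ ≤ C * defectSum ρ u + η ρ

namespace DefectBddOn

variable {f g : Unknown ι T → ScalarL2 T}

theorem of_norm_defect_le (hf : BddLipOn s f)
    (h : ∀ ρ, 0 < ρ → ∀ u, ‖defect (volterra T) ρ (f u)‖ ≤ defectSum ρ u) : DefectBddOn s f := by
  obtain ⟨C, hC, hf, -⟩ := hf
  refine ⟨C + 1, by positivity, fun _ => 0, tendsto_const_nhds,
    fun u hu => (hf u hu).trans (le_add_of_nonneg_right zero_le_one), fun ρ hρ u _ => ?_⟩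
  linarith [h ρ hρ u, mul_nonneg hC (defectSum_nonneg ρ u)]

theorem const (k : ScalarL2 T) : DefectBddOn s fun _ => k :=
  ⟨‖k‖, norm_nonneg _, fun ρ => ‖defect (volterra T) ρ k‖,
    by simpa using (tendsto_defect_volterra k).norm, fun _ _ => le_rfl,
    fun ρ _ u _ => le_add_of_nonneg_left (mul_nonneg (norm_nonneg _) (defectSum_nonneg ρ u))⟩

theorem add (hf : DefectBddOn s f) (hg : DefectBddOn s g) :
    DefectBddOn s fun u => f u + g u := by
  obtain ⟨C, hC, η, hη, hf, hf'⟩ := hf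
  obtain ⟨D, hD, θ, hθ, hg, hg'⟩ := hg
  refine ⟨C + D, by positivity, fun ρ => η ρ + θ ρ, by simpa using hη.add hθ,
    fun u hu => norm_add_le_of_le (hf u hu) (hg u hu), fun ρ hρ u hu => ?_⟩
  rw [map_add]
  refine (norm_add_le_of_le (hf' ρ hρ u hu) (hg' ρ hρ u hu)).trans_eq ?_
  ring

theorem smul {A : Unknown ι T → ℝ →ᵇ ℝ} (hA : H1BddOn s A) (hf : DefectBddOn s f) :
    DefectBddOn s fun u => A u • f u := by
  obtain ⟨A', K, hK, hA⟩ := hA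
  obtain ⟨C, hC, η, hη, hf, hf'⟩ := hf
  refine ⟨K * C, by positivity, fun ρ => K * |η ρ| + √(2 * ρ) * (K * C), ?_,
    fun u hu => (norm_smul_le _ _).trans
      (mul_le_mul (hA u hu).2.1 (hf u hu) (norm_nonneg _) hK), fun ρ hρ u hu => ?_⟩
  · have hsqrt : Tendsto (fun ρ : ℝ => √(2 * ρ) * (K * C)) (𝓝[>] 0) (𝓝 (√(2 * 0) * (K * C))) :=
      Continuous.tendsto (by fun_prop) 0 |>.mono_left nhdsWithin_le_nhds
    simpa using (hη.abs.const_mul K).add hsqrt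
  · obtain ⟨hAA', hA, hA'⟩ := hA u hu
    calc ‖defect (volterra T) ρ (A u • f u)‖
        ≤ ‖A u‖ * ‖defect (volterra T) ρ (f u)‖ + √(2 * ρ) * (‖A' u‖ * ‖f u‖) :=
          norm_defect_smul_le hρ hAA' (f u)
      _ ≤ K * (C * defectSum ρ u + |η ρ|) + √(2 * ρ) * (K * C) := by
          gcongr
          exacts [(hf' ρ hρ u hu).trans (by gcongr; exact le_abs_self _), hf u hu]
      _ = K * C * defectSum ρ u + (K * |η ρ| + √(2 * ρ) * (K * C)) := by ring

theorem const_smul (r : ℝ) (hf : DefectBddOn s f) : DefectBddOn s fun u => r • f u := by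
  obtain ⟨C, hC, η, hη, hf, hf'⟩ := hf
  refine ⟨|r| * C, by positivity, fun ρ => |r| * η ρ, by simpa using hη.const_mul |r|,
    fun u hu => ?_, fun ρ hρ u hu => ?_⟩
  · rw [norm_smul, Real.norm_eq_abs]
    gcongr
    exact hf u hu
  · rw [map_smul, norm_smul, Real.norm_eq_abs, mul_assoc, ← mul_add]
    gcongr
    exact hf' ρ hρ u hu

theorem sub (hf : DefectBddOn s f) (hg : DefectBddOn s g) :
    DefectBddOn s fun u => f u - g u := by
  simpa only [sub_eq_add_neg, neg_one_smul] using hf.add (hg.const_smul (-1))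

theorem sum {J : Type*} {t : Finset J} {F : J → Unknown ι T → ScalarL2 T}
    (hF : ∀ i ∈ t, DefectBddOn s (F i)) : DefectBddOn s fun u => ∑ i ∈ t, F i u := by
  simpa only [Finset.sum_fn] using
    Finset.sum_induction F (DefectBddOn s) (fun _ _ => add) (const 0) hF

theorem toL2 {A : Unknown ι T → ℝ →ᵇ ℝ} (hA : H1BddOn s A) :
    DefectBddOn s fun u => toL2 T (A u) := by
  simpa only [← toL2_eq_smul_one] using smul hA (const (SupersonicDuct.toL2 T 1))

theorem fst_apply (R : ℝ) (j : ι) :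
    DefectBddOn (Metric.closedBall (0 : Unknown ι T) R) fun u => u.1 j :=
  of_norm_defect_le (bddLipOn_fst_apply R j) fun ρ hρ u => by
    rw [← defect_vecVolterra_apply hρ]
    exact (PiLp.norm_apply_le _ j).trans (le_add_of_nonneg_right (norm_nonneg _))

theorem snd_apply (R : ℝ) (j : ι) :
    DefectBddOn (Metric.closedBall (0 : Unknown ι T) R) fun u => u.2 j :=
  of_norm_defect_le (bddLipOn_snd_apply R j) fun ρ hρ u => by
    rw [← defect_vecVolterra_apply hρ]
    exact (PiLp.norm_apply_le _ j).trans (le_add_of_nonneg_left (norm_nonneg _))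

end DefectBddOn

namespace DiagonalSystem

open Metric

variable {c : DiagonalSystem ι T} {R : ℝ} (hR : closedBall 0 R ⊆ c.supersonic)

theorem defectBddOn_source'' (i : ι) :
    DefectBddOn (closedBall 0 R) fun u => c.source'' u i := by
  have hvalue (j : ι) : H1BddOn (closedBall 0 R) fun u : Unknown ι T => value u j :=
    .of_bddLipOn (bddLipOn_value R j) ((bddLipOn_timeDeriv R j).clm (toL2 T))
      fun u _ => isPrimitive_value u j
  have htimeDeriv (j : ι) : H1BddOn (closedBall 0 R) fun u : Unknown ι T => timeDeriv u j :=
    .of_bddLipOn (bddLipOn_timeDeriv R j) (bddLipOn_fst_apply R j)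
      fun u _ => isPrimitive_timeDeriv u j
  simp only [source'', ← smul_toL2]
  exact .sum fun j _ => ((DefectBddOn.smul (hvalue j) (.const _)).add
    ((DefectBddOn.smul (.const (c.isPrimitive_β' i j)) (.toL2 (htimeDeriv j))).const_smul 2)).add
    (.smul (.const (c.isPrimitive_β i j)) (.fst_apply R j))

include hR

theorem defectBddOn_lowerOrder_apply (i : ι) :
    DefectBddOn (closedBall 0 R) fun u => c.lowerOrder u i := by
  have hslow : H1BddOn (closedBall 0 R) fun u => c.slowness u i :=
    .of_bddLipOn (c.bddLipOn_slowness_apply R i)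
      ((c.bddLipOn_slowness'_apply R i).clm (toL2 T)) fun u hu => isPrimitive_slowness (hR hu)
  have hspeed' : H1BddOn (closedBall 0 R) fun u => c.speed' u i :=
    .of_bddLipOn (c.bddLipOn_speed' R i) (c.bddLipOn_speed'' R i) fun u _ => isPrimitive_speed'
  have hxDeriv : H1BddOn (closedBall 0 R) fun u => c.xDeriv u i :=
    .of_bddLipOn (c.bddLipOn_xDeriv R i) (c.bddLipOn_xDeriv'_apply R i)
      fun u hu => isPrimitive_xDeriv (hR hu)
  have hsource' : H1BddOn (closedBall 0 R) fun u => c.source' u i :=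
    .of_bddLipOn (c.bddLipOn_source' R i) (c.bddLipOn_source'' R i) fun u _ => isPrimitive_source'
  have hspeed'' : DefectBddOn (closedBall 0 R) fun u => c.speed'' u i :=
    (DefectBddOn.const _).add (.sum fun j _ => (DefectBddOn.fst_apply R j).const_smul _)
  have hxDeriv' : DefectBddOn (closedBall 0 R) fun u => c.xDeriv' u i :=
    .smul hslow (((DefectBddOn.toL2 hsource').sub (.snd_apply R i)).sub
      (.smul hxDeriv (.toL2 hspeed')))
  exact .smul hslow (((defectBddOn_source'' i).sub
    ((DefectBddOn.smul hspeed' hxDeriv').const_smul 2)).sub (.smul hxDeriv hspeed''))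

theorem exists_norm_defect_lowerOrder_le : ∃ C, 0 ≤ C ∧ ∃ η : ℝ → ℝ, Tendsto η (𝓝[>] 0) (𝓝 0) ∧
    ∀ ρ, 0 < ρ → ∀ u ∈ closedBall (0 : Unknown ι T) R,
      ‖defect (vecVolterra ι T) ρ (c.lowerOrder u)‖ ≤ C * defectSum ρ u + η ρ := by
  choose C hC η hη _ hle using fun i => defectBddOn_lowerOrder_apply hR i
  refine ⟨∑ i, C i, Finset.sum_nonneg fun i _ => hC i, fun ρ => ∑ i, η i ρ,
    by simpa using tendsto_finsetSum Finset.univ fun i _ => hη i, fun ρ hρ u hu => ?_⟩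
  rw [Finset.sum_mul, ← Finset.sum_add_distrib]
  refine (norm_le_sum_norm_apply _).trans (Finset.sum_le_sum fun i _ => ?_)
  rw [defect_vecVolterra_apply hρ]
  exact hle i ρ hρ u hu

end DiagonalSystem

end Regularity

namespace DiagonalSystem

open Metric

variable {ι : Type*} [Fintype ι] {T : ℝ} {c : DiagonalSystem ι T} {R L : ℝ}

section Regularized

/-- The unknown `(h, k)` in which `k` is a smoothed version of `h`. -/
noncomputable def smoothed (δ : ℝ) : VectorL2 ι T →L[ℝ] Unknown ι T :=
  (ContinuousLinearMap.id ℝ _).prod (smoothing (vecVolterra ι T) δ)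

/-- The right-hand side of the equation for `h = ∂ₜ² m` in which the Yosida approximation replaces
the derivative `∂ₜ h`. -/
noncomputable def field (c : DiagonalSystem ι T) (δ : ℝ) (h : VectorL2 ι T) : VectorL2 ι T :=
  c.lowerOrder (smoothed δ h)
    - diagSMul (c.slowness (smoothed δ h)) (yosida (vecVolterra ι T) δ h)

variable {δ ρ : ℝ} (hδ : 0 < δ)

include hδ

theorem norm_smoothed_le (h : VectorL2 ι T) : ‖smoothed δ h‖ ≤ ‖h‖ :=
  max_le le_rfl (accretive_vecVolterra.norm_smoothing_le hδ h)

theorem smoothed_mem_closedBall {h : VectorL2 ι T} (hh : ‖h‖ ≤ R) :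
    smoothed δ h ∈ closedBall 0 R :=
  mem_closedBall_zero_iff.2 ((norm_smoothed_le hδ h).trans hh)

theorem defectSum_smoothed_le (hρ : 0 < ρ) (h : VectorL2 ι T) :
    defectSum ρ (smoothed δ h) ≤ 2 * ‖defect (vecVolterra ι T) ρ h‖ := by
  have hcomm : defect (vecVolterra ι T) ρ (smoothing (vecVolterra ι T) δ h)
      = smoothing (vecVolterra ι T) δ (defect (vecVolterra ι T) ρ h) := by
    rw [defect_apply, defect_apply, smoothing_apply, accretive_vecVolterra.yosida_apply_apply hρ,
      smoothing_apply, accretive_vecVolterra.yosida_comm hρ hδ, map_smul, smoothing_apply]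
  change _ + ‖defect _ ρ (smoothing _ δ h)‖ ≤ _
  rw [hcomm, two_mul]
  exact add_le_add le_rfl (accretive_vecVolterra.norm_smoothing_le hδ _)

theorem vecVolterra_field (hR : closedBall 0 R ⊆ c.supersonic) {h : VectorL2 ι T} (hh : ‖h‖ ≤ R) :
    vecVolterra ι T (c.field δ h) = c.xDeriv' (smoothed δ h) :=
  vecVolterra_lowerOrder_sub (hR (smoothed_mem_closedBall hδ hh)) rfl

theorem bddLipOn_field : BddLipOn (closedBall 0 R) (c.field δ) := by
  have hid : BddLipOn (closedBall 0 R) fun h : VectorL2 ι T => h :=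
    .of_le (K := 1) (fun h hh => mem_closedBall_zero_iff.1 hh) fun _ _ _ _ => (one_mul _).ge
  have hsmoothed : BddLipOn (closedBall (0 : VectorL2 ι T) R) (smoothed δ) := hid.clm _
  have hmaps : MapsTo (smoothed δ) (closedBall (0 : VectorL2 ι T) R) (closedBall 0 R) :=
    fun h hh => smoothed_mem_closedBall hδ (mem_closedBall_zero_iff.1 hh)
  have hyosida (i : ι) : BddLipOn (closedBall (0 : VectorL2 ι T) R) fun h =>
      yosida (vecVolterra ι T) δ h i :=
    (hid.clm (yosida (vecVolterra ι T) δ)).clm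
      (PiLp.proj 2 (𝕜 := ℝ) (fun _ : ι => ScalarL2 T) i)
  have hslow (i : ι) : BddLipOn (closedBall (0 : VectorL2 ι T) R) fun h =>
      c.slowness (smoothed δ h) i :=
    (c.bddLipOn_slowness_apply R i).comp hsmoothed hmaps
  exact ((c.bddLipOn_lowerOrder R).comp hsmoothed hmaps).sub
    (.toVectorL2 fun i => (hslow i).smul (hyosida i))

end Regularized

section Energy

variable (hR : closedBall 0 R ⊆ c.supersonic)

include hR

theorem exists_two_mul_inner_field_le : ∃ K, 0 ≤ K ∧ ∀ δ, 0 < δ → ∀ h, ‖h‖ ≤ R →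
    2 * inner ℝ (c.field δ h) h ≤ K * ‖h‖ ^ 2 := by
  obtain ⟨C, hC, -, hlower⟩ := c.bddLipOn_lowerOrder R
  obtain ⟨D, hD, hslow, -⟩ := c.bddLipOn_slowness' R
  refine ⟨2 * C + D, by positivity, fun δ hδ h hh => ?_⟩
  have hmem := smoothed_mem_closedBall hδ hh
  have htransport := inner_diagSMul_yosida_ge hδ (fun i => isPrimitive_slowness (i := i) (hR hmem))
    (fun i t _ => truncInv_nonneg c.κ_pos _ t) h
  have hlower_le : ‖c.lowerOrder (smoothed δ h)‖ ≤ C * ‖h‖ := by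
    have := hlower _ hmem 0 (mem_closedBall_self ((norm_nonneg h).trans hh))
    rw [lowerOrder_zero, sub_zero, sub_zero] at this
    exact this.trans (by gcongr; exact norm_smoothed_le hδ h)
  have hinner : inner ℝ (c.lowerOrder (smoothed δ h)) h ≤ C * ‖h‖ ^ 2 := by
    rw [sq, ← mul_assoc]
    exact (real_inner_le_norm _ _).trans (by gcongr)
  have hslow_le : ‖c.slowness' (smoothed δ h)‖ * ‖h‖ ^ 2 ≤ D * ‖h‖ ^ 2 := by
    gcongr
    exact hslow _ hmem
  rw [field, inner_sub_left]
  linarith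

theorem exists_two_mul_inner_defect_field_le : ∃ K, 0 ≤ K ∧ ∃ η : ℝ → ℝ,
    Tendsto η (𝓝[>] 0) (𝓝 0) ∧ (∀ ρ, 0 ≤ η ρ) ∧ ∀ ρ, 0 < ρ → ∀ δ, 0 < δ → ∀ h, ‖h‖ ≤ R →
      2 * inner ℝ (defect (vecVolterra ι T) ρ (c.field δ h)) (defect (vecVolterra ι T) ρ h)
        ≤ K * ‖defect (vecVolterra ι T) ρ h‖ ^ 2 + η ρ := by
  obtain ⟨C, hC, η, hη, hlower⟩ := exists_norm_defect_lowerOrder_le hR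
  obtain ⟨D, hD, hslow, -⟩ := c.bddLipOn_slowness' R
  refine ⟨4 * C + 1 + 3 * D, by positivity, fun ρ => η ρ ^ 2, by simpa using hη.pow 2,
    fun ρ => sq_nonneg _, fun ρ hρ δ hδ h hh => ?_⟩
  have hmem := smoothed_mem_closedBall hδ hh
  have hslow := hslow _ hmem
  set d := defect (vecVolterra ι T) ρ h
  set a := c.slowness (smoothed δ h) with ha
  set a' := c.slowness' (smoothed δ h)
  have hprim (i : ι) : IsPrimitive (a i) (toL2 T (a' i)) := isPrimitive_slowness (hR hmem)
  have htransport := inner_diagSMul_yosida_ge hδ hprim (fun i t _ => truncInv_nonneg c.κ_pos _ t) d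
  set e := defect (vecVolterra ι T) ρ (diagSMul a (yosida (vecVolterra ι T) δ h))
    - diagSMul a (yosida (vecVolterra ι T) δ d) with he
  have hcommutator : ‖e‖ ≤ D * ‖d‖ :=
    (norm_defect_diagSMul_yosida_sub_le hρ hδ hprim h).trans (by gcongr)
  have hlower : ‖defect (vecVolterra ι T) ρ (c.lowerOrder (smoothed δ h))‖ ≤ 2 * C * ‖d‖ + η ρ := by
    refine (hlower ρ hρ _ hmem).trans ?_
    rw [mul_comm 2 C, mul_assoc]
    gcongr
    exact defectSum_smoothed_le hδ hρ h
  have hsplit : defect (vecVolterra ι T) ρ (c.field δ h)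
      = defect (vecVolterra ι T) ρ (c.lowerOrder (smoothed δ h))
        - diagSMul a (yosida (vecVolterra ι T) δ d) - e := by
    rw [field, map_sub, he, ← ha]
    abel
  rw [hsplit, inner_sub_left, inner_sub_left]
  have hlower_inner := (real_inner_le_norm _ d).trans
    (mul_le_mul_of_nonneg_right hlower (norm_nonneg d))
  have hcommutator_inner := ((neg_le_abs _).trans (abs_real_inner_le_norm e d)).trans
    (mul_le_mul_of_nonneg_right hcommutator (norm_nonneg d))
  have hslow_le : ‖a'‖ * ‖d‖ ^ 2 ≤ D * ‖d‖ ^ 2 := by gcongr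
  linarith [two_mul_le_add_sq (η ρ) ‖d‖]

end Energy

section Difference

theorem norm_toL2_value_sub_le (u v : Unknown ι T) (j : ι) :
    ‖toL2 T (value u j - value v j)‖ ≤ ‖vecVolterra ι T (vecVolterra ι T (u.1 - v.1))‖ := by
  have hvalue : toL2 T (value u j - value v j)
      = vecVolterra ι T (vecVolterra ι T (u.1 - v.1)) j := by
    rw [value, value, ← map_sub, ← map_sub, ← volterra_apply]
    rfl
  rw [hvalue]
  exact PiLp.norm_apply_le _ j

theorem norm_toL2_source_sub_le (u v : Unknown ι T) (i : ι) :
    ‖toL2 T (c.source u i - c.source v i)‖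
      ≤ (∑ j, ‖c.β i j‖) * ‖vecVolterra ι T (vecVolterra ι T (u.1 - v.1))‖ := by
  rw [source, source, ← Finset.sum_sub_distrib, map_sum, Finset.sum_mul]
  refine norm_sum_le_of_le _ fun j _ => ?_
  rw [← mul_sub, ← smul_toL2]
  exact (norm_smul_le _ _).trans (by gcongr; exact norm_toL2_value_sub_le u v j)

theorem norm_toL2_speed_sub_le (u v : Unknown ι T) (i : ι) :
    ‖toL2 T (c.speed u i - c.speed v i)‖
      ≤ (∑ j, |c.ℓ i j|) * ‖vecVolterra ι T (vecVolterra ι T (u.1 - v.1))‖ := by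
  rw [speed, speed, add_sub_add_left_eq_sub, ← Finset.sum_sub_distrib, map_sum, Finset.sum_mul]
  refine norm_sum_le_of_le _ fun j _ => ?_
  rw [map_sub, ContinuousLinearMap.map_smul, ContinuousLinearMap.map_smul, ← smul_sub, ← map_sub,
    norm_smul, Real.norm_eq_abs]
  gcongr
  exact norm_toL2_value_sub_le u v j

theorem norm_toL2_slowness_sub_le (u v : Unknown ι T) (i : ι) :
    ‖toL2 T (c.slowness u i - c.slowness v i)‖ ≤ c.κ⁻¹ * c.κ⁻¹ * ((∑ j, |c.ℓ i j|)
      * ‖vecVolterra ι T (vecVolterra ι T (u.1 - v.1))‖) := by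
  have hκ := c.κ_pos
  refine (norm_toL2_le_of_abs_le (g := c.speed u i - c.speed v i) fun t => ?_).trans
    (mul_le_mul_of_nonneg_left (norm_toL2_speed_sub_le u v i) (by positivity))
  have hlip := (lipschitzWith_inv_max hκ).dist_le_mul (c.speed u i t) (c.speed v i t)
  rwa [Real.coe_toNNReal _ (by positivity), Real.dist_eq, Real.dist_eq] at hlip

theorem toL2_xDeriv_sub (u v : Unknown ι T) (i : ι) :
    toL2 T (c.xDeriv u i) - toL2 T (c.xDeriv v i)
      = c.slowness u i • toL2 T (c.source u i - c.source v i)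
        + c.residual v i • toL2 T (c.slowness u i - c.slowness v i)
        + c.slowness u i • volterra T ((u.1 - u.2 - (v.1 - v.2)) i)
        - c.slowness u i • volterra T ((u.1 - v.1) i) := by
  rw [← map_sub, volterra_apply, volterra_apply, smul_toL2, smul_toL2, smul_toL2, smul_toL2,
    ← map_add, ← map_add, ← map_sub]
  congr 1
  simp only [xDeriv, residual, PiLp.sub_apply, map_sub]
  ring

/-- The transport term contributes `⟨a V² g, V g⟩`, whose part containing the highest derivative is
controlled by an integration by parts in time. -/
theorem exists_two_mul_inner_xDeriv_sub_le (c : DiagonalSystem ι T) (R : ℝ) (i : ι) :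
    ∃ K, 0 ≤ K ∧ ∀ u ∈ closedBall 0 R ∩ c.supersonic, ∀ v ∈ closedBall 0 R,
      2 * inner ℝ (toL2 T (c.xDeriv u i) - toL2 T (c.xDeriv v i))
          (vecVolterra ι T (vecVolterra ι T (u.1 - v.1)) i)
        ≤ K * ‖vecVolterra ι T (vecVolterra ι T (u.1 - v.1))‖ ^ 2
          + K * ‖u.1 - u.2 - (v.1 - v.2)‖ ^ 2 := by
  obtain ⟨A, hA, hslow, -⟩ := c.bddLipOn_slowness_apply R i
  obtain ⟨D, hD, hslow', -⟩ := c.bddLipOn_slowness'_apply R i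
  obtain ⟨Q, hQ, hres, -⟩ := c.bddLipOn_residual R i
  have hκ := c.κ_pos
  set B := ∑ j, ‖c.β i j‖
  set Λ := c.κ⁻¹ * c.κ⁻¹ * ∑ j, |c.ℓ i j|
  have : 0 ≤ B := by positivity
  have : 0 ≤ Λ := by positivity
  set N := ‖volterra T‖
  refine ⟨2 * (A * B + Q * Λ) + A * N + D, by positivity, fun u ⟨hu, hsup⟩ v hv => ?_⟩
  have hsource := norm_toL2_source_sub_le (c := c) u v i
  have hslow_sub := norm_toL2_slowness_sub_le (c := c) u v i
  rw [← mul_assoc] at hslow_sub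
  rw [toL2_xDeriv_sub]
  have htransport := inner_smul_volterra_ge (isPrimitive_slowness (i := i) hsup)
    (fun t _ => truncInv_nonneg hκ _ t) (volterra T ((u.1 - v.1) i))
  set W := vecVolterra ι T (vecVolterra ι T (u.1 - v.1))
  set d := u.1 - u.2 - (v.1 - v.2)
  set a := c.slowness u i
  have hWi : ‖W i‖ ≤ ‖W‖ := PiLp.norm_apply_le W i
  have hlower : ‖a • toL2 T (c.source u i - c.source v i)
      + c.residual v i • toL2 T (c.slowness u i - c.slowness v i) + a • volterra T (d i)‖
      ≤ A * (B * ‖W‖) + Q * (Λ * ‖W‖) + A * (N * ‖d‖) := by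
    refine norm_add₃_le.trans (add_le_add_three ?_ ?_ ?_) <;> refine (norm_smul_le _ _).trans ?_
    · gcongr
      exact hslow u hu
    · gcongr
      exact hres v hv
    · gcongr
      exacts [hslow u hu, (volterra T).le_opNorm_of_le (PiLp.norm_apply_le d i)]
  have hlower_inner := (real_inner_le_norm _ _).trans
    (mul_le_mul hlower hWi (norm_nonneg _) (by positivity))
  have hslow'_le : ‖c.slowness' u i‖ * ‖W i‖ ^ 2 ≤ D * ‖W‖ ^ 2 := by
    gcongr
    exact hslow' u hu
  have hcross : A * N * (2 * (‖d‖ * ‖W‖)) ≤ A * N * (‖W‖ ^ 2 + ‖d‖ ^ 2) := by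
    gcongr
    linarith [two_mul_le_add_sq ‖d‖ ‖W‖]
  have hrest : 0 ≤ (2 * (A * B + Q * Λ) + D) * ‖d‖ ^ 2 := by positivity
  rw [inner_sub_left]
  change -(‖c.slowness' u i‖ * ‖W i‖ ^ 2) ≤ 2 * inner ℝ _ (W i) at htransport
  linarith

theorem exists_two_mul_inner_vecVolterra_xDeriv'_sub_le (c : DiagonalSystem ι T) (R : ℝ) :
    ∃ K, 0 ≤ K ∧ ∀ u ∈ closedBall 0 R ∩ c.supersonic, ∀ v ∈ closedBall 0 R ∩ c.supersonic,
      2 * inner ℝ (vecVolterra ι T (c.xDeriv' u) - vecVolterra ι T (c.xDeriv' v))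
          (vecVolterra ι T (vecVolterra ι T (u.1 - v.1)))
        ≤ K * ‖vecVolterra ι T (vecVolterra ι T (u.1 - v.1))‖ ^ 2
          + K * ‖u.1 - u.2 - (v.1 - v.2)‖ ^ 2 := by
  choose K hK hle using exists_two_mul_inner_xDeriv_sub_le c R
  refine ⟨∑ i, K i, Finset.sum_nonneg fun i _ => hK i, fun u hu v hv => ?_⟩
  rw [vecVolterra_xDeriv' hu.2, vecVolterra_xDeriv' hv.2, PiLp.inner_apply, Finset.mul_sum,
    Finset.sum_mul, Finset.sum_mul, ← Finset.sum_add_distrib]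
  exact Finset.sum_le_sum fun i _ => hle i u hu v hv.1

theorem exists_norm_vecVolterra_sub_le (c : DiagonalSystem ι T) (R L : ℝ) :
    ∃ C, ∀ p q : ℝ → Unknown ι T,
      (∀ x ∈ Icc 0 L, p x ∈ closedBall 0 R ∩ c.supersonic) →
      (∀ x ∈ Icc 0 L, q x ∈ closedBall 0 R ∩ c.supersonic) →
      (∀ x ∈ Icc 0 L, HasDerivWithinAt (fun x => vecVolterra ι T (p x).1)
        (c.xDeriv' (p x)) (Icc 0 L) x) →
      (∀ x ∈ Icc 0 L, HasDerivWithinAt (fun x => vecVolterra ι T (q x).1)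
        (c.xDeriv' (q x)) (Icc 0 L) x) →
      (p 0).1 = (q 0).1 → ∀ r,
      (∀ x ∈ Icc 0 L, ‖(p x).1 - (p x).2 - ((q x).1 - (q x).2)‖ ≤ r) →
      ∀ x ∈ Icc 0 L, ‖vecVolterra ι T (vecVolterra ι T ((p x).1 - (q x).1))‖ ≤ C * r := by
  obtain ⟨K, hK, hle⟩ := exists_two_mul_inner_vecVolterra_xDeriv'_sub_le c R
  refine ⟨√(Real.exp (K * L) * (K * L)), fun p q hp hq hp' hq' h₀ r hd x hx => ?_⟩
  have hr : 0 ≤ r := (norm_nonneg _).trans (hd x hx)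
  have hderiv : ∀ x ∈ Icc 0 L, HasDerivWithinAt
      (fun x => vecVolterra ι T (vecVolterra ι T ((p x).1 - (q x).1)))
      (vecVolterra ι T (c.xDeriv' (p x)) - vecVolterra ι T (c.xDeriv' (q x))) (Icc 0 L) x := by
    intro x hx
    simp only [map_sub]
    exact ((vecVolterra ι T).hasFDerivAt.comp_hasDerivWithinAt x (hp' x hx)).sub
      ((vecVolterra ι T).hasFDerivAt.comp_hasDerivWithinAt x (hq' x hx))
  have hgronwall := norm_sq_le_of_inner_deriv_le hK (by positivity : 0 ≤ K * r ^ 2) hderiv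
    (fun x hx => (hle _ (hp x hx) _ (hq x hx)).trans (by gcongr; exact hd x hx)) hx
  rw [h₀, sub_self, map_zero, map_zero, norm_zero, sq (0 : ℝ), mul_zero, zero_add] at hgronwall
  refine le_of_sq_le_sq ?_ (by positivity)
  have hL := hx.1.trans hx.2
  rw [mul_pow, Real.sq_sqrt (by positivity)]
  linarith

end Difference

end DiagonalSystem

section Calculus

variable {E : Type*} [NormedAddCommGroup E] [NormedSpace ℝ E] [CompleteSpace E] {L x : ℝ}

theorem integral_eq_sub_of_hasDerivWithinAt_Icc {u u' : ℝ → E}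
    (hu : ∀ x ∈ Icc 0 L, HasDerivWithinAt u (u' x) (Icc 0 L) x) (hu' : ContinuousOn u' (Icc 0 L))
    (hx : x ∈ Icc 0 L) : ∫ y in (0 : ℝ)..x, u' y = u x - u 0 := by
  have hsub : Icc 0 x ⊆ Icc 0 L := Icc_subset_Icc_right hx.2
  refine intervalIntegral.integral_eq_sub_of_hasDerivAt_of_le hx.1
    (fun y hy => (hu y (hsub hy)).continuousWithinAt.mono hsub) (fun y hy => ?_)
    (hu'.mono (by rwa [uIcc_of_le hx.1])).intervalIntegrable
  exact (hu y (hsub (Ioo_subset_Icc_self hy))).hasDerivAt (Icc_mem_nhds hy.1 (hy.2.trans_le hx.2))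

theorem hasDerivWithinAt_of_integral_eq_sub {u u' : ℝ → E} (hu' : ContinuousOn u' (Icc 0 L))
    (hu : ∀ x ∈ Icc 0 L, ∫ y in (0 : ℝ)..x, u' y = u x - u 0) (hx : x ∈ Icc 0 L) :
    HasDerivWithinAt u (u' x) (Icc 0 L) x := by
  have : Fact (x ∈ Icc 0 L) := ⟨hx⟩
  have hint : IntervalIntegrable u' volume 0 x :=
    (hu'.mono (by rw [uIcc_of_le hx.1]; exact Icc_subset_Icc_right hx.2)).intervalIntegrable
  refine ((intervalIntegral.integral_hasDerivWithinAt_right hint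
    (hu'.stronglyMeasurableAtFilter_nhdsWithin measurableSet_Icc x) (hu' x hx)).const_add
      (u 0)).congr_of_mem (fun y hy => ?_) hx
  rw [hu y hy, add_sub_cancel]

theorem hasDerivWithinAt_of_tendsto {ι : Type*} {l : Filter ι} [l.NeBot] [l.IsCountablyGenerated]
    {f f' : ι → ℝ → E} {g g' : ℝ → E} {K : ℝ}
    (hf : ∀ᶠ n in l, ∀ x ∈ Icc 0 L, HasDerivWithinAt (f n) (f' n x) (Icc 0 L) x)
    (hf' : ∀ᶠ n in l, ContinuousOn (f' n) (Icc 0 L))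
    (hK : ∀ᶠ n in l, ∀ x ∈ Icc 0 L, ‖f' n x‖ ≤ K)
    (hfg : ∀ x ∈ Icc 0 L, Tendsto (fun n => f n x) l (𝓝 (g x)))
    (hfg' : ∀ x ∈ Icc 0 L, Tendsto (fun n => f' n x) l (𝓝 (g' x)))
    (hg' : ContinuousOn g' (Icc 0 L)) (hx : x ∈ Icc 0 L) :
    HasDerivWithinAt g (g' x) (Icc 0 L) x := by
  refine hasDerivWithinAt_of_integral_eq_sub hg' (fun x hx => ?_) hx
  have hsub : uIoc 0 x ⊆ Icc 0 L := by
    rw [uIoc_of_le hx.1]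
    exact Ioc_subset_Icc_self.trans (Icc_subset_Icc_right hx.2)
  have hintegral : Tendsto (fun n => ∫ y in (0 : ℝ)..x, f' n y) l
      (𝓝 (∫ y in (0 : ℝ)..x, g' y)) := by
    refine intervalIntegral.tendsto_integral_filter_of_dominated_convergence (fun _ => K) ?_ ?_
      intervalIntegrable_const (.of_forall fun y hy => hfg' y (hsub hy))
    · filter_upwards [hf'] with n hn
      exact (hn.mono hsub).aestronglyMeasurable measurableSet_uIoc
    · filter_upwards [hK] with n hn
      exact .of_forall fun y hy => hn y (hsub hy)
  refine tendsto_nhds_unique hintegral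
    (((hfg x hx).sub (hfg 0 ⟨le_rfl, hx.1.trans hx.2⟩)).congr' ?_)
  filter_upwards [hf, hf'] with n hn hn'
  exact (integral_eq_sub_of_hasDerivWithinAt_Icc hn hn' hx).symm

end Calculus

namespace DiagonalSystem

open Metric

variable {ι : Type*} [Fintype ι] {T : ℝ} {c : DiagonalSystem ι T} {R L : ℝ}

section Approximation

/-- `u` solves the regularised equation with parameter `δ` on `[0, L]`, with initial value `h₀`,
and stays in the ball of radius `R`. -/
structure IsApprox (c : DiagonalSystem ι T) (R L δ : ℝ) (h₀ : VectorL2 ι T)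
    (u : ℝ → VectorL2 ι T) : Prop where
  zero : u 0 = h₀
  norm_le : ∀ x ∈ Icc 0 L, ‖u x‖ ≤ R
  deriv : ∀ x ∈ Icc 0 L, HasDerivWithinAt u (c.field δ (u x)) (Icc 0 L) x

variable (hR : closedBall 0 R ⊆ c.supersonic)

include hR

theorem exists_isApprox (hL : 0 ≤ L) (hR₀ : 0 < R) : ∃ C, 0 < C ∧ ∀ h₀ : VectorL2 ι T,
    C * ‖h₀‖ ≤ R → ∀ δ, 0 < δ → ∃ u, c.IsApprox R L δ h₀ u ∧ ∀ x ∈ Icc 0 L, ‖u x‖ ≤ C * ‖h₀‖ := by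
  obtain ⟨C, hC, henergy⟩ := exists_two_mul_inner_field_le hR
  have hsq (h₀ : VectorL2 ι T) :
      (Real.exp (C * L / 2) * ‖h₀‖) ^ 2 = Real.exp (C * L) * ‖h₀‖ ^ 2 := by
    rw [mul_pow, ← Real.exp_nat_mul, Nat.cast_ofNat, mul_div_cancel₀ _ two_ne_zero]
  refine ⟨Real.exp (C * L / 2), Real.exp_pos _, fun h₀ hh₀ δ hδ => ?_⟩
  obtain ⟨K, hK, hbound, hlip⟩ := c.bddLipOn_field (R := R) hδ
  simp only [mem_closedBall_zero_iff] at hbound hlip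
  obtain ⟨u, hu₀, hu⟩ := exists_solution_of_inner_le hL hR₀ hC hbound hK
    (fun x y hx hy => hlip x hx y hy) (henergy δ hδ)
    (hsq h₀ ▸ pow_le_pow_left₀ (by positivity) hh₀ 2)
  exact ⟨u, ⟨hu₀, fun x hx => (hu x hx).2.1, fun x hx => (hu x hx).1⟩, fun x hx =>
    le_of_sq_le_sq ((hu x hx).2.2.trans_eq (hsq h₀).symm) (by positivity)⟩

theorem exists_norm_defect_le (L : ℝ) (h₀ : VectorL2 ι T) : ∃ θ : ℝ → ℝ,
    Tendsto θ (𝓝[>] 0) (𝓝 0) ∧ ∀ ρ, 0 < ρ → ∀ δ, 0 < δ → ∀ u, c.IsApprox R L δ h₀ u →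
      ∀ x ∈ Icc 0 L, ‖defect (vecVolterra ι T) ρ (u x)‖ ≤ θ ρ := by
  obtain ⟨K, hK, η, hη, hη₀, hle⟩ := exists_two_mul_inner_defect_field_le hR
  refine ⟨fun ρ => √(Real.exp (K * L) * (‖defect (vecVolterra ι T) ρ h₀‖ ^ 2 + η ρ * L)), ?_,
    fun ρ hρ δ hδ u hu x hx => Real.le_sqrt_of_sq_le ?_⟩
  · simpa using ((((tendsto_defect_vecVolterra h₀).norm.pow 2).add
      (hη.mul_const L)).const_mul (Real.exp (K * L))).sqrt
  · rw [← hu.zero]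
    exact norm_sq_le_of_inner_deriv_le (u := fun x => defect (vecVolterra ι T) ρ (u x)) hK (hη₀ ρ)
      (fun x hx => (defect (vecVolterra ι T) ρ).hasFDerivAt.comp_hasDerivWithinAt x (hu.deriv x hx))
      (fun x hx => hle ρ hρ δ hδ _ (hu.norm_le x hx)) hx

omit hR in
theorem IsApprox.continuousOn {δ : ℝ} {h₀ : VectorL2 ι T} {u : ℝ → VectorL2 ι T}
    (hu : c.IsApprox R L δ h₀ u) : ContinuousOn u (Icc 0 L) :=
  fun x hx => (hu.deriv x hx).continuousWithinAt

theorem IsApprox.hasDerivWithinAt_vecVolterra {δ : ℝ} (hδ : 0 < δ) {h₀ : VectorL2 ι T}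
    {u : ℝ → VectorL2 ι T} (hu : c.IsApprox R L δ h₀ u) {x : ℝ} (hx : x ∈ Icc 0 L) :
    HasDerivWithinAt (fun x => vecVolterra ι T (u x)) (c.xDeriv' (smoothed δ (u x)))
      (Icc 0 L) x := by
  rw [← vecVolterra_field hδ hR (hu.norm_le x hx)]
  exact (vecVolterra ι T).hasFDerivAt.comp_hasDerivWithinAt x (hu.deriv x hx)

variable {h₀ : VectorL2 ι T} {u : ℝ → ℝ → VectorL2 ι T}
  (hu : ∀ δ, 0 < δ → c.IsApprox R L δ h₀ (u δ))

include hu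

/-- The difference estimate bounds `V² (u_δ - u_δ')` by the defects, which are uniformly small;
interpolating this with the defect at scale `ρ` recovers the norm of `u_δ - u_δ'` itself. -/
theorem exists_norm_approx_sub_le : ∃ (C : ℝ) (θ : ℝ → ℝ), Tendsto θ (𝓝[>] 0) (𝓝 0) ∧
    ∀ ρ, 0 < ρ → ∀ δ, 0 < δ → ∀ δ', 0 < δ' → ∀ x ∈ Icc 0 L,
      ‖u δ x - u δ' x‖ ≤ 4 * θ ρ + ρ⁻¹ * (ρ⁻¹ * (C * (θ δ + θ δ'))) := by
  obtain ⟨θ, hθ, hdefect⟩ := exists_norm_defect_le hR L h₀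
  obtain ⟨C, hdiff⟩ := exists_norm_vecVolterra_sub_le c R L
  refine ⟨C, θ, hθ, fun ρ hρ δ hδ δ' hδ' x hx => ?_⟩
  have hdefect_sub (ρ) (hρ : 0 < ρ) (ρ') (hρ' : 0 < ρ') (x) (hx : x ∈ Icc 0 L) :
      ‖defect (vecVolterra ι T) ρ (u δ x) - defect (vecVolterra ι T) ρ' (u δ' x)‖
        ≤ θ ρ + θ ρ' :=
    norm_sub_le_of_le (hdefect ρ hρ δ hδ _ (hu δ hδ) x hx)
      (hdefect ρ' hρ' δ' hδ' _ (hu δ' hδ') x hx)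
  have hmem (δ) (hδ : 0 < δ) (x) (hx : x ∈ Icc 0 L) :
      smoothed δ (u δ x) ∈ closedBall 0 R ∩ c.supersonic :=
    have h := smoothed_mem_closedBall hδ ((hu δ hδ).norm_le x hx)
    ⟨h, hR h⟩
  have hsub_smoothing (δ) (hδ : 0 < δ) (h : VectorL2 ι T) :
      (smoothed δ h).1 - (smoothed δ h).2 = defect (vecVolterra ι T) δ h :=
    accretive_vecVolterra.sub_smoothing hδ h
  have hlow : ‖vecVolterra ι T (vecVolterra ι T (u δ x - u δ' x))‖ ≤ C * (θ δ + θ δ') :=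
    hdiff (fun x => smoothed δ (u δ x)) (fun x => smoothed δ' (u δ' x)) (hmem δ hδ) (hmem δ' hδ')
      (fun x hx => (hu δ hδ).hasDerivWithinAt_vecVolterra hR hδ hx)
      (fun x hx => (hu δ' hδ').hasDerivWithinAt_vecVolterra hR hδ' hx)
      ((hu δ hδ).zero.trans (hu δ' hδ').zero.symm) _
      (fun x hx => by
        rw [hsub_smoothing δ hδ, hsub_smoothing δ' hδ']
        exact hdefect_sub δ hδ δ' hδ' x hx) x hx
  have hhigh : ‖defect (vecVolterra ι T) ρ (u δ x - u δ' x)‖ ≤ θ ρ + θ ρ := by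
    rw [map_sub]
    exact hdefect_sub ρ hρ ρ hρ x hx
  calc ‖u δ x - u δ' x‖
      ≤ 2 * ‖defect (vecVolterra ι T) ρ (u δ x - u δ' x)‖
        + ρ⁻¹ * (ρ⁻¹ * ‖vecVolterra ι T (vecVolterra ι T (u δ x - u δ' x))‖) :=
        accretive_vecVolterra.norm_le_two_mul_norm_defect_add hρ _
    _ ≤ 2 * (θ ρ + θ ρ) + ρ⁻¹ * (ρ⁻¹ * (C * (θ δ + θ δ'))) := by gcongr
    _ = 4 * θ ρ + ρ⁻¹ * (ρ⁻¹ * (C * (θ δ + θ δ'))) := by ring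

theorem uniformCauchySeqOn_approx : UniformCauchySeqOn u (𝓝[>] 0) (Icc 0 L) := by
  obtain ⟨C, θ, hθ, hle⟩ := exists_norm_approx_sub_le hR hu
  intro s hs
  obtain ⟨ε, hε, hs⟩ := mem_uniformity_dist.1 hs
  obtain ⟨ρ, hρε, hρ : 0 < ρ⟩ := ((hθ.eventually
    (gt_mem_nhds (show 0 < ε / 8 by positivity))).and self_mem_nhdsWithin).exists
  have hlim : Tendsto (fun p : ℝ × ℝ => ρ⁻¹ * (ρ⁻¹ * (C * (θ p.1 + θ p.2))))
      (𝓝[>] 0 ×ˢ 𝓝[>] 0) (𝓝 0) := by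
    simpa using ((((hθ.comp tendsto_fst).add (hθ.comp tendsto_snd)).const_mul C).const_mul
      ρ⁻¹).const_mul ρ⁻¹
  have hpos : ∀ᶠ p : ℝ × ℝ in 𝓝[>] 0 ×ˢ 𝓝[>] 0, 0 < p.1 ∧ 0 < p.2 :=
    prod_mem_prod self_mem_nhdsWithin self_mem_nhdsWithin
  filter_upwards [hlim.eventually (gt_mem_nhds (show 0 < ε / 2 by positivity)), hpos]
    with p hp hpos x hx
  refine hs ?_
  rw [dist_eq_norm]
  linarith [hle ρ hρ p.1 hpos.1 p.2 hpos.2 x hx]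

theorem tendsto_smoothed_approx {x : ℝ} (hx : x ∈ Icc 0 L) {h : VectorL2 ι T}
    (hh : Tendsto (fun δ => u δ x) (𝓝[>] 0) (𝓝 h)) :
    Tendsto (fun δ => smoothed δ (u δ x)) (𝓝[>] 0) (𝓝 (h, h)) := by
  obtain ⟨θ, hθ, hdefect⟩ := exists_norm_defect_le hR L h₀
  have hpos : ∀ᶠ δ : ℝ in 𝓝[>] 0, 0 < δ := self_mem_nhdsWithin
  have hzero : Tendsto (fun δ => defect (vecVolterra ι T) δ (u δ x)) (𝓝[>] 0) (𝓝 0) :=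
    squeeze_zero_norm' (hpos.mono fun δ hδ => hdefect δ hδ δ hδ _ (hu δ hδ) x hx) hθ
  have hsmoothing := hh.sub hzero
  rw [sub_zero] at hsmoothing
  refine hh.prodMk_nhds (hsmoothing.congr' (hpos.mono fun δ hδ => ?_))
  rw [← accretive_vecVolterra.sub_smoothing hδ, sub_sub_cancel]
  rfl

theorem hasDerivWithinAt_of_tendsto_approx {h : ℝ → VectorL2 ι T} (hcont : ContinuousOn h (Icc 0 L))
    (hh : ∀ x ∈ Icc 0 L, Tendsto (fun δ => u δ x) (𝓝[>] 0) (𝓝 (h x)))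
    (hhR : ∀ x ∈ Icc 0 L, ‖h x‖ ≤ R) {x : ℝ} (hx : x ∈ Icc 0 L) :
    HasDerivWithinAt (fun x => vecVolterra ι T (h x)) (c.xDeriv' (h x, h x)) (Icc 0 L) x := by
  have hpos : ∀ᶠ δ : ℝ in 𝓝[>] 0, 0 < δ := self_mem_nhdsWithin
  obtain ⟨K, -, hK, -⟩ := c.bddLipOn_xDeriv' R
  have hmem {x : ℝ} (hx : x ∈ Icc 0 L) : (h x, h x) ∈ closedBall 0 R :=
    mem_closedBall_zero_iff.2 (max_le (hhR x hx) (hhR x hx))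
  have happrox {δ : ℝ} (hδ : 0 < δ) {x : ℝ} (hx : x ∈ Icc 0 L) :
      smoothed δ (u δ x) ∈ closedBall 0 R := smoothed_mem_closedBall hδ ((hu δ hδ).norm_le x hx)
  have hxDeriv := (c.bddLipOn_xDeriv' R).continuousOn
  refine hasDerivWithinAt_of_tendsto (l := 𝓝[>] 0) (f := fun δ x => vecVolterra ι T (u δ x))
    (f' := fun δ x => c.xDeriv' (smoothed δ (u δ x))) (g' := fun x => c.xDeriv' (h x, h x))
    (hpos.mono fun δ hδ x hx => (hu δ hδ).hasDerivWithinAt_vecVolterra hR hδ hx)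
    (hpos.mono fun δ hδ => hxDeriv.comp ((smoothed δ).continuous.comp_continuousOn
      (hu δ hδ).continuousOn) fun x hx => happrox hδ hx)
    (hpos.mono fun δ hδ x hx => hK _ (happrox hδ hx))
    (fun x hx => ((vecVolterra ι T).continuous.tendsto _).comp (hh x hx)) (fun x hx => ?_)
    (hxDeriv.comp (hcont.prodMk hcont) fun x hx => hmem hx) hx
  exact (hxDeriv _ (hmem hx)).tendsto.comp (tendsto_nhdsWithin_iff.2
    ⟨tendsto_smoothed_approx hR hu hx (hh x hx), hpos.mono fun δ hδ => happrox hδ hx⟩)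

end Approximation

theorem exists_solution (hL : 0 ≤ L) (hR₀ : 0 < R) (hR : closedBall 0 R ⊆ c.supersonic) :
    ∃ C, 0 < C ∧ ∀ h₀ : VectorL2 ι T, C * ‖h₀‖ ≤ R →
      ∃ h : ℝ → VectorL2 ι T, h 0 = h₀ ∧ ContinuousOn h (Icc 0 L) ∧ ∀ x ∈ Icc 0 L,
        ‖h x‖ ≤ C * ‖h₀‖ ∧
        HasDerivWithinAt (fun x => vecVolterra ι T (h x)) (c.xDeriv' (h x, h x)) (Icc 0 L) x := by
  obtain ⟨C, hC, hexists⟩ := exists_isApprox hR hL hR₀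
  refine ⟨C, hC, fun h₀ hh₀ => ?_⟩
  choose! u hu hbound using hexists h₀ hh₀
  have hpos : ∀ᶠ δ : ℝ in 𝓝[>] 0, 0 < δ := self_mem_nhdsWithin
  have hcauchy := uniformCauchySeqOn_approx hR hu
  have hlim : ∀ x ∈ Icc 0 L, ∃ y, Tendsto (fun δ => u δ x) (𝓝[>] 0) (𝓝 y) := fun x hx =>
    cauchy_map_iff_exists_tendsto.1 (hcauchy.cauchy_map hx)
  choose! h hh using hlim
  have hcont : ContinuousOn h (Icc 0 L) := (hcauchy.tendstoUniformlyOn_of_tendsto hh).continuousOn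
    (hpos.mono fun δ hδ => (hu δ hδ).continuousOn).frequently
  have hhR (x : ℝ) (hx : x ∈ Icc 0 L) : ‖h x‖ ≤ R :=
    le_of_tendsto (hh x hx).norm (hpos.mono fun δ hδ => (hu δ hδ).norm_le x hx)
  refine ⟨h, ?_, hcont, fun x hx => ⟨?_,
    hasDerivWithinAt_of_tendsto_approx hR hu hcont hh hhR hx⟩⟩
  · exact tendsto_nhds_unique (hh 0 ⟨le_rfl, hL⟩)
      (tendsto_const_nhds.congr' (hpos.mono fun δ hδ => (hu δ hδ).zero.symm))
  · exact le_of_tendsto ((hh x hx).norm) (hpos.mono fun δ hδ => hbound δ hδ x hx)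

theorem eqOn_of_hasDerivWithinAt {h k : ℝ → VectorL2 ι T}
    (hh : ∀ x ∈ Icc 0 L, (h x, h x) ∈ closedBall 0 R ∩ c.supersonic)
    (hk : ∀ x ∈ Icc 0 L, (k x, k x) ∈ closedBall 0 R ∩ c.supersonic)
    (hh' : ∀ x ∈ Icc 0 L, HasDerivWithinAt (fun x => vecVolterra ι T (h x))
      (c.xDeriv' (h x, h x)) (Icc 0 L) x)
    (hk' : ∀ x ∈ Icc 0 L, HasDerivWithinAt (fun x => vecVolterra ι T (k x))
      (c.xDeriv' (k x, k x)) (Icc 0 L) x)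
    (h₀ : h 0 = k 0) : EqOn h k (Icc 0 L) := fun x hx => by
  obtain ⟨C, hdiff⟩ := exists_norm_vecVolterra_sub_le c R L
  have hzero := hdiff (fun x => (h x, h x)) (fun x => (k x, k x)) hh hk hh' hk' h₀ 0 (by simp) x hx
  rw [mul_zero, norm_le_zero_iff] at hzero
  exact vecVolterra_injective (vecVolterra_injective
    (sub_eq_zero.1 (by simpa only [map_sub] using hzero)))

end DiagonalSystem

section WeakDerivative

variable {T : ℝ}

theorem IsPrimitive.integral_deriv_mul_eq_neg (hT : 0 < T) {F : ℝ →ᵇ ℝ} {g : ScalarL2 T}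
    (h : IsPrimitive F g) {φ : ℝ → ℝ} (hφ : IsTest T φ) :
    ∫ t, deriv φ t * toL2 T F t ∂(timeMeasure T) = -∫ t, φ t * g t ∂(timeMeasure T) := by
  obtain ⟨f, f', hf, hf', hff'⟩ := hφ.exists_isPrimitive
  have hparts := (hff'.mul h) T ⟨hT.le, le_rfl⟩
  rw [primitive_apply_end, inner_add_right, inner_toL2_one_smul, inner_toL2_one_smul] at hparts
  simp only [BoundedContinuousFunction.coe_mul, Pi.mul_apply, hf] at hparts
  rw [hφ.eq_zero (by simp), hφ.eq_zero (by simp), zero_mul, zero_mul, zero_add] at hparts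
  rw [← hf', ← hf, ← inner_toL2, ← inner_toL2]
  linarith [real_inner_comm (toL2 T F) (toL2 T f')]

theorem IsTest.exists_tsupport_subset_Icc (hT : 0 < T) {φ : ℝ → ℝ} (hφ : IsTest T φ) :
    ∃ a b, 0 < a ∧ b < T ∧ tsupport φ ⊆ Icc a b := by
  rcases (tsupport φ).eq_empty_or_nonempty with h | h
  · exact ⟨T, 0, hT, hT, by simp [h]⟩
  · have hK : IsCompact (tsupport φ) := hφ.2.1
    exact ⟨sInf (tsupport φ), sSup (tsupport φ), (hφ.2.2 (hK.sInf_mem h)).1,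
      (hφ.2.2 (hK.sSup_mem h)).2, hK.isBounded.subset_Icc_sInf_sSup⟩

theorem IsTest.integral_timeMeasure {φ : ℝ → ℝ} (hφ : IsTest T φ) :
    ∫ t, φ t ∂(timeMeasure T) = ∫ t, φ t :=
  setIntegral_eq_integral_of_forall_compl_eq_zero fun _ ht => hφ.eq_zero ht

theorem integral_zero_to_eq_zero_of_notMem_Icc {ψ : ℝ → ℝ} {a b : ℝ} (ha : 0 < a)
    (hψ : ∀ t ∉ Icc a b, ψ t = 0) (h₀ : ∫ t, ψ t = 0) {t : ℝ} (ht : t ∉ Icc a b) :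
    ∫ s in (0 : ℝ)..t, ψ s = 0 := by
  rcases lt_or_ge t a with h | h
  · refine intervalIntegral.integral_zero_ae (.of_forall fun s hs => hψ s fun hs' => ?_)
    exact (hs'.1.trans hs.2).not_gt (max_lt ha h)
  · have hbt : b < t := lt_of_not_ge fun h' => ht ⟨h, h'⟩
    rw [intervalIntegral.integral_of_le (ha.le.trans h)]
    refine Eq.trans ?_ h₀
    exact setIntegral_eq_integral_of_forall_compl_eq_zero fun s hs => hψ s fun hs' =>
      hs ⟨ha.trans_le hs'.1, hs'.2.trans hbt.le⟩

theorem IsTest.exists_deriv_eq (hT : 0 < T) {ψ : ℝ → ℝ} (hψ : IsTest T ψ)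
    (h₀ : ∫ t, ψ t ∂(timeMeasure T) = 0) : ∃ φ, IsTest T φ ∧ deriv φ = ψ := by
  have hd (t : ℝ) : HasDerivAt (fun t => ∫ s in (0 : ℝ)..t, ψ s) (ψ t) t :=
    intervalIntegral.integral_hasDerivAt_right (hψ.1.continuous.intervalIntegrable 0 t)
      (hψ.1.continuous.stronglyMeasurableAtFilter _ _) hψ.1.continuous.continuousAt
  have hd' : deriv (fun t => ∫ s in (0 : ℝ)..t, ψ s) = ψ := funext fun t => (hd t).deriv
  obtain ⟨a, b, ha, hb, hab⟩ := hψ.exists_tsupport_subset_Icc hT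
  have hsupp : tsupport (fun t => ∫ s in (0 : ℝ)..t, ψ s) ⊆ Icc a b :=
    closure_minimal (fun t ht => by_contra fun h => ht <|
      integral_zero_to_eq_zero_of_notMem_Icc ha
        (fun s hs => image_eq_zero_of_notMem_tsupport fun hs' => hs (hab hs'))
        (hψ.integral_timeMeasure.symm.trans h₀) h) isClosed_Icc
  refine ⟨_, ⟨contDiff_infty_iff_deriv.2 ⟨fun t => (hd t).differentiableAt, ?_⟩,
    isCompact_Icc.of_isClosed_subset (isClosed_tsupport _) hsupp,
    hsupp.trans (Icc_subset_Ioo ha hb)⟩, hd'⟩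
  rw [hd']
  exact hψ.1

theorem IsTest.sub_const_mul {φ ψ : ℝ → ℝ} (hφ : IsTest T φ) (hψ : IsTest T ψ) (c : ℝ) :
    IsTest T fun t => φ t - c * ψ t :=
  ⟨hφ.1.sub (contDiff_const.mul hψ.1), hφ.2.1.sub hψ.2.1.mul_left,
    (tsupport_sub φ _).trans (union_subset hφ.2.2
      ((tsupport_mul_subset_right (f := fun _ => c)).trans hψ.2.2))⟩

theorem exists_isTest_integral_eq_one (hT : 0 < T) :
    ∃ χ, IsTest T χ ∧ ∫ t, χ t ∂(timeMeasure T) = 1 := by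
  let b : ContDiffBump (T / 2) := ⟨T / 8, T / 4, by positivity, by linarith⟩
  have hb : IsTest T (b.normed volume) := by
    refine ⟨b.contDiff_normed, b.hasCompactSupport_normed, ?_⟩
    rw [b.tsupport_normed_eq, Real.closedBall_eq_Icc]
    change Icc (T / 2 - T / 4) (T / 2 + T / 4) ⊆ _
    exact Icc_subset_Ioo (by linarith) (by linarith)
  exact ⟨_, hb, hb.integral_timeMeasure.trans b.integral_normed⟩

theorem exists_eq_smul_one_of_integral_deriv_mul_eq_zero (hT : 0 < T) {u : ScalarL2 T}
    (hu : ∀ φ, IsTest T φ → ∫ t, deriv φ t * u t ∂(timeMeasure T) = 0) :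
    ∃ c : ℝ, u = c • toL2 T 1 := by
  obtain ⟨χ, hχ, hχ₁⟩ := exists_isTest_integral_eq_one hT
  obtain ⟨X, -, rfl, -, -⟩ := hχ.exists_isPrimitive
  refine ⟨inner ℝ (toL2 T X) u, ?_⟩
  rw [← sub_eq_zero]
  refine eq_zero_of_integral_test fun ψ hψ => ?_
  obtain ⟨Ψ, -, rfl, -, -⟩ := hψ.exists_isPrimitive
  have hmean (f : ℝ →ᵇ ℝ) : ∫ t, f t ∂(timeMeasure T) = inner ℝ (toL2 T f) (toL2 T 1) := by
    rw [real_inner_comm, inner_toL2]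
    refine integral_congr_ae ?_
    filter_upwards [coeFn_toL2 (T := T) f] with t ht
    simp [ht]
  -- `Ψ - (∫ Ψ) X` is a test function of mean zero, hence the derivative of a test function.
  set k : ℝ := inner ℝ (toL2 T Ψ) (toL2 T 1) with hk
  have hΨX : IsTest T ⇑(Ψ - k • X) := hψ.sub_const_mul hχ k
  rw [hmean] at hχ₁
  obtain ⟨φ, hφ, hφ'⟩ := hΨX.exists_deriv_eq hT (by
    rw [hmean, map_sub, ContinuousLinearMap.map_smul, inner_sub_left, real_inner_smul_left, hχ₁,
      mul_one, ← hk, sub_self])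
  have horth := hu φ hφ
  rw [hφ', ← inner_toL2, map_sub, ContinuousLinearMap.map_smul, inner_sub_left,
    real_inner_smul_left] at horth
  rw [← inner_toL2, inner_sub_right, real_inner_smul_right, ← hk, mul_comm, horth]

/-- The du Bois-Reymond lemma. -/
theorem exists_eq_smul_one_add_volterra (hT : 0 < T) {f g : ScalarL2 T}
    (h : ∀ φ, IsTest T φ →
      ∫ t, deriv φ t * f t ∂(timeMeasure T) = -∫ t, φ t * g t ∂(timeMeasure T)) :
    ∃ c : ℝ, f = c • toL2 T 1 + volterra T g := by
  obtain ⟨c, hc⟩ := exists_eq_smul_one_of_integral_deriv_mul_eq_zero hT (u := f - volterra T g)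
    fun φ hφ => by
      have hg := (isPrimitive_primitive g).integral_deriv_mul_eq_neg hT hφ
      have hf := h φ hφ
      obtain ⟨-, F', -, hF', -⟩ := hφ.exists_isPrimitive
      rw [← hF', ← inner_toL2] at hf hg ⊢
      rw [inner_sub_right, volterra_apply, hf, hg, sub_self]
  exact ⟨c, sub_eq_iff_eq_add.1 hc⟩

end WeakDerivative

section Components

variable {T : ℝ}

/-- The `i`-th component of a vector-valued `L²` function. -/
noncomputable def component (i : Fin 2) : L2 T →L[ℝ] ScalarL2 T :=
  (EuclideanSpace.proj i : State →L[ℝ] ℝ).compLpL 2 (timeMeasure T)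

theorem coeFn_component (i : Fin 2) (f : L2 T) : component i f =ᵐ[timeMeasure T] fun t => f t i :=
  ContinuousLinearMap.coeFn_compLpL _ f

theorem ext_component {f g : L2 T} (h : ∀ i, component i f = component i g) : f = g := by
  apply Lp.ext
  have hf := ae_all_iff.2 fun i => coeFn_component i f
  have hg := ae_all_iff.2 fun i => coeFn_component i g
  filter_upwards [hf, hg] with t hf hg
  ext i
  rw [← hf, h, hg]

/-- The vector-valued `L²` function whose `i`-th component is `v`, and whose other component
vanishes. -/
noncomputable def singleComponent (i : Fin 2) : ScalarL2 T →L[ℝ] L2 T :=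
  (ContinuousLinearMap.toSpanSingleton ℝ (EuclideanSpace.single i (1 : ℝ) : State)).compLpL 2
    (timeMeasure T)

theorem component_singleComponent (i j : Fin 2) (v : ScalarL2 T) :
    component i (singleComponent j v) = if i = j then v else 0 := by
  apply Lp.ext
  filter_upwards [coeFn_component i (singleComponent j v), Lp.coeFn_zero ℝ 2 (timeMeasure T),
    ContinuousLinearMap.coeFn_compLpL (p := 2) (μ := timeMeasure T)
      (ContinuousLinearMap.toSpanSingleton ℝ (EuclideanSpace.single j (1 : ℝ) : State)) v]
    with t h₁ h₀ h₂
  rw [h₁, singleComponent, h₂]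
  split_ifs with hij
  · simp [hij]
  · simpa [hij] using h₀.symm

/-- The identification of a vector-valued `L²` function with the pair of its components. -/
noncomputable def components (T : ℝ) : L2 T ≃L[ℝ] VectorL2 (Fin 2) T :=
  have component_sum (v : Fin 2 → ScalarL2 T) (i : Fin 2) :
      component i (∑ j, singleComponent j (v j)) = v i := by
    simp only [map_sum, component_singleComponent, Finset.sum_ite_eq, Finset.mem_univ, if_true]
  .equivOfInverse
    (((PiLp.continuousLinearEquiv 2 ℝ fun _ : Fin 2 => ScalarL2 T).symm : _ →L[ℝ] _).comp
      (ContinuousLinearMap.pi component))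
    (∑ j, (singleComponent j).comp (PiLp.proj 2 (𝕜 := ℝ) _ j))
    (fun f => ext_component fun i => by simpa using component_sum (fun j => component j f) i)
    (fun v => by ext1 i; simpa using component_sum v i)

theorem components_apply (f : L2 T) (i : Fin 2) : components T f i = component i f := rfl

@[simp]
theorem component_components_symm (v : VectorL2 (Fin 2) T) (i : Fin 2) :
    component i ((components T).symm v) = v i := by
  rw [← components_apply, ContinuousLinearEquiv.apply_symm_apply]

theorem coeFn_components_symm (v : VectorL2 (Fin 2) T) (i : Fin 2) :
    (fun t => (components T).symm v t i) =ᵐ[timeMeasure T] v i := by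
  simpa using (coeFn_component i ((components T).symm v)).symm

theorem integral_smul_apply {ψ : ℝ → ℝ} {f : L2 T}
    (h : Integrable (fun t => ψ t • f t) (timeMeasure T)) (i : Fin 2) :
    (∫ t, ψ t • f t ∂(timeMeasure T)) i = ∫ t, ψ t * component i f t ∂(timeMeasure T) := by
  change (EuclideanSpace.proj i : State →L[ℝ] ℝ) (∫ t, ψ t • f t ∂(timeMeasure T)) = _
  rw [← ContinuousLinearMap.integral_comp_comm _ h]
  refine integral_congr_ae ?_
  filter_upwards [coeFn_component i f] with t ht
  simp [ht]

theorem isWeakDeriv_iff_component {f g : L2 T} : IsWeakDeriv f g ↔ ∀ i, ∀ φ, IsTest T φ →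
    ∫ t, deriv φ t * component i f t ∂(timeMeasure T)
      = -∫ t, φ t * component i g t ∂(timeMeasure T) := by
  have happly (φ : ℝ → ℝ) (hφ : IsTest T φ) :
      (∫ t, deriv φ t • f t ∂(timeMeasure T) = -∫ t, φ t • g t ∂(timeMeasure T)) ↔
        ∀ i, ∫ t, deriv φ t * component i f t ∂(timeMeasure T)
          = -∫ t, φ t * component i g t ∂(timeMeasure T) := by
    simp only [PiLp.ext_iff, PiLp.neg_apply, integral_smul_apply (hφ.integrable_deriv f),
      integral_smul_apply (hφ.integrable g)]
  exact ⟨fun h i φ hφ => (happly φ hφ).1 (h φ hφ) i, fun h φ hφ => (happly φ hφ).2 (h · φ hφ)⟩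

theorem isWeakDeriv_vecVolterra (hT : 0 < T) (v : VectorL2 (Fin 2) T) :
    IsWeakDeriv ((components T).symm (vecVolterra (Fin 2) T v)) ((components T).symm v) := by
  refine isWeakDeriv_iff_component.2 fun i φ hφ => ?_
  rw [component_components_symm, component_components_symm]
  exact (isPrimitive_primitive (v i)).integral_deriv_mul_eq_neg hT hφ

theorem IsContRep.eqOn (hT : 0 < T) {f : L2 T} {g g' : ℝ → State} (hg : IsContRep f g)
    (hg' : IsContRep f g') : EqOn g g' (Icc 0 T) := by
  refine Measure.eqOn_Icc_of_ae_eq volume hT.ne ?_ hg.1 hg'.1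
  rw [← restrict_Ioo_eq_restrict_Icc]
  exact hg.2.symm.trans hg'.2

theorem isContRep_of_component_eq {f : L2 T} {F : Fin 2 → ℝ →ᵇ ℝ}
    (h : ∀ i, component i f = toL2 T (F i)) :
    IsContRep f fun t => WithLp.toLp 2 fun i => F i t := by
  refine ⟨Continuous.continuousOn ((PiLp.continuous_toLp 2 _).comp
    (continuous_pi fun i => (F i).continuous)), ?_⟩
  have hf := ae_all_iff.2 fun i => coeFn_component i f
  have hF := ae_all_iff.2 fun i => coeFn_toL2 (T := T) (F i)
  filter_upwards [hf, hF] with t hf hF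
  ext i
  rw [← hf, h, hF]

theorem IsWeakDeriv.components_eq (hT : 0 < T) {f g : L2 T} (h : IsWeakDeriv f g)
    (h₀ : VanishesAtZero f) : components T f = vecVolterra (Fin 2) T (components T g) := by
  choose c hc using fun i => exists_eq_smul_one_add_volterra hT (isWeakDeriv_iff_component.1 h i)
  obtain ⟨G, hG, hG₀⟩ := h₀
  have hf (i : Fin 2) : component i f = toL2 T (c i • 1 + primitive (component i g)) := by
    rw [hc, map_add, ContinuousLinearMap.map_smul, volterra_apply]
  have hGf := hG.eqOn hT (isContRep_of_component_eq hf) (left_mem_Icc.2 hT.le)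
  ext1 i
  have hc₀ : c i = 0 := by simpa [hG₀] using (congrArg (fun v : State => v i) hGf).symm
  rw [components_apply, hc, hc₀, zero_smul, zero_add]
  rfl

end Components

section SobolevLift

variable {k : ℕ} {T : ℝ}

/-- The `k`-th derivative of `f ∈ Hᵏ`, as a pair of scalar functions. -/
noncomputable def topDeriv (k : ℕ) (T : ℝ) : Sobolev k T →L[ℝ] VectorL2 (Fin 2) T :=
  (components T : L2 T →L[ℝ] VectorL2 (Fin 2) T).comp
    ((PiLp.proj 2 (fun _ : Fin (k + 1) => L2 T) (Fin.last k)).comp (Sobolev k T).subtypeL)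

theorem topDeriv_apply (f : Sobolev k T) :
    topDeriv k T f = components T (wderiv f (Fin.last k)) := rfl

/-- The element of `Hᵏ` with `k`-th derivative `h` whose lower derivatives vanish at time `0`. -/
noncomputable def ofTopDeriv (k : ℕ) (hT : 0 < T) : VectorL2 (Fin 2) T →L[ℝ] Sobolev k T :=
  (((PiLp.continuousLinearEquiv 2 ℝ fun _ : Fin (k + 1) => L2 T).symm : _ →L[ℝ] _).comp
    (ContinuousLinearMap.pi fun i : Fin (k + 1) =>
      ((components T).symm : VectorL2 (Fin 2) T →L[ℝ] L2 T).comp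
        (vecVolterra (Fin 2) T ^ (i.rev : ℕ)))).codRestrict (Sobolev k T) fun h i => by
    change IsWeakDeriv ((components T).symm ((vecVolterra _ T ^ (i.castSucc.rev : ℕ)) h))
      ((components T).symm ((vecVolterra _ T ^ (i.succ.rev : ℕ)) h))
    rw [Fin.rev_castSucc, Fin.rev_succ, Fin.val_succ, pow_succ']
    exact isWeakDeriv_vecVolterra hT _

theorem wderiv_ofTopDeriv (hT : 0 < T) (h : VectorL2 (Fin 2) T) (i : Fin (k + 1)) :
    wderiv (ofTopDeriv k hT h) i = (components T).symm ((vecVolterra _ T ^ (i.rev : ℕ)) h) := rfl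

theorem toH1_ofTopDeriv (hT : 0 < T) (h : VectorL2 (Fin 2) T) :
    toH1 (ofTopDeriv 2 hT h) = ofTopDeriv 1 hT (vecVolterra _ T h) := by
  refine Subtype.ext (PiLp.ext fun i => ?_)
  fin_cases i <;> rfl

theorem topDeriv_ofTopDeriv (hT : 0 < T) (h : VectorL2 (Fin 2) T) :
    topDeriv k T (ofTopDeriv k hT h) = h := by
  rw [topDeriv_apply, wderiv_ofTopDeriv, ContinuousLinearEquiv.apply_symm_apply, Fin.rev_last]
  rfl

theorem vanishesAtZero_ofTopDeriv (hT : 0 < T) (h : VectorL2 (Fin 2) T) (i : Fin k) :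
    VanishesAtZero (wderiv (ofTopDeriv k hT h) i.castSucc) := by
  have hcomponent (j : Fin 2) : component j (wderiv (ofTopDeriv k hT h) i.castSucc)
      = toL2 T (primitive ((vecVolterra (Fin 2) T ^ (i.rev : ℕ)) h j)) := by
    rw [wderiv_ofTopDeriv, component_components_symm, Fin.rev_castSucc, Fin.val_succ, pow_succ']
    rfl
  exact ⟨_, isContRep_of_component_eq hcomponent, PiLp.ext fun j => primitive_apply_zero _⟩

theorem ofTopDeriv_topDeriv (hT : 0 < T) {f : Sobolev k T}
    (hf : ∀ i : Fin k, VanishesAtZero (wderiv f i.castSucc)) :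
    ofTopDeriv k hT (topDeriv k T f) = f := by
  have hV (i : Fin (k + 1)) : components T (wderiv f i)
      = (vecVolterra _ T ^ (i.rev : ℕ)) (topDeriv k T f) := by
    induction i using Fin.reverseInduction with
    | last => rw [Fin.rev_last]; rfl
    | cast i ih =>
      have hi : IsWeakDeriv (wderiv f i.castSucc) (wderiv f i.succ) := f.2 i
      rw [hi.components_eq hT (hf i), ih, Fin.rev_castSucc, Fin.rev_succ, Fin.val_succ, pow_succ']
      rfl
  refine Subtype.ext (PiLp.ext fun i => ?_)
  change wderiv (ofTopDeriv k hT _) i = wderiv f i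
  rw [wderiv_ofTopDeriv, ← hV, ContinuousLinearEquiv.symm_apply_apply]

end SobolevLift

section Clamp

variable {T : ℝ}

/-- The bounded continuous function that agrees with `f` on `[0, T]` and is constant on either
side of it. -/
noncomputable def clamp (hT : 0 ≤ T) (f : ℝ → ℝ) (hf : Continuous f) : ℝ →ᵇ ℝ :=
  (BoundedContinuousFunction.mkOfCompact
    (⟨fun t : Icc 0 T => f t, hf.comp continuous_subtype_val⟩ : C(Icc 0 T, ℝ))).compContinuous
    ⟨projIcc 0 T hT, continuous_projIcc⟩

theorem clamp_apply (hT : 0 ≤ T) {f : ℝ → ℝ} (hf : Continuous f) {t : ℝ} (ht : t ∈ Icc 0 T) :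
    clamp hT f hf t = f t :=
  congrArg (fun s : Icc 0 T => f s) (projIcc_of_mem hT ht)

theorem isPrimitive_clamp (hT : 0 ≤ T) {f f' : ℝ → ℝ} (hf : Continuous f) (hf' : Continuous f')
    (h : ∀ t ∈ Ioo 0 T, HasDerivAt f (f' t) t) :
    IsPrimitive (clamp hT f hf) (toL2 T (clamp hT f' hf')) :=
  isPrimitive_of_hasDerivAt fun t ht => by
    rw [clamp_apply hT hf' (Ioo_subset_Icc_self ht)]
    refine (h t ht).congr_of_eventuallyEq ?_
    filter_upwards [isOpen_Ioo.mem_nhds ht] with s hs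
    exact clamp_apply hT hf (Ioo_subset_Icc_self hs)

end Clamp

namespace DiagonalSystem

variable {ι : Type*} [Fintype ι] {T : ℝ} (c : DiagonalSystem ι T)

theorem continuous_speed (i : ι) : Continuous fun u => c.speed u i := by
  unfold speed value
  fun_prop

theorem speed_zero (i : ι) : c.speed 0 i = c.μ i := by simp [speed]

theorem speed_apply (u : Unknown ι T) (i : ι) (t : ℝ) :
    c.speed u i t = c.μ i t + ∑ j, c.ℓ i j * value u j t := by
  simp [speed]

theorem supersonic_mem_nhds_zero {κ : ℝ} (hκ : c.κ < κ) (hμ : ∀ i, ∀ t ∈ Icc 0 T, κ ≤ c.μ i t) :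
    c.supersonic ∈ 𝓝 0 := by
  have hnear : ∀ᶠ u in 𝓝 (0 : Unknown ι T), ∀ i, dist (c.speed u i) (c.speed 0 i) < κ - c.κ :=
    eventually_all.2 fun i => Metric.tendsto_nhds.1 (c.continuous_speed i).continuousAt.tendsto _
      (sub_pos.2 hκ)
  filter_upwards [hnear] with u hu i t ht
  have hdist := (BoundedContinuousFunction.dist_coe_le_dist t).trans_lt (hu i)
  rw [speed_zero, Real.dist_eq] at hdist
  linarith [(abs_lt.1 hdist).1, hμ i t ht]

theorem exists_norm_xDeriv'_le {R : ℝ} (hR : 0 ≤ R) : ∃ K, 0 ≤ K ∧ ∀ h : VectorL2 ι T, ‖h‖ ≤ R →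
    ‖c.xDeriv' (h, h)‖ ≤ K * ‖h‖ := by
  obtain ⟨K, hK, -, hlip⟩ := c.bddLipOn_xDeriv' R
  refine ⟨K, hK, fun h hh => ?_⟩
  simpa [xDeriv'_zero] using hlip (h, h) (by simpa using hh) 0 (by simpa using hR)

end DiagonalSystem

namespace Duct

/-- The hypotheses under which the problem is solved on the time interval `[0, T]`: a pressure law
with `p' > 0`, and a background flow that is supersonic during this time. -/
structure IsSupersonicOn (d : Duct) (T : ℝ) : Prop where
  aγ_pos : 0 < d.a * d.γ
  γ_ne_one : d.γ ≠ 1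
  ρb_pos : 0 < d.ρb
  L_pos : 0 < d.L
  α_smooth : ContDiff ℝ 2 d.α
  cb_lt_uα : ∀ t ∈ Icc 0 T, d.cb < d.uα t

variable {d : Duct} {T : ℝ}

theorem cb_nonneg (hρ : 0 ≤ d.ρb) : 0 ≤ d.cb :=
  mul_nonneg (Real.sqrt_nonneg _) (Real.rpow_nonneg hρ _)

theorem Admissible.isSupersonicOn (hd : d.Admissible) (T : ℝ) : d.IsSupersonicOn T where
  aγ_pos := mul_pos hd.a_pos (one_pos.trans hd.one_lt_γ)
  γ_ne_one := hd.one_lt_γ.ne'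
  ρb_pos := hd.ρb_pos
  L_pos := hd.L_pos
  α_smooth := hd.α_smooth
  cb_lt_uα t ht := hd.supersonic.trans_le <|
    le_mul_of_one_le_left ((cb_nonneg hd.ρb_pos.le).trans hd.supersonic.le)
      (Real.one_le_exp (hd.α_primitive t ht.1))

theorem hasDerivAt_uα (hα : Continuous d.α) (t : ℝ) : HasDerivAt d.uα (d.α t * d.uα t) t := by
  have hprimitive : HasDerivAt (fun t => ∫ s in (0 : ℝ)..t, d.α s) (d.α t) t :=
    intervalIntegral.integral_hasDerivAt_right (hα.intervalIntegrable _ _)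
      (hα.stronglyMeasurableAtFilter _ _) hα.continuousAt
  refine (hprimitive.exp.mul_const d.ub).congr_deriv ?_
  rw [uα]
  ring

theorem continuous_uα (hα : Continuous d.α) : Continuous d.uα :=
  continuous_iff_continuousAt.2 fun t => (hasDerivAt_uα hα t).continuousAt

/-- The signs of the sound speed in the two characteristic speeds. -/
def sign : Fin 2 → ℝ := ![-1, 1]

variable (d) in
/-- The derivative of the `i`-th characteristic speed with respect to `mⱼ`. -/
noncomputable def speedCoeff (i j : Fin 2) : ℝ := 1 + sign i * ((d.γ - 1) / 2) * sign j

theorem speed_eq (hγ : d.γ ≠ 1) (t : ℝ) (m : State) (i : Fin 2) :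
    d.speed t m i = d.uα t + sign i * d.cb + ∑ j, d.speedCoeff i j * m j := by
  have hγ' : d.γ - 1 ≠ 0 := sub_ne_zero.2 hγ
  fin_cases i <;>
  · simp [speed, charSpeed, velocity, soundSpeed, rα, sα, sign, speedCoeff]
    field_simp
    ring

namespace IsSupersonicOn

variable (hd : d.IsSupersonicOn T)
include hd

theorem continuous_α : Continuous d.α := hd.α_smooth.continuous

theorem hasDerivAt_α (t : ℝ) : HasDerivAt d.α (deriv d.α t) t :=
  (hd.α_smooth.differentiable (by norm_num) t).hasDerivAt

theorem contDiff_deriv_α : ContDiff ℝ 1 (deriv d.α) :=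
  ((contDiff_succ_iff_deriv (n := 1)).1 hd.α_smooth).2.2

theorem hasDerivAt_deriv_α (t : ℝ) : HasDerivAt (deriv d.α) (deriv (deriv d.α) t) t :=
  (hd.contDiff_deriv_α.differentiable (by norm_num) t).hasDerivAt

theorem background_speed_pos (i : Fin 2) {t : ℝ} (ht : t ∈ Icc 0 T) :
    0 < d.uα t + sign i * d.cb := by
  have hcb := cb_nonneg hd.ρb_pos.le
  have hsupersonic := hd.cb_lt_uα t ht
  fin_cases i <;> simp only [sign] <;> simp <;> linarith

theorem exists_le_background_speed :
    ∃ κ, 0 < κ ∧ ∀ i, ∀ t ∈ Icc 0 T, κ ≤ d.uα t + sign i * d.cb := by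
  have huα := continuous_uα hd.continuous_α
  choose κ hκ₀ hκ using fun i => isCompact_Icc.exists_forall_le' (s := Icc 0 T)
    (huα.add continuous_const).continuousOn fun t ht => hd.background_speed_pos i ht
  exact ⟨min (κ 0) (κ 1), lt_min (hκ₀ 0) (hκ₀ 1), fun i t ht => le_trans (by fin_cases i <;> simp)
    (hκ i t ht)⟩

end IsSupersonicOn

/-- The system for the perturbation `m`, multiplied by `Λ⁻¹`. -/
noncomputable def system (hd : d.IsSupersonicOn T) (hT : 0 ≤ T) {κ : ℝ} (hκ : 0 < κ) :
    DiagonalSystem (Fin 2) T :=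
  have hα := hd.continuous_α
  have hα' := hd.contDiff_deriv_α.continuous
  have hα'' : Continuous (deriv (deriv d.α)) := hd.contDiff_deriv_α.continuous_deriv (by norm_num)
  have hu := continuous_uα hα
  { κ := κ
    κ_pos := hκ
    β := fun _ _ => clamp hT (fun t => d.α t / 2) (by fun_prop)
    β' := fun _ _ => clamp hT (fun t => deriv d.α t / 2) (by fun_prop)
    β'' := fun _ _ => toL2 T (clamp hT (fun t => deriv (deriv d.α) t / 2) (by fun_prop))
    isPrimitive_β := fun _ _ => isPrimitive_clamp _ _ _ fun t _ => (hd.hasDerivAt_α t).div_const 2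
    isPrimitive_β' := fun _ _ => isPrimitive_clamp _ _ _ fun t _ =>
      (hd.hasDerivAt_deriv_α t).div_const 2
    μ := fun i => clamp hT (fun t => d.uα t + sign i * d.cb) (by fun_prop)
    μ' := fun _ => clamp hT (fun t => d.α t * d.uα t) (by fun_prop)
    μ'' := fun _ => toL2 T (clamp hT (fun t => deriv d.α t * d.uα t + d.α t * (d.α t * d.uα t))
      (by fun_prop))
    isPrimitive_μ := fun _ => isPrimitive_clamp _ _ _ fun t _ =>
      (hasDerivAt_uα hα t).add_const _
    isPrimitive_μ' := fun _ => isPrimitive_clamp _ _ _ fun t _ =>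
      (hd.hasDerivAt_α t).mul (hasDerivAt_uα hα t)
    ℓ := d.speedCoeff }

variable {hd : d.IsSupersonicOn T} {hT : 0 ≤ T} {κ : ℝ} {hκ : 0 < κ} {t : ℝ}

theorem system_μ_apply (ht : t ∈ Icc 0 T) (i : Fin 2) :
    (system hd hT hκ).μ i t = d.uα t + sign i * d.cb :=
  clamp_apply hT _ ht

theorem system_speed_apply (ht : t ∈ Icc 0 T) (u : Unknown (Fin 2) T) (i : Fin 2) :
    (system hd hT hκ).speed u i t = d.speed t (WithLp.toLp 2 fun j => value u j t) i := by
  rw [speed_eq hd.γ_ne_one, DiagonalSystem.speed_apply, system_μ_apply ht]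
  rfl

theorem system_source_apply (ht : t ∈ Icc 0 T) (u : Unknown (Fin 2) T) (i : Fin 2) :
    (system hd hT hκ).source u i t = d.α t / 2 * (value u 0 t + value u 1 t) := by
  have hβ (j : Fin 2) : (system hd hT hκ).β i j t = d.α t / 2 := clamp_apply hT _ ht
  simp [DiagonalSystem.source, hβ, mul_add]

theorem exists_system_supersonic_mem_nhds_zero (hd : d.IsSupersonicOn T) (hT : 0 ≤ T) :
    ∃ (κ : ℝ) (hκ : 0 < κ), (system hd hT hκ).supersonic ∈ 𝓝 0 := by
  obtain ⟨κ, hκ, hle⟩ := hd.exists_le_background_speed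
  refine ⟨κ / 2, half_pos hκ, DiagonalSystem.supersonic_mem_nhds_zero _ (half_lt_self hκ) ?_⟩
  intro i t ht
  rw [system_μ_apply ht]
  exact hle i t ht

end Duct

theorem ae_components_symm_eq_iff {T : ℝ} {v : VectorL2 (Fin 2) T} {F : Fin 2 → ℝ →ᵇ ℝ} :
    (∀ᵐ t ∂(timeMeasure T), ∀ i, (components T).symm v t i = F i t) ↔
      v = WithLp.toLp 2 fun i => toL2 T (F i) := by
  rw [ae_all_iff, PiLp.ext_iff]
  refine forall_congr' fun i => ⟨fun h => Lp.ext ?_, fun h => ?_⟩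
  · exact (coeFn_components_symm v i).symm.trans (.trans h (coeFn_toL2 (F i)).symm)
  · exact (coeFn_components_symm v i).trans (h ▸ coeFn_toL2 (F i))

theorem isContRep_ofTopDeriv_zero {T : ℝ} (hT : 0 < T) (h : VectorL2 (Fin 2) T) :
    IsContRep (wderiv (ofTopDeriv 2 hT h) 0) fun t => WithLp.toLp 2 fun j => value (h, h) j t :=
  isContRep_of_component_eq fun i => component_components_symm _ i

theorem isContRep_ofTopDeriv_one {T : ℝ} (hT : 0 < T) (h : VectorL2 (Fin 2) T) :
    IsContRep (wderiv (ofTopDeriv 2 hT h) 1) fun t => WithLp.toLp 2 fun j =>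
      timeDeriv (h, h) j t :=
  isContRep_of_component_eq fun i => component_components_symm _ i

namespace Duct

variable {d : Duct} {T : ℝ}

variable (d) in
/-- The differential equation for `m ∈ H²`, with `w` in the role of `∂ₓ m`. -/
def SatisfiesEquation (m : Sobolev 2 T) (w : L2 T) : Prop :=
  ∀ᵐ t ∂(timeMeasure T),
    (w t).ofLp + (d.Lam t (wderiv m 0 t)).mulVec (wderiv m 1 t).ofLp
      = (d.α t / 2) • (d.Lam t (wderiv m 0 t)).mulVec
          ![wderiv m 0 t 0 + wderiv m 0 t 1, wderiv m 0 t 0 + wderiv m 0 t 1]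

theorem equation_iff {t : ℝ} {w m m' : State} (hm : ∀ i, d.speed t m i ≠ 0) :
    w.ofLp + (d.Lam t m).mulVec m'.ofLp
        = (d.α t / 2) • (d.Lam t m).mulVec ![m 0 + m 1, m 0 + m 1] ↔
      ∀ i, d.speed t m i * w i = d.α t / 2 * (m 0 + m 1) - m' i := by
  have hsource (i : Fin 2) : (![m 0 + m 1, m 0 + m 1] : Fin 2 → ℝ) i = m 0 + m 1 := by
    fin_cases i <;> rfl
  rw [funext_iff]
  refine forall_congr' fun i => ?_
  simp only [Lam, Pi.add_apply, Pi.smul_apply, Matrix.mulVec_diagonal, hsource, smul_eq_mul]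
  have hmi := hm i
  field_simp
  rw [eq_sub_iff_add_eq, add_mul]

section System

variable {hd : d.IsSupersonicOn T} {hT : 0 ≤ T} {κ : ℝ} {hκ : 0 < κ} {h : VectorL2 (Fin 2) T}

theorem mem_supersonic_system_iff {u : Unknown (Fin 2) T} :
    u ∈ (system hd hT hκ).supersonic ↔
      ∀ i, ∀ t ∈ Icc 0 T, κ ≤ d.speed t (WithLp.toLp 2 fun j => value u j t) i :=
  forall_congr' fun i => forall₂_congr fun t ht => by rw [system_speed_apply ht]; rfl

theorem speed_mul_system_xDeriv (hu : (h, h) ∈ (system hd hT hκ).supersonic) {t : ℝ}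
    (ht : t ∈ Icc 0 T) (i : Fin 2) :
    d.speed t (WithLp.toLp 2 fun j => value (h, h) j t) i * (system hd hT hκ).xDeriv (h, h) i t
      = d.α t / 2 * (value (h, h) 0 t + value (h, h) 1 t) - timeDeriv (h, h) i t := by
  have hslowness := truncInv_mul_apply (system hd hT hκ).κ_pos (hu i t ht)
  rw [mul_comm] at hslowness
  rw [← system_source_apply (hd := hd) (hT := hT) (hκ := hκ) ht,
    ← system_speed_apply (hd := hd) (hT := hT) (hκ := hκ) ht,
    DiagonalSystem.xDeriv,
    BoundedContinuousFunction.coe_mul, Pi.mul_apply, ← mul_assoc, DiagonalSystem.slowness,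
    hslowness, one_mul]
  rfl

theorem satisfiesEquation_ofTopDeriv_iff {hT : 0 < T}
    (hu : (h, h) ∈ (system hd hT.le hκ).supersonic)
    {k : VectorL2 (Fin 2) T} :
    d.SatisfiesEquation (ofTopDeriv 2 hT h) (wderiv (ofTopDeriv 1 hT k) 0) ↔
      k = (system hd hT.le hκ).xDeriv' (h, h) := by
  rw [← vecVolterra_injective.eq_iff, DiagonalSystem.vecVolterra_xDeriv' hu,
    ← ae_components_symm_eq_iff]
  refine eventually_congr ?_
  filter_upwards [(isContRep_ofTopDeriv_zero hT h).2, (isContRep_ofTopDeriv_one hT h).2,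
    ae_mem_Icc] with t hvalue htimeDeriv ht
  have hspeed (i : Fin 2) : d.speed t (WithLp.toLp 2 fun j => value (h, h) j t) i ≠ 0 :=
    (hκ.trans_le (mem_supersonic_system_iff.1 hu i t ht)).ne'
  rw [hvalue, htimeDeriv, equation_iff hspeed]
  refine forall_congr' fun i => ?_
  rw [← speed_mul_system_xDeriv hu ht, mul_right_inj' (hspeed i)]
  rfl

end System

open Metric

section Existence

variable {hd : d.IsSupersonicOn T} {hT : 0 < T} {κ : ℝ} {hκ : 0 < κ} {h : ℝ → VectorL2 (Fin 2) T}

theorem hasDerivWithinAt_toH1_ofTopDeriv {h' : VectorL2 (Fin 2) T} {s : Set ℝ} {x : ℝ}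
    (hh' : HasDerivWithinAt (fun x => vecVolterra (Fin 2) T (h x)) h' s x) :
    HasDerivWithinAt (fun x => toH1 (ofTopDeriv 2 hT (h x))) (ofTopDeriv 1 hT h') s x := by
  simp only [toH1_ofTopDeriv]
  exact (ofTopDeriv 1 hT).hasFDerivAt.comp_hasDerivWithinAt x hh'

variable (hsupersonic : ∀ x ∈ Icc 0 d.L, (h x, h x) ∈ (system hd hT.le hκ).supersonic)
  (hcont : ContinuousOn h (Icc 0 d.L))
  (hh' : ∀ x ∈ Icc 0 d.L, HasDerivWithinAt (fun x => vecVolterra (Fin 2) T (h x))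
    ((system hd hT.le hκ).xDeriv' (h x, h x)) (Icc 0 d.L) x)

include hh' in
theorem derivWithin_toH1_ofTopDeriv {x : ℝ} (hx : x ∈ Icc 0 d.L) :
    derivWithin (fun x => toH1 (ofTopDeriv 2 hT (h x))) (Icc 0 d.L) x
      = ofTopDeriv 1 hT ((system hd hT.le hκ).xDeriv' (h x, h x)) :=
  (hasDerivWithinAt_toH1_ofTopDeriv (hh' x hx)).derivWithin (uniqueDiffOn_Icc hd.L_pos x hx)

theorem continuousOn_system_xDeriv' {s : Set ℝ} (hs : IsCompact s) (hcont : ContinuousOn h s) :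
    ContinuousOn (fun x => (system hd hT.le hκ).xDeriv' (h x, h x)) s := by
  obtain ⟨R, hR⟩ := hs.exists_bound_of_continuousOn hcont
  exact ((system hd hT.le hκ).bddLipOn_xDeriv' R).continuousOn.comp (hcont.prodMk hcont)
    fun x hx => by simpa using hR x hx

include hsupersonic hcont hh' in
theorem isSolution_ofTopDeriv :
    d.IsSolution (ofTopDeriv 2 hT (h 0)) fun x => ofTopDeriv 2 hT (h x) where
  continuousOn := (ofTopDeriv 2 hT).continuous.comp_continuousOn hcont
  contDiffOn := (contDiffOn_one_iff_derivWithin (uniqueDiffOn_Icc hd.L_pos)).2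
    ⟨fun x hx => (hasDerivWithinAt_toH1_ofTopDeriv (hh' x hx)).differentiableWithinAt,
      ((ofTopDeriv 1 hT).continuous.comp_continuousOn
        (continuousOn_system_xDeriv' (hd := hd) (hT := hT) (hκ := hκ) isCompact_Icc hcont)).congr
          fun _ hx => derivWithin_toH1_ofTopDeriv hh' hx⟩
  speed_ne_zero x hx := ⟨_, isContRep_ofTopDeriv_zero hT (h x), fun t ht i =>
    (hκ.trans_le (mem_supersonic_system_iff.1 (hsupersonic x hx) i t ht)).ne'⟩
  equation x hx := by
    rw [derivWithin_toH1_ofTopDeriv hh' hx]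
    exact (satisfiesEquation_ofTopDeriv_iff (hsupersonic x hx)).2 rfl
  boundary := rfl
  initial x _ := vanishesAtZero_ofTopDeriv hT (h x) (0 : Fin 2)

theorem exists_isSolution (hd : d.IsSupersonicOn T) (hT : 0 < T) :
    ∃ ε C : ℝ, 0 < ε ∧ 0 < C ∧ ∀ m₀ : Sobolev 2 T, VanishesAtZero (wderiv m₀ 0) →
      VanishesAtZero (wderiv m₀ 1) → ‖m₀‖ ≤ ε →
      ∃ m : ℝ → Sobolev 2 T, d.IsSolution m₀ m ∧ ∀ x ∈ Icc 0 d.L, ‖m x‖ ≤ C * ‖m₀‖ ∧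
        ‖derivWithin (fun y => toH1 (m y)) (Icc 0 d.L) x‖ ≤ C * ‖m₀‖ := by
  obtain ⟨κ, hκ, hnhds⟩ := exists_system_supersonic_mem_nhds_zero hd hT.le
  obtain ⟨R, hR₀, hR⟩ := nhds_basis_closedBall.mem_iff.1 hnhds
  obtain ⟨A, hA, hexists⟩ := DiagonalSystem.exists_solution hd.L_pos.le hR₀ hR
  obtain ⟨K, hK, hxDeriv'⟩ := (system hd hT.le hκ).exists_norm_xDeriv'_le hR₀.le
  obtain ⟨N, hN, htop⟩ := (topDeriv 2 T).bound
  obtain ⟨B₁, hB₁, hlift₁⟩ := (ofTopDeriv 1 hT).bound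
  obtain ⟨B₂, hB₂, hlift₂⟩ := (ofTopDeriv 2 hT).bound
  refine ⟨R / (A * N), (B₁ * K + B₂) * (A * N), by positivity, by positivity,
    fun m₀ h₀ h₁ hm₀ => ?_⟩
  have htop₀ : A * ‖topDeriv 2 T m₀‖ ≤ A * N * ‖m₀‖ := by
    rw [mul_assoc]
    gcongr
    exact htop m₀
  have hsmall : A * N * ‖m₀‖ ≤ R := by rwa [le_div_iff₀' (by positivity)] at hm₀
  obtain ⟨h, hh₀, hcont, hh⟩ := hexists (topDeriv 2 T m₀) (htop₀.trans hsmall)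
  have hle (x : ℝ) (hx : x ∈ Icc 0 d.L) : ‖h x‖ ≤ A * N * ‖m₀‖ := (hh x hx).1.trans htop₀
  have hhR (x : ℝ) (hx : x ∈ Icc 0 d.L) : ‖h x‖ ≤ R := (hle x hx).trans hsmall
  have hh' := fun x hx => (hh x hx).2
  refine ⟨fun x => ofTopDeriv 2 hT (h x), ?_, fun x hx => ⟨?_, ?_⟩⟩
  · convert isSolution_ofTopDeriv (fun x hx => hR (by simpa using hhR x hx)) hcont hh' using 1
    rw [hh₀, ofTopDeriv_topDeriv hT (Fin.forall_fin_two.2 ⟨h₀, h₁⟩)]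
  · calc ‖ofTopDeriv 2 hT (h x)‖ ≤ B₂ * ‖h x‖ := hlift₂ _
      _ ≤ (B₁ * K + B₂) * (A * N * ‖m₀‖) := by
        gcongr
        · exact le_add_of_nonneg_left (by positivity)
        · exact hle x hx
      _ = (B₁ * K + B₂) * (A * N) * ‖m₀‖ := (mul_assoc _ _ _).symm
  · rw [derivWithin_toH1_ofTopDeriv hh' hx]
    calc ‖ofTopDeriv 1 hT ((system hd hT.le hκ).xDeriv' (h x, h x))‖
        ≤ B₁ * (K * ‖h x‖) := (hlift₁ _).trans (by gcongr; exact hxDeriv' _ (hhR x hx))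
      _ = B₁ * K * ‖h x‖ := (mul_assoc _ _ _).symm
      _ ≤ (B₁ * K + B₂) * (A * N * ‖m₀‖) := by
        gcongr
        · exact le_add_of_nonneg_right hB₂.le
        · exact hle x hx
      _ = (B₁ * K + B₂) * (A * N) * ‖m₀‖ := (mul_assoc _ _ _).symm

end Existence

theorem continuousOn_speed (hd : d.IsSupersonicOn T) {g : ℝ → State} {s : Set ℝ}
    (hg : ContinuousOn g s) (i : Fin 2) : ContinuousOn (fun t => d.speed t (g t) i) s := by
  have huα := continuous_uα hd.continuous_α
  simp only [speed_eq hd.γ_ne_one]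
  fun_prop

theorem speed_zero_pos (hd : d.IsSupersonicOn T) (hT : 0 ≤ T) (i : Fin 2) :
    0 < d.speed 0 0 i := by
  simpa [speed_eq hd.γ_ne_one] using hd.background_speed_pos i (left_mem_Icc.2 hT)

theorem SatisfiesEquation.vanishesAtZero_wderiv_one (hd : d.IsSupersonicOn T)
    {m : Sobolev 2 T} {w : L2 T} (hmw : d.SatisfiesEquation m w) {g : ℝ → State}
    (hg : IsContRep (wderiv m 0) g) (hspeed : ∀ t ∈ Icc 0 T, ∀ i, d.speed t (g t) i ≠ 0)
    (hg₀ : g 0 = 0) (hw : VanishesAtZero w) : VanishesAtZero (wderiv m 1) := by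
  obtain ⟨W, hW, hW₀⟩ := hw
  have hα := hd.continuous_α.continuousOn (s := Icc 0 T)
  have hgcont := hg.1
  have hWcont := hW.1
  refine ⟨fun t => WithLp.toLp 2 fun i =>
    d.α t / 2 * (g t 0 + g t 1) - d.speed t (g t) i * W t i, ⟨?_, ?_⟩, ?_⟩
  · refine (PiLp.continuous_toLp 2 _).comp_continuousOn (continuousOn_pi.2 fun i => ?_)
    have hspeedcont := continuousOn_speed hd hgcont i
    fun_prop
  · filter_upwards [hmw, hg.2, hW.2, ae_mem_Icc] with t ht hgt hWt htT
    rw [hgt, hWt] at ht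
    ext i
    exact eq_sub_of_add_eq' (add_eq_of_eq_sub ((equation_iff (hspeed t htT)).1 ht i))
  · ext i
    simp [hg₀, hW₀]

namespace IsSolution

variable {m₀ : Sobolev 2 T} {m m' : ℝ → Sobolev 2 T} {x : ℝ}

variable (hm : d.IsSolution m₀ m)
include hm

theorem hasDerivWithinAt_toH1 (hx : x ∈ Icc 0 d.L) :
    HasDerivWithinAt (fun y => toH1 (m y)) (derivWithin (fun y => toH1 (m y)) (Icc 0 d.L) x)
      (Icc 0 d.L) x :=
  (hm.contDiffOn.differentiableOn_one x hx).hasDerivWithinAt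

theorem vanishesAtZero_derivWithin (hL : 0 < d.L) (hT : 0 < T) (hx : x ∈ Icc 0 d.L) :
    VanishesAtZero (wderiv (derivWithin (fun y => toH1 (m y)) (Icc 0 d.L) x) 0) := by
  have hfix (y : ℝ) (hy : y ∈ Icc 0 d.L) :
      ofTopDeriv 1 hT (topDeriv 1 T (toH1 (m y))) = toH1 (m y) :=
    ofTopDeriv_topDeriv hT (Fin.forall_fin_one.2 (hm.initial y hy))
  have hderiv := hm.hasDerivWithinAt_toH1 hx
  have hfix' := (((ofTopDeriv 1 hT).comp (topDeriv 1 T)).hasFDerivAt.comp_hasDerivWithinAt x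
    hderiv).congr (fun y hy => (hfix y hy).symm) (hfix x hx).symm
  rw [(uniqueDiffOn_Icc hL x hx).eq_deriv _ hderiv hfix']
  exact vanishesAtZero_ofTopDeriv hT _ (0 : Fin 1)

theorem exists_isContRep (hT : 0 < T) (hx : x ∈ Icc 0 d.L) :
    ∃ g, IsContRep (wderiv (m x) 0) g ∧ g 0 = 0 ∧ ∀ t ∈ Icc 0 T, ∀ i, d.speed t (g t) i ≠ 0 := by
  obtain ⟨g, hg, hspeed⟩ := hm.speed_ne_zero x hx
  obtain ⟨g₀, hg₀, hzero⟩ := hm.initial x hx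
  exact ⟨g, hg, (hg.eqOn hT hg₀ (left_mem_Icc.2 hT.le)).trans hzero, hspeed⟩

theorem ofTopDeriv_topDeriv (hd : d.IsSupersonicOn T) (hT : 0 < T) (hx : x ∈ Icc 0 d.L) :
    ofTopDeriv 2 hT (topDeriv 2 T (m x)) = m x := by
  obtain ⟨g, hg, hg₀, hspeed⟩ := hm.exists_isContRep hT hx
  exact SupersonicDuct.ofTopDeriv_topDeriv hT (Fin.forall_fin_two.2 ⟨hm.initial x hx,
    SatisfiesEquation.vanishesAtZero_wderiv_one hd (hm.equation x hx) hg hspeed hg₀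
      (hm.vanishesAtZero_derivWithin hd.L_pos hT hx)⟩)

theorem speed_pos (hd : d.IsSupersonicOn T) (hT : 0 < T) (hx : x ∈ Icc 0 d.L) (i : Fin 2) {t : ℝ}
    (ht : t ∈ Icc 0 T) : 0 < d.speed t
      (WithLp.toLp 2 fun j => value (topDeriv 2 T (m x), topDeriv 2 T (m x)) j t) i := by
  obtain ⟨g, hg, hg₀, hspeed⟩ := hm.exists_isContRep hT hx
  have hvalue := isContRep_ofTopDeriv_zero hT (topDeriv 2 T (m x))
  rw [hm.ofTopDeriv_topDeriv hd hT hx] at hvalue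
  have hgt : g t = WithLp.toLp 2 fun j => value (topDeriv 2 T (m x), topDeriv 2 T (m x)) j t :=
    hg.eqOn hT hvalue ht
  rw [← hgt]
  by_contra! hneg
  have hcont := (continuousOn_speed hd hg.1 i).mono (Icc_subset_Icc_right ht.2)
  have hzero : 0 < d.speed 0 (g 0) i := hg₀ ▸ speed_zero_pos hd hT.le i
  obtain ⟨s, hs, hs₀⟩ := intermediate_value_Icc' ht.1 hcont ⟨hneg, hzero.le⟩
  exact hspeed s ⟨hs.1, hs.2.trans ht.2⟩ i hs₀

theorem continuousOn_topDeriv : ContinuousOn (fun x => topDeriv 2 T (m x)) (Icc 0 d.L) :=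
  (topDeriv 2 T).continuous.comp_continuousOn hm.continuousOn

theorem exists_le_speed (hd : d.IsSupersonicOn T) (hT : 0 < T) :
    ∃ κ, 0 < κ ∧ ∀ x ∈ Icc 0 d.L, ∀ i, ∀ t ∈ Icc 0 T, κ ≤ d.speed t
      (WithLp.toLp 2 fun j => value (topDeriv 2 T (m x), topDeriv 2 T (m x)) j t) i := by
  let f (i : Fin 2) (p : ℝ × ℝ) : ℝ :=
    (system hd hT.le one_pos).speed (topDeriv 2 T (m p.1), topDeriv 2 T (m p.1)) i p.2
  have hfst := hm.continuousOn_topDeriv.comp continuousOn_fst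
    fun p (hp : p ∈ Icc 0 d.L ×ˢ Icc 0 T) => hp.1
  have hcont (i : Fin 2) : ContinuousOn (f i) (Icc 0 d.L ×ˢ Icc 0 T) :=
    (((system hd hT.le one_pos).continuous_speed i).comp_continuousOn (hfst.prodMk hfst)).eval
      continuousOn_snd
  have hpos (i : Fin 2) (p : ℝ × ℝ) (hp : p ∈ Icc 0 d.L ×ˢ Icc 0 T) : 0 < f i p :=
    (hm.speed_pos hd hT hp.1 i hp.2).trans_eq (system_speed_apply hp.2 _ i).symm
  choose κ hκ₀ hκ using fun i =>
    (isCompact_Icc.prod isCompact_Icc).exists_forall_le' (hcont i) (hpos i)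
  refine ⟨min (κ 0) (κ 1), lt_min (hκ₀ 0) (hκ₀ 1), fun x hx i t ht => ?_⟩
  rw [← system_speed_apply (hd := hd) (hT := hT.le) (hκ := one_pos) ht]
  exact le_trans (by fin_cases i <;> simp) (hκ i (x, t) ⟨hx, ht⟩)

theorem hasDerivWithinAt_vecVolterra {hd : d.IsSupersonicOn T} (hT : 0 < T) {κ : ℝ} {hκ : 0 < κ}
    (hx : x ∈ Icc 0 d.L)
    (hu : (topDeriv 2 T (m x), topDeriv 2 T (m x)) ∈ (system hd hT.le hκ).supersonic) :
    HasDerivWithinAt (fun x => vecVolterra (Fin 2) T (topDeriv 2 T (m x)))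
      ((system hd hT.le hκ).xDeriv' (topDeriv 2 T (m x), topDeriv 2 T (m x))) (Icc 0 d.L) x := by
  have hvolterra (y : ℝ) (hy : y ∈ Icc 0 d.L) :
      vecVolterra (Fin 2) T (topDeriv 2 T (m y)) = topDeriv 1 T (toH1 (m y)) := by
    rw [← hm.ofTopDeriv_topDeriv hd hT hy, toH1_ofTopDeriv, topDeriv_ofTopDeriv,
      topDeriv_ofTopDeriv]
  have hlift := SupersonicDuct.ofTopDeriv_topDeriv hT
    (Fin.forall_fin_one.2 (hm.vanishesAtZero_derivWithin hd.L_pos hT hx))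
  have hequation := hm.equation x hx
  rw [← hlift, ← hm.ofTopDeriv_topDeriv hd hT hx] at hequation
  rw [← (satisfiesEquation_ofTopDeriv_iff hu).1 hequation]
  exact ((topDeriv 1 T).hasFDerivAt.comp_hasDerivWithinAt x (hm.hasDerivWithinAt_toH1 hx)).congr
    hvolterra (hvolterra x hx)

theorem eqOn (hd : d.IsSupersonicOn T) (hT : 0 < T) (hm' : d.IsSolution m₀ m') :
    EqOn m m' (Icc 0 d.L) := by
  obtain ⟨κ, hκ, hle⟩ := hm.exists_le_speed hd hT
  obtain ⟨κ', hκ', hle'⟩ := hm'.exists_le_speed hd hT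
  obtain ⟨R, hR⟩ := isCompact_Icc.exists_bound_of_continuousOn hm.continuousOn_topDeriv
  obtain ⟨R', hR'⟩ := isCompact_Icc.exists_bound_of_continuousOn hm'.continuousOn_topDeriv
  let c := system hd hT.le (lt_min hκ hκ')
  have hmem (x : ℝ) (hx : x ∈ Icc 0 d.L) : (topDeriv 2 T (m x), topDeriv 2 T (m x))
      ∈ closedBall 0 (max R R') ∩ c.supersonic :=
    ⟨by simpa using .inl (hR x hx), mem_supersonic_system_iff.2 fun i t ht =>
      (min_le_left _ _).trans (hle x hx i t ht)⟩
  have hmem' (x : ℝ) (hx : x ∈ Icc 0 d.L) : (topDeriv 2 T (m' x), topDeriv 2 T (m' x))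
      ∈ closedBall 0 (max R R') ∩ c.supersonic :=
    ⟨by simpa using .inr (hR' x hx), mem_supersonic_system_iff.2 fun i t ht =>
      (min_le_right _ _).trans (hle' x hx i t ht)⟩
  have htop := DiagonalSystem.eqOn_of_hasDerivWithinAt hmem hmem'
    (fun x hx => hm.hasDerivWithinAt_vecVolterra hT hx (hmem x hx).2)
    (fun x hx => hm'.hasDerivWithinAt_vecVolterra hT hx (hmem' x hx).2)
    (by rw [hm.boundary, hm'.boundary])
  intro x hx
  rw [← hm.ofTopDeriv_topDeriv hd hT hx, ← hm'.ofTopDeriv_topDeriv hd hT hx]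
  exact congrArg (ofTopDeriv 2 hT) (htop hx)

end IsSolution

end Duct

theorem iSup_enorm_le {E : Type*} [SeminormedAddGroup E] {s : Set ℝ} {f : ℝ → E} {C : ℝ}
    (h : ∀ x ∈ s, ‖f x‖ ≤ C) : ⨆ x ∈ s, ‖f x‖ₑ ≤ ENNReal.ofReal C :=
  iSup₂_le fun x hx => by
    rw [← ofReal_norm]
    exact ENNReal.ofReal_le_ofReal (h x hx)

end SupersonicDuct

open SupersonicDuct in
theorem theorem4p2_general (d : Duct) {T : ℝ} (hT : 0 < T) (hd : d.IsSupersonicOn T) :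
    ∃ ε₁ C₁ : ℝ, 0 < ε₁ ∧ 0 < C₁ ∧ ∀ ε : ℝ, 0 < ε → ε < ε₁ → ∀ m₀ : Sobolev 2 T,
      VanishesAtZero (wderiv m₀ 0) → VanishesAtZero (wderiv m₀ 1) → ‖m₀‖ ≤ ε →
      ∃ m : ℝ → Sobolev 2 T, d.IsSolution m₀ m ∧
        (⨆ x ∈ Icc 0 d.L, ‖m x‖ₑ)
          + (⨆ x ∈ Icc 0 d.L, ‖derivWithin (fun y => toH1 (m y)) (Icc 0 d.L) x‖ₑ)
          ≤ ENNReal.ofReal (C₁ * ε) ∧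
        ∀ m' : ℝ → Sobolev 2 T, d.IsSolution m₀ m' → ∀ x ∈ Icc 0 d.L, m' x = m x := by
  obtain ⟨ε₁, C, hε₁, hC, hexists⟩ := Duct.exists_isSolution hd hT
  refine ⟨ε₁, C + C, hε₁, by positivity, fun ε hε hεε₁ m₀ h₀ h₁ hm₀ => ?_⟩
  obtain ⟨m, hm, hle⟩ := hexists m₀ h₀ h₁ (hm₀.trans hεε₁.le)
  have hCε : C * ‖m₀‖ ≤ C * ε := by gcongr
  refine ⟨m, hm, ?_, fun m' hm' => hm'.eqOn hd hT hm⟩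
  rw [add_mul, ENNReal.ofReal_add (by positivity) (by positivity)]
  exact add_le_add (iSup_enorm_le fun x hx => (hle x hx).1.trans hCε)
    (iSup_enorm_le fun x hx => (hle x hx).2.trans hCε)

theorem theorem4p2 (d : SupersonicDuct.Duct) (hd : d.Admissible) (T₀ : ℝ) (hT₀ : 0 < T₀) :
    ∃ ε₁ C₁ T₁ : ℝ, 0 < ε₁ ∧ 0 < C₁ ∧ T₀ < T₁ ∧
      ∀ ε : ℝ, 0 < ε → ε < ε₁ →
      ∀ m₀ : SupersonicDuct.Sobolev 2 T₁,
        SupersonicDuct.VanishesAtZero (SupersonicDuct.wderiv m₀ 0) →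
        SupersonicDuct.VanishesAtZero (SupersonicDuct.wderiv m₀ 1) →
        ‖m₀‖ ≤ ε →
        ∃ m : ℝ → SupersonicDuct.Sobolev 2 T₁,
          d.IsSolution m₀ m ∧
          (⨆ x ∈ Set.Icc 0 d.L, ‖m x‖ₑ)
            + (⨆ x ∈ Set.Icc 0 d.L,
                ‖derivWithin (fun y => SupersonicDuct.toH1 (m y)) (Set.Icc 0 d.L) x‖ₑ)
            ≤ ENNReal.ofReal (C₁ * ε) ∧
          ∀ m' : ℝ → SupersonicDuct.Sobolev 2 T₁, d.IsSolution m₀ m' →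
            ∀ x ∈ Set.Icc 0 d.L, m' x = m x := by
  obtain ⟨ε₁, C₁, hε₁, hC₁, h⟩ :=
    theorem4p2_general d (add_pos hT₀ one_pos) (hd.isSupersonicOn (T₀ + 1))
  exact ⟨ε₁, C₁, T₀ + 1, hε₁, hC₁, lt_add_one T₀, h⟩
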